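/- **Setting.** Let $K>0$, $W\in\mathbb R$, and let $f=f(t,\theta,\omega)$, $(t,\theta,\omega)\in[0,\infty)\times\mathbb T\times\mathbb R$, $\mathbb T=\mathbb R/2\pi\mathbb Z$, be a global classical ($C^1$) solution of the Kuramoto–Sakaguchi equation $$\partial_t f+\partial_\theta(v[f]f)=0,\qquad v[f](t,\theta,\omega)=\omega+K\int_{\mathbb T}\sin(\theta'-\theta)\rho(t,\theta')\,d\theta',\qquad \rho(t,\theta)=\int_{\mathbb R}f(t,\theta,\omega)\,d\omega,$$ such that $f(t,\cdot,\cdot)$ is a probability density for every $t\ge 0$, with initial datum $f_0=f(0,\cdot,\cdot)$ whose frequency distribution $g(\omega)=\int_{\mathbb T}f_0(\theta,\omega)\,d\theta$ is supported in $[-W,W]$. Write $R(t)e^{i\phi(t)}=\int e^{i\theta}f\,d\theta\,d\omega$ with $R\ge 0$, $R_0=R(0)$, and let $\dot R$ be the time derivative (one-sided at $t=0$). For $A\subseteq\mathbb T$ let $f_t^2(A)=\int_{A\times\mathbb R}f(t,\theta,\omega)^2\,d\theta\,d\omega$, $\|f_0\|_2^2=f_0^2(\mathbb T)$, and let $A_{s,t}$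 be the projection to $\mathbb T$ of the image of $A\times[-W,W]$ under the flow of $\dot\theta=v[f](t,\theta,\omega)$, $\dot\omega=0$ from time $s$ to time $t$. Put $\alpha=\pi/6$ and $Q=4\cdot 30^2$, and let $\lambda<1$. **Dyadic times.** Let $R_k=2^{k/2}R_0$, $r_0=0$ and $r_{k+1}=\inf\{t\ge r_k: R(t)^2\ge 2R_k^2\}$ ($\inf\emptyset=\infty$), and let $k_*$ be the largest $k$ with $r_k<\infty$. Let $$\mu_k=\tfrac{\cos^2\alpha}{4}\lambda^3R_k^3,\qquad d_k=\tfrac{1}{3KR_k}\log 10,\qquad \delta_k=\tfrac1{KR_k}\log\tfrac1{R_k},$$ $$T^k_{-1}=\inf\{t\ge r_k:\dot R(t)\le KR_k^3/Q\},\qquad t_0=\min_{0\le k\le k_*}T_{-1}^k,\qquad k_0=\max\{k:r_k\le t_0\}.$$ **Attractor.** Let $\gamma\in(0,\pi/2)$ with $\cos^2\gamma=R_{k_0}/30$, let $\epsilon=R_0/15$, let $L^+_\gamma(t_0)=(\phi(t_0)-\frac\pi2+\gamma,\phi(t_0)+\frac\pi2-\gamma)$, and for $t\ge t_0$ let $L^+_\gamma(t_0)_t=(L^+_\gamma(t_0))_{t_0,t}$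 and $(L^+_\gamma(t_0)_t)_\epsilon=\{\theta:\inf_{\theta^*\in L^+_\gamma(t_0)_t}\cos(\theta-\theta^*)\ge 1-\epsilon\}$. **Subdivision.** Starting from $t_0$, given $t_l<\infty$ with $t_l\in[r_k,r_{k+1})$: if $\dot R(t_l)<K\mu_k$ (then $l\in B_k$), let $t_{l+1}=\sup\{t\in[t_l,r_{k+1}):\dot R<K\mu_k\text{ on }[t_l,t)\}$; if $\dot R(t_l)\ge K\mu_k$ (then $l\in G_k$), let $\widetilde t_{l+1}=\sup\{t\in[t_l,r_{k+1}):\dot R\ge K\mu_k\text{ on }[t_l,t)\}$ and $t_{l+1}=\widetilde t_{l+1}+d_k$ if this is $\le r_{k+1}$, and $t_{l+1}=r_{k+1}$ otherwise. The construction stops if $t_{l+1}=\infty$. Let $b_k=\#B_k$, $g_k=\#G_k$ and $$D_k=\max(b_k,g_k)(\delta_k+d_k)+\sum_{l\in G_k}(\widetilde t_{l+1}-t_l).$$ **Barriers.** Let $s_{k_0}=t_0$, $A_{k_0}=\|f_0\|_2^2e^{4Q/R_0}$, and, for $k_0<k\le k_*$, $s_k=r_k$, $A_k=F_{k-1}(r_k)$,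 where $$F_k(t)=\begin{cases}A_k\,e^{2KR_k(t-s_k)},& s_k\le t\le s_k+D_k,\\ A_k\,e^{2KR_kD_k}\,e^{-\frac{KR_k\sin\alpha}{2}(t-s_k-D_k)},& t\ge s_k+D_k.\end{cases}$$ **Theorem.** There are universal constants $C,B>0$ such that, for all data as above, if $$\frac WK\le C R_0^3\qquad\text{and}\qquad 1-\lambda\le\frac{\cos^2\alpha}{180}R_0,$$ then, for every $k=k_0,\dots,k_*$, the sets $G_k$ and $B_k$ are finite, and for every $t\ge t_0$ with $t\in[r_k,r_{k+1})$ $$f_t^2\big(\mathbb T\setminus(L^+_\gamma(t_0)_t)_\epsilon\big)\le F_k(t)\le\|f_0\|_2^2\,e^{\frac{B}{R_0}\log\left(1+\frac1{R_0}\right)}.$$ -/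

import Mathlib

open Set MeasureTheory
open Real (cos sin exp log sqrt)

noncomputable section

namespace Kuramoto

/-! ## The Kuramoto-Sakaguchi equation

The torus is the real line modulo `2π`: functions on it are `2π`-periodic functions on the
line, subsets of it are `2π`-periodic subsets of the line, and integrals over it are integrals
over the period `(-π, π]`. A density `f` is written `f t θ ω`. -/

/-- A period, over which the torus variable is integrated. -/
def period : Set ℝ := Ioc (-Real.pi) Real.pi

/-- The phase density `ρ(t, θ) = ∫ f(t, θ, ω) dω`. -/
def phaseDensity (f : ℝ → ℝ → ℝ → ℝ) (t θ : ℝ) : ℝ := ∫ ω, f t θ ω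

/-- The frequency distribution `g(ω) = ∫ f(0, θ, ω) dθ`. -/
def freqDist (f : ℝ → ℝ → ℝ → ℝ) (ω : ℝ) : ℝ := ∫ θ in period, f 0 θ ω

/-- The velocity field `v[f](t, θ, ω) = ω + K ∫ sin(θ' - θ) ρ(t, θ') dθ'`. -/
def velocity (K : ℝ) (f : ℝ → ℝ → ℝ → ℝ) (t θ ω : ℝ) : ℝ :=
  ω + K * ∫ θ' in period, sin (θ' - θ) * phaseDensity f t θ'

/-- Global classical solutions of `∂ₜ f + ∂_θ (v[f] f) = 0`: continuously differentiable on
`[0, ∞) × 𝕋 × ℝ`, and a probability density at every time. The initial datum is `f 0`. -/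
structure IsClassicalSolution (K : ℝ) (f : ℝ → ℝ → ℝ → ℝ) : Prop where
  contDiffOn : ContDiffOn ℝ 1 (fun p : ℝ × ℝ × ℝ => f p.1 p.2.1 p.2.2) (Ici 0 ×ˢ univ)
  periodic : ∀ t, 0 ≤ t → ∀ θ ω, f t (θ + 2 * Real.pi) ω = f t θ ω
  nonneg : ∀ t, 0 ≤ t → ∀ θ ω, 0 ≤ f t θ ω
  mass_one : ∀ t, 0 ≤ t → ∫ p in period ×ˢ (univ : Set ℝ), f t p.1 p.2 = 1
  equation : ∀ t, 0 ≤ t → ∀ θ ω,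
    derivWithin (fun s => f s θ ω) (Ici 0) t
      + deriv (fun x => velocity K f t x ω * f t x ω) θ = 0

/-- The complex order parameter `∫ e^{iθ} f dθ dω = R e^{iφ}`. -/
def orderParam (f : ℝ → ℝ → ℝ → ℝ) (t : ℝ) : ℂ :=
  ∫ p in period ×ˢ (univ : Set ℝ), Complex.exp (Complex.I * (p.1 : ℂ)) * (f t p.1 p.2 : ℂ)

/-- The modulus `R(t)` of the order parameter. -/
def orderR (f : ℝ → ℝ → ℝ → ℝ) (t : ℝ) : ℝ := ‖orderParam f t‖

/-- A representative of the phase `φ(t)` of the order parameter (only its class modulo `2π`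
is used). -/
def orderPhase (f : ℝ → ℝ → ℝ → ℝ) (t : ℝ) : ℝ := (orderParam f t).arg

/-- `f²_t(A) = ∫_{A × ℝ} f(t, θ, ω)² dθ dω` for a subset `A` of the torus. -/
def sqMass (f : ℝ → ℝ → ℝ → ℝ) (t : ℝ) (A : Set ℝ) : ℝ :=
  ∫ p in (period ∩ A) ×ˢ (univ : Set ℝ), (f t p.1 p.2) ^ 2

/-! ## Characteristics and attractor sets -/

/-- The arc `(φ - π/2 + γ, φ + π/2 - γ)` of the torus. -/
def arcPlus (γ φ : ℝ) : Set ℝ :=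
  {θ | ∃ n : ℤ, θ + 2 * Real.pi * n ∈ Ioo (φ - Real.pi / 2 + γ) (φ + Real.pi / 2 - γ)}

/-- `x` is (a lift of) a characteristic of frequency `ω`, i.e. `x' = v[f](t, x, ω)` on `[0, ∞)`. -/
def IsCharacteristic (K : ℝ) (f : ℝ → ℝ → ℝ → ℝ) (ω : ℝ) (x : ℝ → ℝ) : Prop :=
  ∀ t, 0 ≤ t → HasDerivWithinAt x (velocity K f t (x t) ω) (Ici 0) t

/-- The set `A_{s,t}`: the projection to the torus of the image of `A × [-W, W]` under the
characteristic flow from time `s` to time `t`. -/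
def transport (K W : ℝ) (f : ℝ → ℝ → ℝ → ℝ) (s t : ℝ) (A : Set ℝ) : Set ℝ :=
  {y | ∃ ω ∈ Icc (-W) W, ∃ x : ℝ → ℝ, IsCharacteristic K f ω x ∧ x s ∈ A ∧ x t = y}

/-- `(L)_ε = {θ : inf_{θ* ∈ L} cos(θ - θ*) ≥ 1 - ε}`. -/
def cosNhd (ε : ℝ) (L : Set ℝ) : Set ℝ := {θ | ∀ θs ∈ L, 1 - ε ≤ cos (θ - θs)}

/-! ## The dyadic hierarchy and the subdivision

These depend on the solution only through the function `R` on `[0, ∞)`. -/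

/-- The fixed angle `α = π/6`. -/
def alpha : ℝ := Real.pi / 6

/-- The universal constant `Q`; its inverse enters the threshold that defines `initialTimeAt`. -/
def constQ : ℝ := 4 * 30 ^ 2

/-- The time derivative of `R`, one-sided at time `0`. -/
def dotR (R : ℝ → ℝ) (t : ℝ) : ℝ := derivWithin R (Ici 0) t

/-- `R_k`, with `R_0 = R(0)` and `R_{k+1}² = 2 R_k²`. -/
def level (R : ℝ → ℝ) (k : ℕ) : ℝ := sqrt 2 ^ k * R 0

/-- `r_0 = 0` and `r_{k+1} = inf {t ≥ r_k : R(t)² ≥ 2 R_k²}`, with `inf ∅ = ∞`. -/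
def rTime (R : ℝ → ℝ) : ℕ → EReal
  | 0 => 0
  | k + 1 => sInf {τ | ∃ t : ℝ, τ = (t : EReal) ∧ rTime R k ≤ (t : EReal) ∧
      2 * level R k ^ 2 ≤ R t ^ 2}

/-- The threshold `μ_k`. -/
def mu (R : ℝ → ℝ) (lam : ℝ) (k : ℕ) : ℝ := cos alpha ^ 2 / 4 * lam ^ 3 * level R k ^ 3

/-- The time length `d_k`. -/
def dLen (R : ℝ → ℝ) (K : ℝ) (k : ℕ) : ℝ := 1 / (3 * K * level R k) * log 10

/-- The time length `δ_k`. -/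
def deltaLen (R : ℝ → ℝ) (K : ℝ) (k : ℕ) : ℝ := 1 / (K * level R k) * log (1 / level R k)

/-- `T_{-1}^k`: the first time after `r_k` at which `R' ≤ K R_k³ / Q`. -/
def initialTimeAt (R : ℝ → ℝ) (K : ℝ) (k : ℕ) : ℝ :=
  sInf {t : ℝ | rTime R k ≤ (t : EReal) ∧ dotR R t ≤ K * level R k ^ 3 / constQ}

/-- `t_0`, the least of the times `T_{-1}^k` over the finitely many `k` with `r_k < ∞`. -/
def initialTime (R : ℝ → ℝ) (K : ℝ) : ℝ :=
  sInf {T : ℝ | ∃ k : ℕ, rTime R k < ⊤ ∧ T = initialTimeAt R K k}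

/-- The largest `k` with `r_k ≤ τ`; for `τ < ∞` this is the `k` with `τ ∈ [r_k, r_{k+1})`. -/
def indexAt (R : ℝ → ℝ) (τ : EReal) : ℕ := sSup {k : ℕ | rTime R k ≤ τ}

/-- `k_0 = max {k : r_k ≤ t_0}`. -/
def kZero (R : ℝ → ℝ) (K : ℝ) : ℕ := indexAt R (initialTime R K : EReal)

/-- The angle `γ ∈ (0, π/2)` with `cos² γ = R_{k_0} / 30`. -/
def gammaAngle (R : ℝ → ℝ) (K : ℝ) : ℝ := Real.arccos (sqrt (level R (kZero R K) / 30))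

/-- The supremum of the `t ∈ [s, r_{k+1})` with `R' < K μ_k` on `[s, t)`. -/
def badEnd (R : ℝ → ℝ) (K lam : ℝ) (k : ℕ) (s : ℝ) : EReal :=
  sSup {τ | ∃ t : ℝ, τ = (t : EReal) ∧ s ≤ t ∧ (t : EReal) < rTime R (k + 1) ∧
    ∀ u ∈ Ico s t, dotR R u < K * mu R lam k}

/-- The supremum of the `t ∈ [s, r_{k+1})` with `R' ≥ K μ_k` on `[s, t)`. -/
def goodCoreEnd (R : ℝ → ℝ) (K lam : ℝ) (k : ℕ) (s : ℝ) : EReal :=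
  sSup {τ | ∃ t : ℝ, τ = (t : EReal) ∧ s ≤ t ∧ (t : EReal) < rTime R (k + 1) ∧
    ∀ u ∈ Ico s t, K * mu R lam k ≤ dotR R u}

open Classical in
/-- The right end of an interval of the subdivision with left end `s ∈ [r_k, r_{k+1})`. -/
def nextEnd (R : ℝ → ℝ) (K lam : ℝ) (k : ℕ) (s : ℝ) : EReal :=
  if dotR R s < K * mu R lam k then badEnd R K lam k s
  else if goodCoreEnd R K lam k s + (dLen R K k : EReal) ≤ rTime R (k + 1) then
    goodCoreEnd R K lam k s + (dLen R K k : EReal)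
  else rTime R (k + 1)

open Classical in
/-- The times `t_l` of the subdivision. The value `∞` marks the end of the subdivision. -/
def subTime (R : ℝ → ℝ) (K lam : ℝ) : ℕ → EReal
  | 0 => (initialTime R K : EReal)
  | l + 1 =>
    if subTime R K lam l = ⊤ then ⊤
    else nextEnd R K lam (indexAt R (subTime R K lam l)) (subTime R K lam l).toReal

/-- `G_k`: the indices of the intervals of good type that start in `[r_k, r_{k+1})`. -/
def goodSet (R : ℝ → ℝ) (K lam : ℝ) (k : ℕ) : Set ℕ :=
  {l | rTime R k ≤ subTime R K lam l ∧ subTime R K lam l < rTime R (k + 1) ∧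
    K * mu R lam k ≤ dotR R (subTime R K lam l).toReal}

/-- `B_k`: the indices of the intervals of bad type that start in `[r_k, r_{k+1})`. -/
def badSet (R : ℝ → ℝ) (K lam : ℝ) (k : ℕ) : Set ℕ :=
  {l | rTime R k ≤ subTime R K lam l ∧ subTime R K lam l < rTime R (k + 1) ∧
    dotR R (subTime R K lam l).toReal < K * mu R lam k}

/-- `D_k = max (b_k, g_k) (δ_k + d_k) + ∑_{l ∈ G_k} (t̃_{l+1} - t_l)`. -/
def dwell (R : ℝ → ℝ) (K lam : ℝ) (k : ℕ) : ℝ :=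
  (max (badSet R K lam k).ncard (goodSet R K lam k).ncard : ℕ) * (deltaLen R K k + dLen R K k)
    + ∑ᶠ l ∈ goodSet R K lam k,
        ((goodCoreEnd R K lam k (subTime R K lam l).toReal).toReal
          - (subTime R K lam l).toReal)

/-! ## The barriers -/

open Classical in
/-- The profile that starts from `A` at time `s`, grows at rate `2 K R_k` during a time `D_k`, and
then decays at rate `K R_k sin α / 2`. -/
def profile (R : ℝ → ℝ) (K lam : ℝ) (k : ℕ) (s A t : ℝ) : ℝ :=
  if t ≤ s + dwell R K lam k then A * exp (2 * K * level R k * (t - s))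
  else A * exp (2 * K * level R k * dwell R K lam k)
    * exp (-(K * (level R k * sin alpha / 2) * (t - s - dwell R K lam k)))

/-- The barriers `F_k` for `k ≥ k_0` (values for `k < k_0` are not used); `E` is the squared `L²`
norm of the initial datum. `F_{k_0}` starts from `E e^{4 Q / R_0}` at time `t_0`, and `F_k` starts
from `F_{k-1}(r_k)` at time `r_k` for `k > k_0`. -/
def barrier (R : ℝ → ℝ) (K lam E : ℝ) : ℕ → ℝ → ℝ
  | 0 => profile R K lam 0 (initialTime R K) (E * exp (4 * constQ / R 0))
  | k + 1 =>
    if k + 1 ≤ kZero R K then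
      profile R K lam (k + 1) (initialTime R K) (E * exp (4 * constQ / R 0))
    else
      profile R K lam (k + 1) (rTime R (k + 1)).toReal
        (barrier R K lam E k (rTime R (k + 1)).toReal)

/-- `(L⁺_γ(t_0)_t)_ε` with `ε = R_0 / 15`. -/
def attractor (K W : ℝ) (f : ℝ → ℝ → ℝ → ℝ) (t : ℝ) : Set ℝ :=
  cosNhd (orderR f 0 / 15)
    (transport K W f (initialTime (orderR f) K) t
      (arcPlus (gammaAngle (orderR f) K) (orderPhase f (initialTime (orderR f) K))))

end Kuramoto

end

/-! The engine is the persistence of a cluster. With `S = R sin(θ - φ)` and the dissipation `I = ∫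
S² f`, one has `(R²/2)' = K I - ∫ ω S f`. Slow growth of `R` therefore forces `I` to be small, so
the mass sits near `φ` or its antipode; as the mean of `cos(θ - φ)` is `R`, a fraction close to `(1
+ R)/2` sits near `φ` (`clusterMass_init`). A cluster with more than half of the mass pulls its own
edge inwards more strongly than the small frequencies push outwards, so it keeps its mass in the
frame of a zero-frequency characteristic (`clusterMass_ge`).

Two facts about `R` follow. At a maximum from which `R` would descend the dissipation is tiny, so a
cluster forms there and holds `R` up: `R` stays very close to its running maximum (`modulus_drop`,
`runMax_sub_le`). A large dissipation cannot vanish faster than on the time scale `1/(K R)`, so it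
raises the running maximum by a definite amount (`runMax_gain`).

For the `L²` estimate, let `y = 1 - cos Δ` be the gap to the centre of the cluster born at `t_0`,
and `h` the component of the order parameter along that centre. At zero frequency `∫ y f²` decays at
the exact rate `K h`; the frequencies are handled by cutting the weight off near the centre
(`weight_rate_le`, `weightedSq_decay`). When `h` is small compared with `R_k`, the order parameter
is nearly orthogonal to the cluster, whose mass then dissipates and raises the running maximum; this
can happen only for a bounded time (`integral_hComp_ge`). Hence the functional decays at rate `K R_k
/ 4` up to a factor `e^{100/R_k}` per level. Since `K R_k sin α / 2 = K R_k / 4` is the fastest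
decay of `F_k`, and the `1/R_k` form a geometric sequence, the functional stays below the barriers
up to `e^{O(1/R_0)}` (`le_profile`, `le_barrier`). Only `D_k ≥ 0` matters here.

The factor `e^{4Q/R_0} = e^{14400/R_0}` pays for all losses. Before `t_0` the lower bound on `R'`
makes `K ∫ R` at most of order `1/R_0`, and the norm grows by at most `e^{10190/R_0}`. After the
further time `1000/(K R_0)` the transported arc lies at the centre of the cluster, so `50/R_0` times
the weight dominates the indicator of the complement of the attractor
(`gap_ge_of_notMem_attractor`); during that time a crude bound on the total norm suffices
(`sqNorm_le_barrier`).

The upper bound on `F_k` is a counting argument: the running maximum at the times `t_l` is a bounded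
potential that rises across every good interval, and every bad interval is followed by a good one
(`count_of_potential`, `dwell_bound`). -/

noncomputable section

namespace Kuramoto

/-! ## Parametric integrals -/

section Parametric

variable {X : Type*} [TopologicalSpace X] [MeasurableSpace X] [BorelSpace X]
  [T2Space X] {m : Measure X} [IsFiniteMeasureOnCompacts m]
  [IsLocallyFiniteMeasure m] [SFinite m]

/-- Differentiation under the integral sign over a compact set, from the right at `0`. -/
theorem hasDerivWithinAt_setIntegral {s : Set X} (hs : IsCompact s) {Φ Φ' : ℝ → X → ℝ} {T : ℝ}
    (hΦ : Continuous (Function.uncurry Φ)) (hΦ' : Continuous (Function.uncurry Φ'))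
    (hd : ∀ t ∈ Ico 0 T, ∀ x, HasDerivWithinAt (fun u => Φ u x) (Φ' t x) (Ici 0) t)
    {t : ℝ} (ht : t ∈ Ico 0 T) :
    HasDerivWithinAt (fun u => ∫ x in s, Φ u x ∂m) (∫ x in s, Φ' t x ∂m) (Ici 0) t := by
  have hc' : Continuous fun u => ∫ x in s, Φ' u x ∂m :=
    continuous_parametric_integral_of_continuous hΦ' hs
  -- Fubini turns the integral into a primitive in time of a continuous function; the fundamental
  -- theorem of calculus then gives the derivative.
  have key : ∀ u ∈ Ico 0 T, ∫ x in s, Φ u x ∂m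
      = (∫ x in s, Φ 0 x ∂m) + ∫ r in (0 : ℝ)..u, ∫ x in s, Φ' r x ∂m := by
    intro u hu
    have h1 : ∀ x, Φ u x = Φ 0 x + ∫ r in (0 : ℝ)..u, Φ' r x := by
      intro x
      rw [intervalIntegral.integral_eq_sub_of_hasDerivAt_of_le hu.1
        (f := fun r => Φ r x)]
      · ring
      · exact (hΦ.comp (by fun_prop : Continuous fun r : ℝ => (r, x))).continuousOn
      · intro r hr
        exact (hd r ⟨hr.1.le, hr.2.trans hu.2⟩ x).hasDerivAt (Ici_mem_nhds hr.1)
      · exact (hΦ'.comp (by fun_prop : Continuous fun r : ℝ => (r, x))).intervalIntegrable _ _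
    have hint : Integrable (Function.uncurry fun x r => Φ' r x)
        ((m.restrict s).prod (volume.restrict (Ioc 0 u))) := by
      rw [Measure.prod_restrict]
      have : IntegrableOn (Function.uncurry fun x r => Φ' r x) (s ×ˢ Icc 0 u)
          (m.prod volume) := by
        apply ContinuousOn.integrableOn_compact (hs.prod isCompact_Icc)
        exact (hΦ'.comp continuous_swap).continuousOn
      exact this.mono_set (prod_mono le_rfl Ioc_subset_Icc_self)
    have h0 : IntegrableOn (fun x => Φ 0 x) s m :=
      ContinuousOn.integrableOn_compact hs
        (hΦ.comp (by fun_prop : Continuous fun x : X => ((0 : ℝ), x))).continuousOn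
    simp_rw [intervalIntegral.integral_of_le hu.1] at h1 ⊢
    simp_rw [h1]
    rw [← integral_integral_swap hint]
    exact integral_add h0 hint.integral_prod_left
  have h2 : HasDerivAt (fun u => (∫ x in s, Φ 0 x ∂m)
      + ∫ r in (0 : ℝ)..u, ∫ x in s, Φ' r x ∂m) (∫ x in s, Φ' t x ∂m) t :=
    (intervalIntegral.integral_hasDerivAt_right (hc'.intervalIntegrable _ _)
      (hc'.stronglyMeasurableAtFilter _ _) hc'.continuousAt).const_add _
  refine h2.hasDerivWithinAt.congr_of_eventuallyEq ?_ (key t ht)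
  filter_upwards [inter_mem_nhdsWithin (Ici 0) (Iio_mem_nhds ht.2)] with u hu
  exact key u ⟨hu.1, hu.2⟩

end Parametric

/-- Compact subset of the phase space that carries the solution: one period and the band of
frequencies `[-W, W]`. -/
def box (W : ℝ) : Set (ℝ × ℝ) := Icc (-Real.pi) Real.pi ×ˢ Icc (-W) W

theorem isCompact_box (W : ℝ) : IsCompact (box W) := isCompact_Icc.prod isCompact_Icc

theorem measurableSet_box (W : ℝ) : MeasurableSet (box W) := (isCompact_box W).measurableSet

/-- The integral over a period of the derivative of a periodic function vanishes. -/
theorem integral_deriv_periodic {g g' : ℝ → ℝ} (hg : ∀ θ, HasDerivAt g (g' θ) θ)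
    (hg' : Continuous g') (hp : ∀ θ, g (θ + 2 * Real.pi) = g θ) :
    ∫ θ in Icc (-Real.pi) Real.pi, g' θ = 0 := by
  rw [integral_Icc_eq_integral_Ioc,
    ← intervalIntegral.integral_of_le (by linarith [Real.pi_pos]),
    intervalIntegral.integral_eq_sub_of_hasDerivAt (fun θ _ => hg θ)
      (hg'.intervalIntegrable _ _)]
  have := hp (-Real.pi)
  rw [show -Real.pi + 2 * Real.pi = Real.pi by ring] at this
  rw [this, sub_self]

theorem setIntegral_box_deriv_periodic (W : ℝ) {g g' : ℝ × ℝ → ℝ}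
    (hg : ∀ p, HasDerivAt (fun θ => g (θ, p.2)) (g' p) p.1) (hg' : Continuous g')
    (hp : ∀ θ ω, g (θ + 2 * Real.pi, ω) = g (θ, ω)) :
    ∫ p in box W, g' p = 0 := by
  have hint : IntegrableOn g' (box W) :=
    hg'.continuousOn.integrableOn_compact (isCompact_box W)
  rw [Measure.volume_eq_prod] at hint ⊢
  unfold box at hint ⊢
  rw [← setIntegral_prod_swap, setIntegral_prod]
  · have : ∀ ω, ∫ θ in Icc (-Real.pi) Real.pi, g' (θ, ω) = 0 := fun ω =>
      integral_deriv_periodic (g := fun θ => g (θ, ω)) (fun θ => hg (θ, ω))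
        (hg'.comp (by fun_prop)) (fun θ => hp θ ω)
    simp only [Prod.swap_prod_mk, this, integral_zero]
  · exact hint.swap

/-! ## The solution on the compact phase space -/

/-- The velocity field written with the components `a + i b` of the order parameter. -/
def vel (K : ℝ) (a b : ℝ → ℝ) (t : ℝ) (p : ℝ × ℝ) : ℝ :=
  p.2 + K * (b t * cos p.1 - a t * sin p.1)

/-- The divergence of the velocity field. -/
def velDiv (K : ℝ) (a b : ℝ → ℝ) (t : ℝ) (p : ℝ × ℝ) : ℝ :=
  -K * (b t * sin p.1 + a t * cos p.1)

/-- A classical solution with frequencies in `[-W, W]`, extended to negative times by its value at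
time `0`, with its partial derivatives and the components of its order parameter. -/
structure Flow (K W : ℝ) (a b : ℝ → ℝ) (F Ft Fθ : ℝ → ℝ × ℝ → ℝ) : Prop where
  cont : Continuous (Function.uncurry F)
  cont_t : Continuous (Function.uncurry Ft)
  cont_θ : Continuous (Function.uncurry Fθ)
  deriv_t : ∀ t, 0 ≤ t → ∀ p, HasDerivWithinAt (fun u => F u p) (Ft t p) (Ici 0) t
  deriv_θ : ∀ t p, HasDerivAt (fun θ => F t (θ, p.2)) (Fθ t p) p.1
  periodic : ∀ t θ ω, F t (θ + 2 * Real.pi, ω) = F t (θ, ω)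
  nonneg : ∀ t p, 0 ≤ F t p
  support : ∀ t p, p.2 ∉ Icc (-W) W → F t p = 0
  mass : ∀ t, ∫ p in box W, F t p = 1
  a_eq : ∀ t, a t = ∫ p in box W, cos p.1 * F t p
  b_eq : ∀ t, b t = ∫ p in box W, sin p.1 * F t p
  equation : ∀ t, 0 ≤ t → ∀ p,
    Ft t p = -(vel K a b t p * Fθ t p + velDiv K a b t p * F t p)

/-- The extension of a solution to negative times by its value at time `0`. -/
def ext (f : ℝ → ℝ → ℝ → ℝ) (t : ℝ) (p : ℝ × ℝ) : ℝ := f (max t 0) p.1 p.2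

theorem setIntegral_period_univ {W : ℝ} {Φ : ℝ × ℝ → ℝ} (h : ∀ p : ℝ × ℝ, p.2 ∉ Icc (-W) W → Φ p = 0) :
    ∫ p in period ×ˢ (univ : Set ℝ), Φ p = ∫ p in box W, Φ p := by
  have h1 : ∫ p in period ×ˢ (univ : Set ℝ), Φ p = ∫ p in period ×ˢ Icc (-W) W, Φ p := by
    apply setIntegral_eq_of_subset_of_forall_sdiff_eq_zero
    · exact measurableSet_Ioc.prod MeasurableSet.univ
    · exact prod_mono le_rfl (subset_univ _)
    · rintro p ⟨hp, hp'⟩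
      exact h p fun h2 => hp' ⟨hp.1, h2⟩
  rw [h1]
  unfold box period
  rw [Measure.volume_eq_prod, ← Measure.prod_restrict, ← Measure.prod_restrict,
    Measure.restrict_congr_set Ioc_ae_eq_Icc]

/-! ### Reduction of the solution to a `Flow` -/

namespace IsClassicalSolution

variable {K W : ℝ} {f : ℝ → ℝ → ℝ → ℝ}

theorem integrable (hf : IsClassicalSolution K f) {t : ℝ} (ht : 0 ≤ t) :
    IntegrableOn (fun p : ℝ × ℝ => f t p.1 p.2) (period ×ˢ (univ : Set ℝ)) := by
  by_contra h
  have := hf.mass_one t ht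
  -- A non-integrable function has integral `0` by convention, which contradicts mass one.
  rw [integral_undef h] at this
  exact zero_ne_one this

theorem integrable_mul (hf : IsClassicalSolution K f) {t : ℝ} (ht : 0 ≤ t) {u : ℝ → ℝ}
    (hu : Continuous u) (hb : ∀ x, |u x| ≤ 1) :
    IntegrableOn (fun p : ℝ × ℝ => u p.1 * f t p.1 p.2) (period ×ˢ (univ : Set ℝ)) :=
  (hf.integrable ht).bdd_mul (c := 1) (by fun_prop) (Filter.Eventually.of_forall fun p => hb p.1)

theorem orderParam_re (hf : IsClassicalSolution K f) {t : ℝ} (ht : 0 ≤ t) :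
    (orderParam f t).re = ∫ p in period ×ˢ (univ : Set ℝ), cos p.1 * f t p.1 p.2 := by
  have h := (hf.integrable ht).ofReal (𝕜 := ℂ)
  have h2 : IntegrableOn (fun p : ℝ × ℝ => Complex.exp (Complex.I * (p.1 : ℂ)) * (f t p.1 p.2 : ℂ))
      (period ×ˢ (univ : Set ℝ)) := by
    refine h.bdd_mul (c := 1) (by fun_prop) (Filter.Eventually.of_forall fun p => ?_)
    rw [mul_comm, Complex.norm_exp_ofReal_mul_I]
  unfold orderParam
  have := integral_re h2
  simp only [RCLike.re_to_complex] at this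
  rw [← this]
  congr 1; ext p
  rw [Complex.re_mul_ofReal, mul_comm Complex.I, Complex.exp_ofReal_mul_I_re]

theorem orderParam_im (hf : IsClassicalSolution K f) {t : ℝ} (ht : 0 ≤ t) :
    (orderParam f t).im = ∫ p in period ×ˢ (univ : Set ℝ), sin p.1 * f t p.1 p.2 := by
  have h := (hf.integrable ht).ofReal (𝕜 := ℂ)
  have h2 : IntegrableOn (fun p : ℝ × ℝ => Complex.exp (Complex.I * (p.1 : ℂ)) * (f t p.1 p.2 : ℂ))
      (period ×ˢ (univ : Set ℝ)) := by
    refine h.bdd_mul (c := 1) (by fun_prop) (Filter.Eventually.of_forall fun p => ?_)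
    rw [mul_comm, Complex.norm_exp_ofReal_mul_I]
  unfold orderParam
  have := integral_im h2
  simp only [RCLike.im_to_complex] at this
  rw [← this]
  congr 1; ext p
  rw [Complex.im_mul_ofReal, mul_comm Complex.I, Complex.exp_ofReal_mul_I_im]

/-- The addition formula for the sine makes the nonlocal term depend on the solution only through
its order parameter. -/
theorem velocity_eq (hf : IsClassicalSolution K f) {t : ℝ} (ht : 0 ≤ t) (θ ω : ℝ) :
    velocity K f t θ ω
      = ω + K * ((orderParam f t).im * cos θ - (orderParam f t).re * sin θ) := by
  have hi : IntegrableOn (fun p : ℝ × ℝ => sin (p.1 - θ) * f t p.1 p.2)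
      (period ×ˢ (univ : Set ℝ)) :=
    hf.integrable_mul ht (u := fun x => sin (x - θ)) (by fun_prop) fun x => Real.abs_sin_le_one _
  have h1 : ∫ θ' in period, sin (θ' - θ) * phaseDensity f t θ'
      = ∫ p in period ×ˢ (univ : Set ℝ), sin (p.1 - θ) * f t p.1 p.2 := by
    rw [Measure.volume_eq_prod] at hi ⊢
    rw [setIntegral_prod _ hi]
    simp only [phaseDensity, Measure.restrict_univ, integral_const_mul]
  have h2 : ∫ p in period ×ˢ (univ : Set ℝ), sin (p.1 - θ) * f t p.1 p.2
      = (orderParam f t).im * cos θ - (orderParam f t).re * sin θ := by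
    rw [hf.orderParam_im ht, hf.orderParam_re ht, ← integral_mul_const, ← integral_mul_const,
      ← integral_sub]
    · congr 1; ext p
      rw [Real.sin_sub]; ring
    · exact (hf.integrable_mul ht Real.continuous_sin Real.abs_sin_le_one).mul_const _
    · exact (hf.integrable_mul ht Real.continuous_cos Real.abs_cos_le_one).mul_const _
  rw [velocity, h1, h2]

/-- The total derivative on `[0, ∞) × 𝕋 × ℝ`, extended to negative times. -/
def extDeriv (f : ℝ → ℝ → ℝ → ℝ) (t : ℝ) (p : ℝ × ℝ) : ℝ × ℝ × ℝ →L[ℝ] ℝ :=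
  fderivWithin ℝ (fun p : ℝ × ℝ × ℝ => f p.1 p.2.1 p.2.2) (Ici 0 ×ˢ univ) (max t 0, p)

theorem uniqueDiffOn_halfSpace : UniqueDiffOn ℝ (Ici (0 : ℝ) ×ˢ (univ : Set (ℝ × ℝ))) :=
  (uniqueDiffOn_Ici 0).prod uniqueDiffOn_univ

theorem hasFDerivWithinAt (hf : IsClassicalSolution K f) (t : ℝ) (p : ℝ × ℝ) :
    HasFDerivWithinAt (fun p : ℝ × ℝ × ℝ => f p.1 p.2.1 p.2.2) (extDeriv f t p)
      (Ici 0 ×ˢ univ) (max t 0, p) :=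
  (hf.contDiffOn.differentiableOn one_ne_zero (max t 0, p)
    ⟨mem_Ici.2 (le_max_right t 0), mem_univ _⟩).hasFDerivWithinAt

theorem continuous_ext (hf : IsClassicalSolution K f) :
    Continuous (Function.uncurry (ext f)) := by
  have := hf.contDiffOn.continuousOn.comp_continuous
    (f := fun q : ℝ × ℝ × ℝ => (max q.1 0, q.2)) (by fun_prop)
    (fun q => ⟨le_max_right q.1 0, mem_univ _⟩)
  exact this

theorem continuous_extDeriv (hf : IsClassicalSolution K f) :
    Continuous (Function.uncurry (extDeriv f)) := by
  have := (hf.contDiffOn.continuousOn_fderivWithin uniqueDiffOn_halfSpace le_rfl).comp_continuous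
    (f := fun q : ℝ × ℝ × ℝ => (max q.1 0, q.2)) (by fun_prop)
    (fun q => ⟨le_max_right q.1 0, mem_univ _⟩)
  exact this

theorem hasDerivWithinAt_ext (hf : IsClassicalSolution K f) {t : ℝ} (ht : 0 ≤ t) (p : ℝ × ℝ) :
    HasDerivWithinAt (fun u => ext f u p) (extDeriv f t p (1, 0, 0)) (Ici 0) t := by
  have h := hf.hasFDerivWithinAt t p
  rw [max_eq_left ht] at h
  have hc : HasDerivWithinAt (fun u : ℝ => (u, p)) ((1 : ℝ), (0 : ℝ × ℝ)) (Ici 0) t :=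
    (hasDerivWithinAt_id t _).prodMk (hasDerivWithinAt_const t _ p)
  have h2 := h.comp_hasDerivWithinAt t hc (fun u hu => mk_mem_prod hu (mem_univ _))
  refine h2.congr (fun u hu => ?_) ?_
  · simp [ext, max_eq_left (mem_Ici.1 hu)]
  · simp [ext, max_eq_left ht]

theorem hasDerivAt_ext (hf : IsClassicalSolution K f) (t : ℝ) (p : ℝ × ℝ) :
    HasDerivAt (fun θ => ext f t (θ, p.2)) (extDeriv f t p (0, 1, 0)) p.1 := by
  have h := hf.hasFDerivWithinAt t p
  have hc : HasDerivWithinAt (fun θ : ℝ => (max t 0, θ, p.2)) ((0 : ℝ), (1 : ℝ), (0 : ℝ)) univ p.1 :=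
    (hasDerivWithinAt_const _ _ _).prodMk
      ((hasDerivWithinAt_id _ _).prodMk (hasDerivWithinAt_const _ _ _))
  have h2 := h.comp_hasDerivWithinAt p.1 hc
    (fun u _ => mk_mem_prod (mem_Ici.2 (le_max_right t 0)) (mem_univ _))
  exact (hasDerivWithinAt_univ.1 h2)

theorem ext_nonneg (hf : IsClassicalSolution K f) (t : ℝ) (p : ℝ × ℝ) : 0 ≤ ext f t p :=
  hf.nonneg _ (le_max_right _ _) _ _

theorem ext_periodic (hf : IsClassicalSolution K f) (t θ ω : ℝ) :
    ext f t (θ + 2 * Real.pi, ω) = ext f t (θ, ω) :=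
  hf.periodic _ (le_max_right _ _) _ _

/-- The components of the order parameter, extended to negative times. -/
def extRe (f : ℝ → ℝ → ℝ → ℝ) (t : ℝ) : ℝ := (orderParam f (max t 0)).re

/-- The imaginary part of the order parameter, extended to negative times. -/
def extIm (f : ℝ → ℝ → ℝ → ℝ) (t : ℝ) : ℝ := (orderParam f (max t 0)).im

theorem hasDerivAt_vel (K : ℝ) (a b : ℝ → ℝ) (t : ℝ) (p : ℝ × ℝ) :
    HasDerivAt (fun θ => vel K a b t (θ, p.2)) (velDiv K a b t p) p.1 := by
  unfold vel velDiv
  have := ((((Real.hasDerivAt_cos p.1).const_mul (b t)).sub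
    ((Real.hasDerivAt_sin p.1).const_mul (a t))).const_mul K).const_add p.2
  exact this.congr_deriv (by ring)

theorem ext_equation (hf : IsClassicalSolution K f) {t : ℝ} (ht : 0 ≤ t) (p : ℝ × ℝ) :
    extDeriv f t p (1, 0, 0) = -(vel K (extRe f) (extIm f) t p * extDeriv f t p (0, 1, 0)
      + velDiv K (extRe f) (extIm f) t p * ext f t p) := by
  have h1 : derivWithin (fun s => f s p.1 p.2) (Ici 0) t = extDeriv f t p (1, 0, 0) := by
    have := hf.hasDerivWithinAt_ext ht p
    refine HasDerivWithinAt.derivWithin ?_ (uniqueDiffOn_Ici 0 t ht)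
    refine this.congr (fun u hu => ?_) ?_
    · simp [ext, max_eq_left (mem_Ici.1 hu)]
    · simp [ext, max_eq_left ht]
  have h2 : deriv (fun x => velocity K f t x p.2 * f t x p.2) p.1
      = vel K (extRe f) (extIm f) t p * extDeriv f t p (0, 1, 0)
      + velDiv K (extRe f) (extIm f) t p * ext f t p := by
    have h3 : (fun x => velocity K f t x p.2 * f t x p.2)
        = fun x => vel K (extRe f) (extIm f) t (x, p.2) * ext f t (x, p.2) := by
      ext x
      rw [hf.velocity_eq ht]
      simp [vel, ext, extRe, extIm, max_eq_left ht]
    have h4 := (hasDerivAt_vel K (extRe f) (extIm f) t p).fun_mul (hf.hasDerivAt_ext t p)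
    rw [h3, h4.deriv]
    ring
  have := hf.equation t ht p.1 p.2
  rw [h1, h2] at this
  linarith

/-- Transport acts in `θ` only, so the mass at each fixed frequency is conserved. Where it vanishes
initially it vanishes always, and a continuous nonnegative density with zero integral is zero. -/
theorem ext_support (hf : IsClassicalSolution K f)
    (hW : Function.support (freqDist f) ⊆ Icc (-W) W) (t : ℝ) (p : ℝ × ℝ)
    (hp : p.2 ∉ Icc (-W) W) : ext f t p = 0 := by
  obtain ⟨θ₀, ω⟩ := p
  have hpi := Real.pi_pos
  have hc : ∀ t, Continuous fun θ => ext f t (θ, ω) := fun t =>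
    hf.continuous_ext.comp (by fun_prop : Continuous fun θ : ℝ => (t, θ, ω))
  have hd : ∀ t, 0 ≤ t → HasDerivWithinAt
      (fun u => ∫ θ in Icc (-Real.pi) Real.pi, ext f u (θ, ω)) 0 (Ici 0) t := by
    intro t ht
    have := hasDerivWithinAt_setIntegral (m := volume) (s := Icc (-Real.pi) Real.pi) isCompact_Icc
      (Φ := fun u θ => ext f u (θ, ω)) (Φ' := fun u θ => extDeriv f u (θ, ω) (1, 0, 0)) (T := t + 1)
      (hf.continuous_ext.comp (by fun_prop : Continuous fun q : ℝ × ℝ => (q.1, q.2, ω)))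
      ((hf.continuous_extDeriv.comp
        (by fun_prop : Continuous fun q : ℝ × ℝ => (q.1, q.2, ω))).clm_apply continuous_const)
      (fun s hs θ => hf.hasDerivWithinAt_ext hs.1 (θ, ω)) ⟨ht, by linarith⟩
    have hz : ∫ θ in Icc (-Real.pi) Real.pi, extDeriv f t (θ, ω) (1, 0, 0) = 0 := by
      refine integral_deriv_periodic
        (g := fun θ => -(vel K (extRe f) (extIm f) t (θ, ω) * ext f t (θ, ω))) ?_ ?_ ?_
      · intro θ
        have h := ((hasDerivAt_vel K (extRe f) (extIm f) t (θ, ω)).mul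
          (hf.hasDerivAt_ext t (θ, ω))).neg
        rw [hf.ext_equation ht]
        exact h.congr_deriv (by ring)
      · exact ((hf.continuous_extDeriv.comp
          (by fun_prop : Continuous fun q : ℝ => (t, q, ω))).clm_apply continuous_const)
      · intro θ
        rw [hf.ext_periodic]
        simp [vel]
    rw [hz] at this
    exact this
  have hconst : ∀ t, 0 ≤ t → ∫ θ in Icc (-Real.pi) Real.pi, ext f t (θ, ω) = 0 := by
    intro t ht
    have h1 := constant_of_has_deriv_right_zero (a := 0) (b := t)
      (fun s hs => ((hd s hs.1).continuousWithinAt).mono Icc_subset_Ici_self)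
      (fun s hs => (hd s hs.1).mono (Ici_subset_Ici.2 hs.1)) t ⟨ht, le_rfl⟩
    rw [h1]
    have h2 : freqDist f ω = 0 := by
      by_contra h
      exact hp (hW h)
    rw [integral_Icc_eq_integral_Ioc]
    simpa [ext, freqDist, period] using h2
  have hzero : ∀ t, 0 ≤ t → ∀ θ ∈ Icc (-Real.pi) Real.pi, ext f t (θ, ω) = 0 := by
    intro t ht
    have h1 := (setIntegral_eq_zero_iff_of_nonneg_ae
      (Filter.Eventually.of_forall fun θ => hf.ext_nonneg t (θ, ω))
      ((hc t).continuousOn.integrableOn_compact isCompact_Icc)).1 (hconst t ht)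
    exact Measure.eqOn_Icc_of_ae_eq volume (by linarith) h1 (hc t).continuousOn continuousOn_const
  have hper : Function.Periodic (fun θ => ext f (max t 0) (θ, ω)) (2 * Real.pi) :=
    fun θ => hf.ext_periodic _ θ ω
  obtain ⟨y, hy, hy'⟩ := hper.exists_mem_Ioc (by positivity) θ₀ (-Real.pi)
  have h3 := hzero _ (le_max_right t 0) y ⟨hy.1.le, by linarith [hy.2]⟩
  have h4 : ext f (max t 0) (θ₀, ω) = ext f (max t 0) (y, ω) := hy'
  rw [h3] at h4
  simpa [ext] using h4

theorem flow (hf : IsClassicalSolution K f)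
    (hW : Function.support (freqDist f) ⊆ Icc (-W) W) :
    Flow K W (extRe f) (extIm f) (ext f) (fun t p => extDeriv f t p (1, 0, 0))
      (fun t p => extDeriv f t p (0, 1, 0)) where
  cont := hf.continuous_ext
  cont_t := hf.continuous_extDeriv.clm_apply continuous_const
  cont_θ := hf.continuous_extDeriv.clm_apply continuous_const
  deriv_t _ ht p := hf.hasDerivWithinAt_ext ht p
  deriv_θ := hf.hasDerivAt_ext
  periodic := hf.ext_periodic
  nonneg := hf.ext_nonneg
  support := hf.ext_support hW
  mass t := by
    rw [← setIntegral_period_univ (hf.ext_support hW t)]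
    exact hf.mass_one _ (le_max_right _ _)
  a_eq t := by
    rw [← setIntegral_period_univ fun p hp => by rw [hf.ext_support hW t p hp, mul_zero]]
    exact hf.orderParam_re (le_max_right _ _)
  b_eq t := by
    rw [← setIntegral_period_univ fun p hp => by rw [hf.ext_support hW t p hp, mul_zero]]
    exact hf.orderParam_im (le_max_right _ _)
  equation _ ht p := hf.ext_equation ht p

end IsClassicalSolution

/-! ## Averages and transport -/

/-- The integral of `P` against the density `g` over the compact phase space. -/
def mean (W : ℝ) (g P : ℝ × ℝ → ℝ) : ℝ := ∫ p in box W, P p * g p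

section Mean

variable {W : ℝ} {g P Q : ℝ × ℝ → ℝ}

theorem integrableOn_box (hP : Continuous P) : IntegrableOn P (box W) :=
  hP.continuousOn.integrableOn_compact (isCompact_box W)

theorem mean_add (hg : Continuous g) (hP : Continuous P) (hQ : Continuous Q) :
    mean W g (fun p => P p + Q p) = mean W g P + mean W g Q := by
  unfold mean
  rw [← integral_add (integrableOn_box (by fun_prop)) (integrableOn_box (by fun_prop))]
  simp only [add_mul]

theorem mean_sub (hg : Continuous g) (hP : Continuous P) (hQ : Continuous Q) :
    mean W g (fun p => P p - Q p) = mean W g P - mean W g Q := by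
  unfold mean
  rw [← integral_sub (integrableOn_box (by fun_prop)) (integrableOn_box (by fun_prop))]
  simp only [sub_mul]

theorem mean_const_mul (c : ℝ) : mean W g (fun p => c * P p) = c * mean W g P := by
  unfold mean
  rw [← integral_const_mul]
  simp only [mul_assoc]

theorem mean_mono (hg : Continuous g) (hg0 : ∀ p, 0 ≤ g p) (hP : Continuous P)
    (hQ : Continuous Q) (h : ∀ p ∈ box W, P p ≤ Q p) : mean W g P ≤ mean W g Q := by
  refine setIntegral_mono_on (integrableOn_box (by fun_prop)) (integrableOn_box (by fun_prop))
    (measurableSet_box W) fun p hp => ?_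
  exact mul_le_mul_of_nonneg_right (h p hp) (hg0 p)

end Mean

namespace Flow

variable {K W : ℝ} {a b : ℝ → ℝ} {F Ft Fθ : ℝ → ℝ × ℝ → ℝ}

theorem cont_at (h : Flow K W a b F Ft Fθ) (t : ℝ) : Continuous (F t) :=
  h.cont.comp (by fun_prop : Continuous fun p : ℝ × ℝ => (t, p))

theorem cont_a (h : Flow K W a b F Ft Fθ) : Continuous a := by
  have := h.cont
  rw [show a = fun t => ∫ p in box W, cos p.1 * F t p from funext h.a_eq]
  exact continuous_parametric_integral_of_continuous (f := fun t p => cos p.1 * F t p)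
    (by fun_prop) (isCompact_box W)

theorem cont_b (h : Flow K W a b F Ft Fθ) : Continuous b := by
  have := h.cont
  rw [show b = fun t => ∫ p in box W, sin p.1 * F t p from funext h.b_eq]
  exact continuous_parametric_integral_of_continuous (f := fun t p => sin p.1 * F t p)
    (by fun_prop) (isCompact_box W)

theorem mean_mono (h : Flow K W a b F Ft Fθ) (t : ℝ) {P Q : ℝ × ℝ → ℝ} (hP : Continuous P)
    (hQ : Continuous Q) (hPQ : ∀ p ∈ box W, P p ≤ Q p) : mean W (F t) P ≤ mean W (F t) Q :=
  Kuramoto.mean_mono (h.cont_at t) (h.nonneg t) hP hQ hPQ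

theorem mean_const (h : Flow K W a b F Ft Fθ) (t c : ℝ) : mean W (F t) (fun _ => c) = c := by
  rw [mean, integral_const_mul, h.mass, mul_one]

/-- Transport of a weighted integral of a density `G` that solves
`∂ₜ G + v ∂_θ G + n (∂_θ v) G = 0`. -/
theorem hasDerivWithinAt_transport (h : Flow K W a b F Ft Fθ) {G Gt Gθ : ℝ → ℝ × ℝ → ℝ} {n : ℝ}
    (hG : Continuous (Function.uncurry G)) (hGt : Continuous (Function.uncurry Gt))
    (hGθ : Continuous (Function.uncurry Gθ))
    (hdt : ∀ t, 0 ≤ t → ∀ p, HasDerivWithinAt (fun u => G u p) (Gt t p) (Ici 0) t)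
    (hdθ : ∀ t p, HasDerivAt (fun θ => G t (θ, p.2)) (Gθ t p) p.1)
    (hper : ∀ t θ ω, G t (θ + 2 * Real.pi, ω) = G t (θ, ω))
    (heq : ∀ t, 0 ≤ t → ∀ p,
      Gt t p = -(vel K a b t p * Gθ t p + n * velDiv K a b t p * G t p))
    {Φ Φt Φθ : ℝ → ℝ → ℝ} (hΦ : Continuous (Function.uncurry Φ))
    (hΦt : Continuous (Function.uncurry Φt)) (hΦθ : Continuous (Function.uncurry Φθ)) {T : ℝ}
    (hΦdt : ∀ t ∈ Ico 0 T, ∀ θ, HasDerivWithinAt (fun u => Φ u θ) (Φt t θ) (Ici 0) t)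
    (hΦdθ : ∀ t θ, HasDerivAt (fun θ => Φ t θ) (Φθ t θ) θ)
    (hΦper : ∀ t θ, Φ t (θ + 2 * Real.pi) = Φ t θ) {t : ℝ} (ht : t ∈ Ico 0 T) :
    HasDerivWithinAt (fun u => mean W (G u) fun p => Φ u p.1)
      (mean W (G t) fun p => Φt t p.1 + vel K a b t p * Φθ t p.1
        - (n - 1) * velDiv K a b t p * Φ t p.1) (Ici 0) t := by
  have ha := h.cont_a
  have hb := h.cont_b
  have h1 := hasDerivWithinAt_setIntegral (m := volume) (isCompact_box W)
    (Φ := fun u p => Φ u p.1 * G u p) (Φ' := fun u p => Φt u p.1 * G u p + Φ u p.1 * Gt u p) (T := T)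
    (by fun_prop) (by fun_prop)
    (fun s hs p => (hΦdt s hs p.1).mul (hdt s hs.1 p)) ht
  -- Integration by parts: `∂_θ (Φ v G)` has zero mean over a period. Using it removes `∂_θ G` and
  -- lowers the coefficient `n` of the divergence by one.
  have h2 : ∫ p in box W, (Φθ t p.1 * (vel K a b t p * G t p)
      + Φ t p.1 * (velDiv K a b t p * G t p + vel K a b t p * Gθ t p)) = 0 := by
    refine setIntegral_box_deriv_periodic W
      (g := fun p => Φ t p.1 * (vel K a b t p * G t p)) ?_ ?_ ?_
    · intro p
      exact (hΦdθ t p.1).mul ((IsClassicalSolution.hasDerivAt_vel K a b t p).mul (hdθ t p))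
    · unfold vel velDiv; fun_prop
    · intro θ ω
      simp [vel, hΦper, hper]
  have h3 : (mean W (G t) fun p => Φt t p.1 + vel K a b t p * Φθ t p.1
        - (n - 1) * velDiv K a b t p * Φ t p.1)
      = ∫ p in box W, (Φt t p.1 * G t p + Φ t p.1 * Gt t p) := by
    rw [mean, ← sub_eq_zero, ← h2, ← integral_sub]
    · congr 1; ext p
      rw [heq t ht.1]; ring
    · exact integrableOn_box (by unfold vel velDiv; fun_prop)
    · exact integrableOn_box (by fun_prop)
  rw [h3]
  exact h1

theorem hasDerivWithinAt_mean (h : Flow K W a b F Ft Fθ)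
    {Φ Φt Φθ : ℝ → ℝ → ℝ} (hΦ : Continuous (Function.uncurry Φ))
    (hΦt : Continuous (Function.uncurry Φt)) (hΦθ : Continuous (Function.uncurry Φθ)) {T : ℝ}
    (hΦdt : ∀ t ∈ Ico 0 T, ∀ θ, HasDerivWithinAt (fun u => Φ u θ) (Φt t θ) (Ici 0) t)
    (hΦdθ : ∀ t θ, HasDerivAt (fun θ => Φ t θ) (Φθ t θ) θ)
    (hΦper : ∀ t θ, Φ t (θ + 2 * Real.pi) = Φ t θ) {t : ℝ} (ht : t ∈ Ico 0 T) :
    HasDerivWithinAt (fun u => mean W (F u) fun p => Φ u p.1)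
      (mean W (F t) fun p => Φt t p.1 + vel K a b t p * Φθ t p.1) (Ici 0) t := by
  have := h.hasDerivWithinAt_transport (n := 1) h.cont h.cont_t h.cont_θ h.deriv_t h.deriv_θ
    h.periodic (fun t ht p => by rw [h.equation t ht, one_mul]) hΦ hΦt hΦθ hΦdt hΦdθ hΦper ht
  simpa using this

/-- The square of the density satisfies the transport equation with twice the divergence, which is
the case `n = 2`. -/
theorem hasDerivWithinAt_mean_sq (h : Flow K W a b F Ft Fθ)
    {Φ Φt Φθ : ℝ → ℝ → ℝ} (hΦ : Continuous (Function.uncurry Φ))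
    (hΦt : Continuous (Function.uncurry Φt)) (hΦθ : Continuous (Function.uncurry Φθ)) {T : ℝ}
    (hΦdt : ∀ t ∈ Ico 0 T, ∀ θ, HasDerivWithinAt (fun u => Φ u θ) (Φt t θ) (Ici 0) t)
    (hΦdθ : ∀ t θ, HasDerivAt (fun θ => Φ t θ) (Φθ t θ) θ)
    (hΦper : ∀ t θ, Φ t (θ + 2 * Real.pi) = Φ t θ) {t : ℝ} (ht : t ∈ Ico 0 T) :
    HasDerivWithinAt (fun u => mean W (fun p => F u p ^ 2) fun p => Φ u p.1)
      (mean W (fun p => F t p ^ 2) fun p => Φt t p.1 + vel K a b t p * Φθ t p.1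
        - velDiv K a b t p * Φ t p.1) (Ici 0) t := by
  have hF := h.cont
  have hFt := h.cont_t
  have hFθ := h.cont_θ
  have := h.hasDerivWithinAt_transport (n := 2) (G := fun t p => F t p ^ 2)
    (Gt := fun t p => 2 * F t p * Ft t p) (Gθ := fun t p => 2 * F t p * Fθ t p)
    (by fun_prop) (by fun_prop) (by fun_prop)
    (fun t ht p => ((h.deriv_t t ht p).pow 2).congr_deriv (by push_cast; ring))
    (fun t p => ((h.deriv_θ t p).pow 2).congr_deriv (by push_cast; ring))
    (fun t θ ω => by rw [h.periodic])
    (fun t ht p => by rw [h.equation t ht]; ring) hΦ hΦt hΦθ hΦdt hΦdθ hΦper ht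
  norm_num at this
  exact this

/-! ## The order parameter and the dissipation -/

/-- `S = R sin (θ - φ)`. -/
def S (a b : ℝ → ℝ) (t θ : ℝ) : ℝ := a t * sin θ - b t * cos θ

/-- The second moment of `S`. -/
def dissip (W : ℝ) (a b : ℝ → ℝ) (F : ℝ → ℝ × ℝ → ℝ) (t : ℝ) : ℝ :=
  mean W (F t) fun p => S a b t p.1 ^ 2

theorem vel_eq (t : ℝ) (p : ℝ × ℝ) : vel K a b t p = p.2 - K * S a b t p.1 := by
  unfold vel S; ring

@[fun_prop]
theorem continuous_S (a b : ℝ → ℝ) (t : ℝ) : Continuous (S a b t) := by unfold S; fun_prop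

theorem mean_cos (h : Flow K W a b F Ft Fθ) (t : ℝ) : mean W (F t) (fun p => cos p.1) = a t :=
  (h.a_eq t).symm

theorem mean_sin (h : Flow K W a b F Ft Fθ) (t : ℝ) : mean W (F t) (fun p => sin p.1) = b t :=
  (h.b_eq t).symm

theorem hasDerivWithinAt_a (h : Flow K W a b F Ft Fθ) {t : ℝ} (ht : 0 ≤ t) :
    HasDerivWithinAt a (-mean W (F t) (fun p => p.2 * sin p.1)
      + K * mean W (F t) fun p => S a b t p.1 * sin p.1) (Ici 0) t := by
  have hF := h.cont_at t
  have h1 := h.hasDerivWithinAt_mean (Φ := fun _ θ => cos θ) (Φt := fun _ _ => 0)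
    (Φθ := fun _ θ => -sin θ) (T := t + 1) (by fun_prop) (by fun_prop) (by fun_prop)
    (fun s _ θ => hasDerivWithinAt_const _ _ _) (fun _ θ => Real.hasDerivAt_cos θ)
    (fun _ θ => Real.cos_add_two_pi θ) ⟨ht, by linarith⟩
  simp only [h.mean_cos] at h1
  refine h1.congr_deriv ?_
  rw [← mean_const_mul, neg_add_eq_sub, ← mean_sub hF (by fun_prop) (by fun_prop)]
  congr 1; ext p
  rw [vel_eq]; ring

theorem hasDerivWithinAt_b (h : Flow K W a b F Ft Fθ) {t : ℝ} (ht : 0 ≤ t) :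
    HasDerivWithinAt b (mean W (F t) (fun p => p.2 * cos p.1)
      - K * mean W (F t) fun p => S a b t p.1 * cos p.1) (Ici 0) t := by
  have hF := h.cont_at t
  have h1 := h.hasDerivWithinAt_mean (Φ := fun _ θ => sin θ) (Φt := fun _ _ => 0)
    (Φθ := fun _ θ => cos θ) (T := t + 1) (by fun_prop) (by fun_prop) (by fun_prop)
    (fun s _ θ => hasDerivWithinAt_const _ _ _) (fun _ θ => Real.hasDerivAt_sin θ)
    (fun _ θ => Real.sin_add_two_pi θ) ⟨ht, by linarith⟩
  simp only [h.mean_sin] at h1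
  refine h1.congr_deriv ?_
  rw [← mean_const_mul, ← mean_sub hF (by fun_prop) (by fun_prop)]
  congr 1; ext p
  rw [vel_eq]; ring

/-- The square of the modulus of the order parameter. -/
def Rsq (a b : ℝ → ℝ) (t : ℝ) : ℝ := a t ^ 2 + b t ^ 2

/-- The derivative of `R² / 2`. -/
def growth (K W : ℝ) (a b : ℝ → ℝ) (F : ℝ → ℝ × ℝ → ℝ) (t : ℝ) : ℝ :=
  K * dissip W a b F t - mean W (F t) fun p => p.2 * S a b t p.1

theorem mean_S_mul (h : Flow K W a b F Ft Fθ) (t : ℝ) {P : ℝ × ℝ → ℝ} (hP : Continuous P) :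
    mean W (F t) (fun p => P p * S a b t p.1)
      = a t * mean W (F t) (fun p => P p * sin p.1)
        - b t * mean W (F t) (fun p => P p * cos p.1) := by
  rw [← mean_const_mul, ← mean_const_mul, ← mean_sub (h.cont_at t) (by fun_prop) (by fun_prop)]
  congr 1; ext p
  unfold S; ring

theorem hasDerivWithinAt_Rsq (h : Flow K W a b F Ft Fθ) {t : ℝ} (ht : 0 ≤ t) :
    HasDerivWithinAt (Rsq a b) (2 * growth K W a b F t) (Ici 0) t := by
  have h1 := ((h.hasDerivWithinAt_a ht).pow 2).add ((h.hasDerivWithinAt_b ht).pow 2)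
  refine h1.congr_deriv ?_
  have h2 := h.mean_S_mul t (P := fun p => S a b t p.1) (by fun_prop)
  have h3 := h.mean_S_mul t (P := fun p => p.2) (by fun_prop)
  simp only [← sq] at h2
  rw [growth, dissip, h2, h3]
  push_cast; ring

theorem S_sq_le (t θ : ℝ) : S a b t θ ^ 2 ≤ Rsq a b t := by
  unfold S Rsq
  nlinarith [sq_nonneg (a t * cos θ + b t * sin θ), Real.sin_sq_add_cos_sq θ]

theorem abs_le_of_mem_box {p : ℝ × ℝ} (hp : p ∈ box W) : |p.2| ≤ W := abs_le.2 hp.2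

/-- Young's inequality. The frequency term takes at most half of the dissipation, so the derivative
of `R²` is at least `K I - W²/K`. -/
theorem two_mul_mean_freq_le (h : Flow K W a b F Ft Fθ) (hK : 0 < K) (t : ℝ) :
    2 * |mean W (F t) fun p => p.2 * S a b t p.1| ≤ K * dissip W a b F t + W ^ 2 / K := by
  have hF := h.cont_at t
  have key : ∀ p ∈ box W, |2 * (p.2 * S a b t p.1)| ≤ K * S a b t p.1 ^ 2 + W ^ 2 / K := by
    intro p hp
    have h1 := abs_le_of_mem_box hp
    have h2 : p.2 ^ 2 ≤ W ^ 2 := sq_le_sq' (by linarith [(abs_le.1 h1).1]) (abs_le.1 h1).2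
    have h3 : p.2 ^ 2 / K ≤ W ^ 2 / K := by gcongr
    have h4 : 0 ≤ K * (S a b t p.1 - p.2 / K) ^ 2 := by positivity
    have h5 : 0 ≤ K * (S a b t p.1 + p.2 / K) ^ 2 := by positivity
    have h6 : K * (S a b t p.1 - p.2 / K) ^ 2
      = K * S a b t p.1 ^ 2 - 2 * (p.2 * S a b t p.1) + p.2 ^ 2 / K := by field_simp; ring
    have h7 : K * (S a b t p.1 + p.2 / K) ^ 2
      = K * S a b t p.1 ^ 2 + 2 * (p.2 * S a b t p.1) + p.2 ^ 2 / K := by field_simp; ring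
    rw [abs_le]; constructor <;> linarith
  have h1 := h.mean_mono t (P := fun p => 2 * (p.2 * S a b t p.1))
    (Q := fun p => K * S a b t p.1 ^ 2 + W ^ 2 / K) (by fun_prop) (by fun_prop)
    fun p hp => (abs_le.1 (key p hp)).2
  have h2 := h.mean_mono t (P := fun p => (-2) * (p.2 * S a b t p.1))
    (Q := fun p => K * S a b t p.1 ^ 2 + W ^ 2 / K) (by fun_prop) (by fun_prop)
    fun p hp => by linarith [(abs_le.1 (key p hp)).1]
  rw [mean_const_mul, mean_add hF (by fun_prop) (by fun_prop), mean_const_mul,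
    h.mean_const] at h1 h2
  have h3 : |2 * mean W (F t) fun p => p.2 * S a b t p.1| ≤ K * dissip W a b F t + W ^ 2 / K := by
    rw [abs_le]; unfold dissip; constructor <;> linarith
  rwa [abs_mul, abs_two] at h3

theorem abs_mean_freq_mul_le (h : Flow K W a b F Ft Fθ) (t : ℝ) {u : ℝ → ℝ} (hu : Continuous u)
    (hb : ∀ x, |u x| ≤ 1) : |mean W (F t) fun p => p.2 * u p.1| ≤ W := by
  have key : ∀ p ∈ box W, |p.2 * u p.1| ≤ W := by
    intro p hp
    rw [abs_mul]
    have := abs_le_of_mem_box hp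
    nlinarith [abs_nonneg p.2, hb p.1, abs_nonneg (u p.1)]
  have h1 := h.mean_mono t (P := fun p => p.2 * u p.1) (Q := fun _ => W) (by fun_prop)
    (by fun_prop) fun p hp => (abs_le.1 (key p hp)).2
  have h2 := h.mean_mono t (P := fun _ => -W) (Q := fun p => p.2 * u p.1) (by fun_prop)
    (by fun_prop) fun p hp => (abs_le.1 (key p hp)).1
  rw [h.mean_const] at h1 h2
  exact abs_le.2 ⟨h2, h1⟩

theorem continuous_mean (h : Flow K W a b F Ft Fθ) {Φ : ℝ → ℝ × ℝ → ℝ}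
    (hΦ : Continuous (Function.uncurry Φ)) : Continuous fun t => mean W (F t) (Φ t) := by
  have := h.cont
  exact continuous_parametric_integral_of_continuous (f := fun t p => Φ t p * F t p)
    (by fun_prop) (isCompact_box W)

theorem continuous_Rsq (h : Flow K W a b F Ft Fθ) : Continuous (Rsq a b) := by
  have := h.cont_a; have := h.cont_b
  unfold Rsq; fun_prop

theorem continuous_dissip (h : Flow K W a b F Ft Fθ) : Continuous (dissip W a b F) := by
  have := h.cont_a; have := h.cont_b
  exact h.continuous_mean (Φ := fun t p => S a b t p.1 ^ 2) (by unfold S; fun_prop)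

theorem continuous_growth (h : Flow K W a b F Ft Fθ) : Continuous (growth K W a b F) := by
  have := h.cont_a; have := h.cont_b
  have h1 := h.continuous_mean (Φ := fun t p => p.2 * S a b t p.1) (by unfold S; fun_prop)
  have h2 := h.continuous_dissip
  unfold growth; fun_prop

theorem Rsq_le_one (h : Flow K W a b F Ft Fθ) (t : ℝ) : Rsq a b t ≤ 1 := by
  have hF := h.cont_at t
  have h1 := h.mean_mono t (P := fun p => a t * cos p.1 + b t * sin p.1)
    (Q := fun _ => (Rsq a b t + 1) / 2) (by fun_prop) (by fun_prop) (fun p _ => by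
      unfold Rsq
      nlinarith [sq_nonneg (a t - cos p.1), sq_nonneg (b t - sin p.1),
        Real.sin_sq_add_cos_sq p.1])
  rw [h.mean_const, mean_add hF (by fun_prop) (by fun_prop), mean_const_mul, mean_const_mul,
    h.mean_cos, h.mean_sin] at h1
  unfold Rsq at *
  nlinarith

/-- The dissipation decays at most exponentially, up to an error from the frequencies. -/
theorem hasDerivWithinAt_dissip (h : Flow K W a b F Ft Fθ) (hK : 0 < K) {t : ℝ} (ht : 0 ≤ t) :
    ∃ D, HasDerivWithinAt (dissip W a b F) D (Ici 0) t ∧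
      -(3 * K * sqrt (Rsq a b t) * dissip W a b F t + 2 * W ^ 2 / K) ≤ D := by
  have hF := h.cont_at t
  have hca := h.cont_a
  have hcb := h.cont_b
  set A1 : ℝ → ℝ := fun t => mean W (F t) fun p => p.2 * sin p.1 with hA1
  set B1 : ℝ → ℝ := fun t => mean W (F t) fun p => p.2 * cos p.1 with hB1
  set P1 : ℝ → ℝ := fun t => mean W (F t) fun p => S a b t p.1 * sin p.1 with hP1
  set Q1 : ℝ → ℝ := fun t => mean W (F t) fun p => S a b t p.1 * cos p.1 with hQ1
  have cA1 : Continuous A1 := h.continuous_mean (Φ := fun t p => p.2 * sin p.1) (by fun_prop)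
  have cB1 : Continuous B1 := h.continuous_mean (Φ := fun t p => p.2 * cos p.1) (by fun_prop)
  have cP1 : Continuous P1 :=
    h.continuous_mean (Φ := fun t p => S a b t p.1 * sin p.1) (by unfold S; fun_prop)
  have cQ1 : Continuous Q1 :=
    h.continuous_mean (Φ := fun t p => S a b t p.1 * cos p.1) (by unfold S; fun_prop)
  have h1 := h.hasDerivWithinAt_mean (Φ := fun t θ => S a b t θ ^ 2)
    (Φt := fun t θ => 2 * S a b t θ * ((-A1 t + K * P1 t) * sin θ - (B1 t - K * Q1 t) * cos θ))
    (Φθ := fun t θ => 2 * S a b t θ * (a t * cos θ + b t * sin θ)) (T := t + 1)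
    (by unfold S; fun_prop) (by unfold S; fun_prop) (by unfold S; fun_prop)
    (fun s hs θ => by
      have := (((h.hasDerivWithinAt_a hs.1).mul_const (sin θ)).sub
        ((h.hasDerivWithinAt_b hs.1).mul_const (cos θ))).pow 2
      exact this.congr_deriv (by simp only [S, hA1, hB1, hP1, hQ1, Pi.sub_apply]; push_cast; ring))
    (fun s θ => by
      have := (((Real.hasDerivAt_sin θ).const_mul (a s)).sub
        ((Real.hasDerivAt_cos θ).const_mul (b s))).pow 2
      exact this.congr_deriv (by simp only [S, Pi.sub_apply]; push_cast; ring))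
    (fun s θ => by simp [S]) ⟨ht, by linarith⟩
  refine ⟨_, h1, ?_⟩
  set R := sqrt (Rsq a b t) with hR
  have hR0 : 0 ≤ R := Real.sqrt_nonneg _
  have hR1 : R ≤ 1 := by
    rw [hR, Real.sqrt_le_one]; exact h.Rsq_le_one t
  have hRR : R ^ 2 = Rsq a b t := Real.sq_sqrt (by unfold Rsq; positivity)
  -- The transport part is bounded pointwise: `-2 K S² c` costs `2 K R S²`, as `|c| ≤ R`, and the
  -- frequency part costs `K R S² + W²/K` by Young. Together these give the rate `3 K R`.
  have hlow := h.mean_mono t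
    (P := fun p => 2 * (-A1 t + K * P1 t) * (S a b t p.1 * sin p.1)
      - (2 * (B1 t - K * Q1 t) * (S a b t p.1 * cos p.1)
      + (3 * K * R * S a b t p.1 ^ 2 + W ^ 2 / K)))
    (Q := fun p => 2 * S a b t p.1 * ((-A1 t + K * P1 t) * sin p.1 - (B1 t - K * Q1 t) * cos p.1)
      + vel K a b t p * (2 * S a b t p.1 * (a t * cos p.1 + b t * sin p.1)))
    (by fun_prop) (by unfold vel; fun_prop) (fun p hp => by
      set s := S a b t p.1
      set c := a t * cos p.1 + b t * sin p.1
      have hc : c ^ 2 ≤ R ^ 2 := by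
        rw [hRR, Rsq]
        nlinarith [sq_nonneg (a t * sin p.1 - b t * cos p.1), Real.sin_sq_add_cos_sq p.1]
      have hc' : |c| ≤ R := abs_le_of_sq_le_sq hc hR0
      have hw := abs_le_of_mem_box hp
      have h2 : -(K * R * s ^ 2 + W ^ 2 / K) ≤ 2 * (p.2 * s * c) := by
        have e1 : |p.2 * s * c| ≤ W * |s| * R := by
          rw [abs_mul, abs_mul]; gcongr
          exact mul_nonneg ((abs_nonneg _).trans hw) (abs_nonneg _)
        have e2 : K * (R * |s| - W / K) ^ 2 = K * R ^ 2 * s ^ 2 - 2 * (W * |s| * R) + W ^ 2 / K := by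
          have : |s| ^ 2 = s ^ 2 := sq_abs s
          field_simp
          rw [← this]; ring
        have e3 : K * R ^ 2 * s ^ 2 ≤ K * R * s ^ 2 := by
          have : R ^ 2 ≤ R := by nlinarith
          gcongr
        have e4 : 0 ≤ K * (R * |s| - W / K) ^ 2 := by positivity
        linarith [(abs_le.1 e1).1]
      have h3 : s ^ 2 * c ≤ s ^ 2 * R := by
        gcongr; exact (abs_le.1 hc').2
      have h4 : K * (s ^ 2 * c) ≤ K * (s ^ 2 * R) := by gcongr
      rw [vel_eq]
      change _ ≤ 2 * s * _ + (p.2 - K * s) * (2 * s * c)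
      have h5 : (p.2 - K * s) * (2 * s * c) = 2 * (p.2 * s * c) - 2 * (K * (s ^ 2 * c)) := by ring
      rw [h5]
      linarith)
  rw [mean_sub hF (by fun_prop) (by fun_prop), mean_add hF (by fun_prop) (by fun_prop),
    mean_add hF (by fun_prop) (by fun_prop), mean_const_mul, mean_const_mul, mean_const_mul,
    h.mean_const] at hlow
  refine le_trans ?_ hlow
  change _ ≤ 2 * (-A1 t + K * P1 t) * P1 t - (2 * (B1 t - K * Q1 t) * Q1 t
    + (3 * K * R * dissip W a b F t + W ^ 2 / K))
  have hA : A1 t ^ 2 ≤ W ^ 2 := sq_le_sq.2 (by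
    have := h.abs_mean_freq_mul_le t Real.continuous_sin Real.abs_sin_le_one
    exact this.trans (le_abs_self W))
  have hB : B1 t ^ 2 ≤ W ^ 2 := sq_le_sq.2 (by
    have := h.abs_mean_freq_mul_le t Real.continuous_cos Real.abs_cos_le_one
    exact this.trans (le_abs_self W))
  -- The motion of the order parameter itself contributes `2 K (P1² + Q1²)` plus cross terms with
  -- the frequencies. Completing squares leaves a loss of at most `W²/K`.
  have e1 : 0 ≤ 2 * K * (P1 t - A1 t / (2 * K)) ^ 2 := by positivity
  have e2 : 0 ≤ 2 * K * (Q1 t - B1 t / (2 * K)) ^ 2 := by positivity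
  have e3 : 2 * K * (P1 t - A1 t / (2 * K)) ^ 2
    = 2 * K * P1 t ^ 2 - 2 * A1 t * P1 t + A1 t ^ 2 / (2 * K) := by field_simp; ring
  have e4 : 2 * K * (Q1 t - B1 t / (2 * K)) ^ 2
    = 2 * K * Q1 t ^ 2 - 2 * B1 t * Q1 t + B1 t ^ 2 / (2 * K) := by field_simp; ring
  have e5 : A1 t ^ 2 / (2 * K) ≤ W ^ 2 / (2 * K) := by gcongr
  have e6 : B1 t ^ 2 / (2 * K) ≤ W ^ 2 / (2 * K) := by gcongr
  have e7 : 2 * W ^ 2 / K = W ^ 2 / (2 * K) + W ^ 2 / (2 * K) + W ^ 2 / K := by field_simp; ring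
  rw [e7]
  nlinarith

end Flow

/-! ## Frames that follow a characteristic -/

/-- `ψ` follows the characteristic of frequency zero on `[0, T)`. -/
structure IsFrame (K : ℝ) (a b : ℝ → ℝ) (T : ℝ) (ψ : ℝ → ℝ) : Prop where
  cont : Continuous ψ
  deriv : ∀ t ∈ Ico 0 T, HasDerivWithinAt ψ (-K * Flow.S a b t (ψ t)) (Ici 0) t

/-- The component of the order parameter in the direction `x`. -/
def hComp (a b : ℝ → ℝ) (t x : ℝ) : ℝ := a t * cos x + b t * sin x

/-- The component of the order parameter orthogonal to the direction `x`. -/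
def qComp (a b : ℝ → ℝ) (t x : ℝ) : ℝ := b t * cos x - a t * sin x

/-- The cutoff to `y ≤ 2 κ`, equal to one on `y ≤ κ`. -/
def cutoff (κ y : ℝ) : ℝ := Real.smoothTransition ((2 * κ - y) / κ)

/-! ### A smooth cutoff in the gap variable -/

section Cutoff

variable {κ y : ℝ}

theorem cutoff_nonneg (κ y : ℝ) : 0 ≤ cutoff κ y := Real.smoothTransition.nonneg _

theorem cutoff_le_one (κ y : ℝ) : cutoff κ y ≤ 1 := Real.smoothTransition.le_one _

theorem cutoff_eq_one (hκ : 0 < κ) (hy : y ≤ κ) : cutoff κ y = 1 :=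
  Real.smoothTransition.one_of_one_le (by rw [le_div_iff₀ hκ]; linarith)

theorem cutoff_eq_zero (hκ : 0 < κ) (hy : 2 * κ ≤ y) : cutoff κ y = 0 :=
  Real.smoothTransition.zero_of_nonpos (div_nonpos_of_nonpos_of_nonneg (by linarith) hκ.le)

theorem contDiff_cutoff (κ : ℝ) : ContDiff ℝ 1 (cutoff κ) :=
  Real.smoothTransition.contDiff.comp ((contDiff_const.sub contDiff_id).div_const κ)

theorem hasDerivAt_cutoff (κ y : ℝ) : HasDerivAt (cutoff κ) (deriv (cutoff κ) y) y :=
  ((contDiff_cutoff κ).differentiable one_ne_zero y).hasDerivAt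

@[fun_prop]
theorem continuous_cutoff (κ : ℝ) : Continuous (cutoff κ) := (contDiff_cutoff κ).continuous

theorem continuous_deriv_cutoff (κ : ℝ) : Continuous (deriv (cutoff κ)) :=
  (contDiff_cutoff κ).continuous_deriv le_rfl

theorem deriv_cutoff_nonpos (hκ : 0 < κ) (y : ℝ) : deriv (cutoff κ) y ≤ 0 := by
  refine Antitone.deriv_nonpos fun u v huv => ?_
  refine Real.smoothTransition.monotone ?_
  gcongr

theorem deriv_cutoff_eq_zero_of_lt (hκ : 0 < κ) (hy : y < κ) : deriv (cutoff κ) y = 0 := by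
  have : cutoff κ =ᶠ[nhds y] fun _ => 1 := by
    filter_upwards [Iio_mem_nhds hy] with u hu using cutoff_eq_one hκ (le_of_lt hu)
  rw [this.deriv_eq, deriv_const]

theorem deriv_cutoff_eq_zero_of_gt (hκ : 0 < κ) (hy : 2 * κ < y) : deriv (cutoff κ) y = 0 := by
  have : cutoff κ =ᶠ[nhds y] fun _ => 0 := by
    filter_upwards [Ioi_mem_nhds hy] with u hu using cutoff_eq_zero hκ (le_of_lt hu)
  rw [this.deriv_eq, deriv_const]

end Cutoff

/-- `1 - cos` of an angle is half of a squared chord, so this is `|u - v|² ≤ 2 |u - 1|² + 2 |v -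
1|²` on the unit circle. It serves as a triangle inequality for gaps. -/
theorem one_sub_cos_sub_le (x y : ℝ) :
    1 - cos (x - y) ≤ 2 * (1 - cos x) + 2 * (1 - cos y) := by
  have h1 := Real.sin_sq_add_cos_sq x
  have h2 := Real.sin_sq_add_cos_sq y
  rw [Real.cos_sub]
  nlinarith [sq_nonneg (cos x + cos y - 2), sq_nonneg (sin x + sin y)]

namespace Flow

variable {K W : ℝ} {a b : ℝ → ℝ} {F Ft Fθ : ℝ → ℝ × ℝ → ℝ}

/-- Since `R ≤ 1`, the field has speed and Lipschitz constant at most `K`. A ball of radius `K T`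
therefore lets Picard–Lindelöf cover all of `[0, T]` at once, forwards and backwards from `t₁`. -/
theorem exists_frame (h : Flow K W a b F Ft Fθ) (hK : 0 < K) {T t₁ : ℝ} (ht₁ : t₁ ∈ Icc 0 T)
    (x₀ : ℝ) : ∃ ψ, IsFrame K a b T ψ ∧ ψ t₁ = x₀ := by
  have hT : 0 ≤ T := ht₁.1.trans ht₁.2
  have hcont : Continuous (Function.uncurry fun t x => -K * S a b t x) := by
    have := h.cont_a; have := h.cont_b
    unfold S; fun_prop
  have hder : ∀ t x, HasDerivAt (fun x => -K * S a b t x) (-K * (a t * cos x + b t * sin x)) x := by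
    intro t x
    have := (((Real.hasDerivAt_sin x).const_mul (a t)).sub
      ((Real.hasDerivAt_cos x).const_mul (b t))).const_mul (-K)
    exact this.congr_deriv (by ring)
  have hpl : IsPicardLindelof (fun t x => -K * S a b t x) (tmin := 0) (tmax := T) ⟨t₁, ht₁⟩ x₀
      (Real.toNNReal (K * T)) 0 (Real.toNNReal K) (Real.toNNReal K) := by
    refine ⟨fun t _ => ?_, fun x _ => ?_, fun t _ x _ => ?_, ?_⟩
    · refine LipschitzWith.lipschitzOnWith (lipschitzWith_of_nnnorm_deriv_le
        (fun x => (hder t x).differentiableAt) fun x => ?_)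
      rw [(hder t x).deriv, ← NNReal.coe_le_coe, coe_nnnorm, Real.coe_toNNReal _ hK.le,
        norm_mul, norm_neg, Real.norm_eq_abs, Real.norm_eq_abs, abs_of_pos hK]
      have : |a t * cos x + b t * sin x| ≤ 1 := by
        rw [← sq_le_one_iff_abs_le_one]
        have := h.Rsq_le_one t
        unfold Rsq at this
        nlinarith [sq_nonneg (a t * sin x - b t * cos x), Real.sin_sq_add_cos_sq x]
      nlinarith
    · exact (hcont.comp (by fun_prop : Continuous fun t : ℝ => (t, x))).continuousOn
    · rw [Real.coe_toNNReal _ hK.le, norm_mul, norm_neg, Real.norm_eq_abs, Real.norm_eq_abs,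
        abs_of_pos hK]
      have : |S a b t x| ≤ 1 := by
        rw [← sq_le_one_iff_abs_le_one]
        exact (S_sq_le t x).trans (h.Rsq_le_one t)
      nlinarith
    · rw [Real.coe_toNNReal _ hK.le, Real.coe_toNNReal _ (by positivity)]
      simp only [NNReal.coe_zero, sub_zero]
      gcongr
      exact max_le (by linarith [ht₁.1]) (by linarith [ht₁.2])
  obtain ⟨α, hα0, hα⟩ := hpl.exists_eq_forall_mem_Icc_hasDerivWithinAt₀
  -- Freezing the solution outside `[0, T]` makes it continuous on the whole line.
  refine ⟨fun t => α (max 0 (min T t)), ⟨?_, ?_⟩, ?_⟩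
  · have hc : ContinuousOn α (Icc 0 T) := fun t ht => (hα t ht).continuousWithinAt
    exact hc.comp_continuous (by fun_prop) fun t => ⟨le_max_left _ _, max_le hT (min_le_left _ _)⟩
  · intro t ht
    have he : ∀ u ∈ Icc 0 T, α (max 0 (min T u)) = α u := fun u hu => by
      rw [min_eq_right hu.2, max_eq_right hu.1]
    have h1 := hα t ⟨ht.1, ht.2.le⟩
    have h2 : HasDerivWithinAt α (-K * S a b t (α t)) (Ici 0) t := by
      refine h1.mono_of_mem_nhdsWithin ?_
      filter_upwards [inter_mem_nhdsWithin (Ici 0) (Iio_mem_nhds ht.2)] with u hu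
      exact ⟨hu.1, le_of_lt hu.2⟩
    rw [he t ⟨ht.1, ht.2.le⟩]
    refine h2.congr_of_eventuallyEq ?_ (he t ⟨ht.1, ht.2.le⟩)
    filter_upwards [inter_mem_nhdsWithin (Ici 0) (Iio_mem_nhds ht.2)] with u hu
    exact he u ⟨hu.1, le_of_lt hu.2⟩
  · simp only []
    rw [min_eq_right ht₁.2, max_eq_right ht₁.1]
    exact hα0

theorem mean_cos_sub (h : Flow K W a b F Ft Fθ) (t x : ℝ) :
    mean W (F t) (fun p => cos (p.1 - x)) = hComp a b t x := by
  rw [hComp, mul_comm (a t), mul_comm (b t), ← h.mean_cos, ← h.mean_sin, ← mean_const_mul,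
    ← mean_const_mul, ← mean_add (h.cont_at t) (by fun_prop) (by fun_prop)]
  congr 1; ext p
  rw [Real.cos_sub]; ring

theorem mean_sin_sub (h : Flow K W a b F Ft Fθ) (t x : ℝ) :
    mean W (F t) (fun p => sin (p.1 - x)) = qComp a b t x := by
  rw [qComp, mul_comm (a t), mul_comm (b t), ← h.mean_cos, ← h.mean_sin, ← mean_const_mul,
    ← mean_const_mul, ← mean_sub (h.cont_at t) (by fun_prop) (by fun_prop)]
  congr 1; ext p
  rw [Real.sin_sub]; ring

theorem Rsq_eq (t x : ℝ) : Rsq a b t = hComp a b t x ^ 2 + qComp a b t x ^ 2 := by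
  unfold Rsq hComp qComp
  linear_combination (-(a t ^ 2 + b t ^ 2)) * Real.sin_sq_add_cos_sq x

theorem S_eq (t x θ : ℝ) :
    S a b t θ = hComp a b t x * sin (θ - x) - qComp a b t x * cos (θ - x) := by
  unfold S hComp qComp
  rw [Real.sin_sub, Real.cos_sub]
  linear_combination (-(a t * sin θ - b t * cos θ)) * Real.sin_sq_add_cos_sq x

theorem S_self (t x : ℝ) : S a b t x = -qComp a b t x := by unfold S qComp; ring

theorem velDiv_eq (t x : ℝ) (p : ℝ × ℝ) : velDiv K a b t p
    = -K * (hComp a b t x * cos (p.1 - x) + qComp a b t x * sin (p.1 - x)) := by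
  unfold velDiv hComp qComp
  rw [Real.sin_sub, Real.cos_sub]
  linear_combination K * (b t * sin p.1 + a t * cos p.1) * Real.sin_sq_add_cos_sq x

/-- The velocity of `1 - cos Δ`, where `Δ` is the angle of a characteristic of frequency `ω`
relative to the frame. -/
def gapVel (K : ℝ) (a b : ℝ → ℝ) (t x Δ ω : ℝ) : ℝ :=
  sin Δ * (ω - K * (hComp a b t x * sin Δ + qComp a b t x * (1 - cos Δ)))

/-- Without frequency the gap `y = 1 - cos Δ` satisfies `y' = -K y J`. The restoring coefficient `J`
is what the cluster keeps positive. -/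
theorem gapVel_eq (t x Δ ω : ℝ) : gapVel K a b t x Δ ω = ω * sin Δ
    - K * (1 - cos Δ) * ((1 + cos Δ) * hComp a b t x + sin Δ * qComp a b t x) := by
  unfold gapVel
  linear_combination (-K * hComp a b t x) * Real.sin_sq_add_cos_sq Δ

theorem vel_sub_frame (t x : ℝ) (p : ℝ × ℝ) :
    sin (p.1 - x) * (vel K a b t p - -K * S a b t x) = gapVel K a b t x (p.1 - x) p.2 := by
  rw [vel_eq, S_eq t x p.1, S_self]
  unfold gapVel; ring

section FrameDeriv

variable {T : ℝ} {ψ Y Y' : ℝ → ℝ}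

theorem hasDerivWithinAt_gap (hψ : IsFrame K a b T ψ) (hY : ∀ y, HasDerivAt Y (Y' y) y) (θ : ℝ)
    {t : ℝ} (ht : t ∈ Ico 0 T) :
    HasDerivWithinAt (fun u => Y (1 - cos (θ - ψ u)))
      (Y' (1 - cos (θ - ψ t)) * (sin (θ - ψ t) * -(-K * S a b t (ψ t)))) (Ici 0) t := by
  have h1 := ((hψ.deriv t ht).const_sub θ).cos.const_sub 1
  have h2 := (hY (1 - cos (θ - ψ t))).comp_hasDerivWithinAt t h1
  exact h2.congr_deriv (by ring)

theorem hasDerivAt_gap (hY : ∀ y, HasDerivAt Y (Y' y) y) (x θ : ℝ) :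
    HasDerivAt (fun θ => Y (1 - cos (θ - x))) (Y' (1 - cos (θ - x)) * sin (θ - x)) θ := by
  have h1 := (((hasDerivAt_id θ).sub_const x).cos).const_sub 1
  have h2 := (hY (1 - cos (θ - x))).comp θ h1
  exact h2.congr_deriv (by simp)

theorem hasDerivWithinAt_frame (h : Flow K W a b F Ft Fθ) (hψ : IsFrame K a b T ψ)
    (hY : ∀ y, HasDerivAt Y (Y' y) y) (hY' : Continuous Y') {t : ℝ} (ht : t ∈ Ico 0 T) :
    HasDerivWithinAt (fun u => mean W (F u) fun p => Y (1 - cos (p.1 - ψ u)))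
      (mean W (F t) fun p => Y' (1 - cos (p.1 - ψ t)) * gapVel K a b t (ψ t) (p.1 - ψ t) p.2)
      (Ici 0) t := by
  have ha := h.cont_a
  have hb := h.cont_b
  have hc := hψ.cont
  have hYc : Continuous Y := continuous_iff_continuousAt.2 fun y => (hY y).continuousAt
  have h1 := h.hasDerivWithinAt_mean (Φ := fun t θ => Y (1 - cos (θ - ψ t)))
    (Φt := fun t θ => Y' (1 - cos (θ - ψ t)) * (sin (θ - ψ t) * -(-K * S a b t (ψ t))))
    (Φθ := fun t θ => Y' (1 - cos (θ - ψ t)) * sin (θ - ψ t))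
    (by fun_prop) (by unfold S; fun_prop) (by fun_prop)
    (fun s hs θ => hasDerivWithinAt_gap hψ hY θ hs)
    (fun s θ => hasDerivAt_gap hY (ψ s) θ)
    (fun s θ => by rw [show θ + 2 * Real.pi - ψ s = θ - ψ s + 2 * Real.pi by ring,
      Real.cos_add_two_pi]) ht
  refine h1.congr_deriv ?_
  congr 1; ext p
  rw [← vel_sub_frame]; ring

theorem hasDerivWithinAt_frame_sq (h : Flow K W a b F Ft Fθ) (hψ : IsFrame K a b T ψ)
    (hY : ∀ y, HasDerivAt Y (Y' y) y) (hY' : Continuous Y') {t : ℝ} (ht : t ∈ Ico 0 T) :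
    HasDerivWithinAt (fun u => mean W (fun p => F u p ^ 2) fun p => Y (1 - cos (p.1 - ψ u)))
      (mean W (fun p => F t p ^ 2) fun p =>
        Y' (1 - cos (p.1 - ψ t)) * gapVel K a b t (ψ t) (p.1 - ψ t) p.2
        + K * (hComp a b t (ψ t) * cos (p.1 - ψ t) + qComp a b t (ψ t) * sin (p.1 - ψ t))
          * Y (1 - cos (p.1 - ψ t)))
      (Ici 0) t := by
  have ha := h.cont_a
  have hb := h.cont_b
  have hc := hψ.cont
  have hYc : Continuous Y := continuous_iff_continuousAt.2 fun y => (hY y).continuousAt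
  have h1 := h.hasDerivWithinAt_mean_sq (Φ := fun t θ => Y (1 - cos (θ - ψ t)))
    (Φt := fun t θ => Y' (1 - cos (θ - ψ t)) * (sin (θ - ψ t) * -(-K * S a b t (ψ t))))
    (Φθ := fun t θ => Y' (1 - cos (θ - ψ t)) * sin (θ - ψ t))
    (by fun_prop) (by unfold S; fun_prop) (by fun_prop)
    (fun s hs θ => hasDerivWithinAt_gap hψ hY θ hs)
    (fun s θ => hasDerivAt_gap hY (ψ s) θ)
    (fun s θ => by rw [show θ + 2 * Real.pi - ψ s = θ - ψ s + 2 * Real.pi by ring,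
      Real.cos_add_two_pi]) ht
  refine h1.congr_deriv ?_
  congr 1; ext p
  rw [← vel_sub_frame, velDiv_eq t (ψ t)]; ring

end FrameDeriv

/-! ## Persistence of a cluster -/

/-- The mass near the direction `x`. -/
def clusterMass (W κ : ℝ) (F : ℝ → ℝ × ℝ → ℝ) (t x : ℝ) : ℝ :=
  mean W (F t) fun p => cutoff κ (1 - cos (p.1 - x))

theorem cos_ge_cutoff {κ : ℝ} (hκ : 0 < κ) (Δ : ℝ) :
    2 * cutoff κ (1 - cos Δ) - 1 - 2 * κ ≤ cos Δ := by
  rcases le_or_gt (2 * κ) (1 - cos Δ) with h | h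
  · rw [cutoff_eq_zero hκ h]
    linarith [Real.neg_one_le_cos Δ]
  · linarith [cutoff_le_one κ (1 - cos Δ)]

theorem cos_sub_ge_cutoff {κ : ℝ} (hκ : 0 < κ) {Δ : ℝ} (hΔ : 1 - cos Δ ≤ 2 * κ) (x : ℝ) :
    2 * cutoff κ (1 - cos x) - 1 - 8 * κ ≤ cos (Δ - x) := by
  rcases le_or_gt (2 * κ) (1 - cos x) with h | h
  · rw [cutoff_eq_zero hκ h]
    linarith [Real.neg_one_le_cos (Δ - x)]
  · linarith [cutoff_le_one κ (1 - cos x), one_sub_cos_sub_le Δ x]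

theorem hComp_ge (h : Flow K W a b F Ft Fθ) {κ : ℝ} (hκ : 0 < κ) (t x : ℝ) :
    2 * clusterMass W κ F t x - 1 - 2 * κ ≤ hComp a b t x := by
  rw [← h.mean_cos_sub]
  have h1 := h.mean_mono t (P := fun p => 2 * cutoff κ (1 - cos (p.1 - x)) - (1 + 2 * κ))
    (Q := fun p => cos (p.1 - x)) (by fun_prop) (by fun_prop)
    fun p _ => by linarith [cos_ge_cutoff hκ (p.1 - x)]
  rw [mean_sub (h.cont_at t) (by fun_prop) (by fun_prop), mean_const_mul, h.mean_const] at h1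
  unfold clusterMass
  linarith

/-- Writing the restoring coefficient as an average over particles shows that each particle of the
cluster contributes nearly `2` and any other at least `-2`. More than half of the mass in the
cluster therefore makes it positive for small `κ`. -/
theorem restoring_eq (h : Flow K W a b F Ft Fθ) (t x Δ : ℝ) :
    (1 + cos Δ) * hComp a b t x + sin Δ * qComp a b t x
      = mean W (F t) fun p => cos (p.1 - x) + cos (Δ - (p.1 - x)) := by
  rw [← h.mean_cos_sub, ← h.mean_sin_sub, ← mean_const_mul, ← mean_const_mul,
    ← mean_add (h.cont_at t) (by fun_prop) (by fun_prop)]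
  congr 1; ext p
  rw [Real.cos_sub Δ]; ring

theorem restoring_ge (h : Flow K W a b F Ft Fθ) {κ : ℝ} (hκ : 0 < κ) (t x : ℝ) {Δ : ℝ}
    (hΔ : 1 - cos Δ ≤ 2 * κ) :
    2 * (2 * clusterMass W κ F t x - 1) - 10 * κ
      ≤ (1 + cos Δ) * hComp a b t x + sin Δ * qComp a b t x := by
  rw [h.restoring_eq]
  have h1 := h.mean_mono t (P := fun p => 4 * cutoff κ (1 - cos (p.1 - x)) - (2 + 10 * κ))
    (Q := fun p => cos (p.1 - x) + cos (Δ - (p.1 - x))) (by fun_prop) (by fun_prop)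
    fun p _ => by linarith [cos_ge_cutoff hκ (p.1 - x), cos_sub_ge_cutoff hκ hΔ (p.1 - x)]
  rw [mean_sub (h.cont_at t) (by fun_prop) (by fun_prop), mean_const_mul, h.mean_const] at h1
  unfold clusterMass
  linarith

theorem abs_restoring_le (h : Flow K W a b F Ft Fθ) (t x Δ : ℝ) :
    |(1 + cos Δ) * hComp a b t x + sin Δ * qComp a b t x| ≤ 2 := by
  rw [h.restoring_eq]
  have h1 := h.mean_mono t (P := fun _ => -2)
    (Q := fun p => cos (p.1 - x) + cos (Δ - (p.1 - x))) (by fun_prop) (by fun_prop)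
    fun p _ => by linarith [Real.neg_one_le_cos (p.1 - x), Real.neg_one_le_cos (Δ - (p.1 - x))]
  have h2 := h.mean_mono t (P := fun p => cos (p.1 - x) + cos (Δ - (p.1 - x)))
    (Q := fun _ => 2) (by fun_prop) (by fun_prop)
    fun p _ => by linarith [Real.cos_le_one (p.1 - x), Real.cos_le_one (Δ - (p.1 - x))]
  rw [h.mean_const] at h1 h2
  exact abs_le.2 ⟨h1, h2⟩

theorem sin_sq_le_gap (Δ : ℝ) : sin Δ ^ 2 ≤ 2 * (1 - cos Δ) := by
  nlinarith [Real.sin_sq_add_cos_sq Δ, sq_nonneg (1 - cos Δ)]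

/-- A cluster that holds a fraction `m > 1/2` of the mass keeps it. -/
theorem clusterMass_ge (h : Flow K W a b F Ft Fθ) (hK : 0 < K) {T : ℝ} {ψ : ℝ → ℝ}
    (hψ : IsFrame K a b T ψ) {t₁ t : ℝ} (ht₁ : 0 ≤ t₁) (ht : t₁ ≤ t) (htT : t < T) {κ m : ℝ}
    (hκ : 0 < κ) (hm : m ≤ clusterMass W κ F t₁ (ψ t₁)) (hr : 0 < 2 * m - 1 - 6 * κ)
    (hW : W ^ 2 ≤ 2 * K ^ 2 * κ * (2 * m - 1 - 6 * κ) ^ 2) :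
    m ≤ clusterMass W κ F t (ψ t) := by
  by_contra hlt
  rw [not_le] at hlt
  set r := 2 * m - 1 - 6 * κ with hrdef
  have htt : t₁ < t := by
    rcases ht.eq_or_lt with e | e
    · subst e; exact absurd hm (not_le.2 hlt)
    · exact e
  have hder : ∀ s ∈ Ico t₁ t, HasDerivWithinAt (fun u => -clusterMass W κ F u (ψ u))
      (-mean W (F s) fun p => deriv (cutoff κ) (1 - cos (p.1 - ψ s))
        * gapVel K a b s (ψ s) (p.1 - ψ s) p.2) (Ici s) s := fun s hs =>
    ((h.hasDerivWithinAt_frame hψ (hasDerivAt_cutoff κ) (continuous_deriv_cutoff κ)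
      ⟨ht₁.trans hs.1, hs.2.trans htT⟩).mono (Ici_subset_Ici.2 (ht₁.trans hs.1))).neg
  have hcont : Continuous fun u => clusterMass W κ F u (ψ u) := by
    have := hψ.cont
    exact h.continuous_mean (Φ := fun u p => cutoff κ (1 - cos (p.1 - ψ u))) (by fun_prop)
  set ε := min (κ / 2) ((m - clusterMass W κ F t (ψ t)) / 2) with hε
  have hε0 : 0 < ε := lt_min (by positivity) (by linarith)
  have hε1 : ε ≤ κ / 2 := min_le_left _ _
  have hε2 : ε ≤ (m - clusterMass W κ F t (ψ t)) / 2 := min_le_right _ _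
  have hmain := image_le_of_deriv_right_lt_deriv_boundary (a := t₁) (b := t)
    (f := fun u => -clusterMass W κ F u (ψ u))
    (B := fun s => -m + ε / (t - t₁) * (s - t₁)) (B' := fun _ => ε / (t - t₁))
    hcont.neg.continuousOn hder (by simpa using hm)
    (fun x => by
      have := (((hasDerivAt_id x).sub_const t₁).const_mul (ε / (t - t₁))).const_add (-m)
      simpa using this) ?_ (right_mem_Icc.2 htt.le)
  · have : ε / (t - t₁) * (t - t₁) = ε := div_mul_cancel₀ _ (by linarith)
    have h2 : -clusterMass W κ F t (ψ t) ≤ -m + ε / (t - t₁) * (t - t₁) := hmain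
    linarith
  · intro s hs heq
    have hpos : 0 < ε / (t - t₁) := div_pos hε0 (by linarith)
    have hM : m - ε ≤ clusterMass W κ F s (ψ s) := by
      have h1 : ε / (t - t₁) * (s - t₁) ≤ ε := by
        rw [div_mul_eq_mul_div, div_le_iff₀ (by linarith)]
        have := hs.2
        gcongr
      have h2 : -clusterMass W κ F s (ψ s) = -m + ε / (t - t₁) * (s - t₁) := heq
      linarith
    have hnn : 0 ≤ mean W (F s) fun p => deriv (cutoff κ) (1 - cos (p.1 - ψ s))
        * gapVel K a b s (ψ s) (p.1 - ψ s) p.2 := by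
      rw [← h.mean_const s 0]
      have hcd := continuous_deriv_cutoff κ
      refine h.mean_mono s (by fun_prop) (by unfold gapVel; fun_prop) fun p hp => ?_
      rcases lt_or_ge (1 - cos (p.1 - ψ s)) κ with h1 | h1
      · rw [deriv_cutoff_eq_zero_of_lt hκ h1, zero_mul]
      rcases lt_or_ge (2 * κ) (1 - cos (p.1 - ψ s)) with h2 | h2
      · rw [deriv_cutoff_eq_zero_of_gt hκ h2, zero_mul]
      -- Only the layer `κ ≤ 1 - cos Δ ≤ 2 κ` matters. There the gap shrinks, because the frequency
      -- term is at most `2 K (1 - cos Δ) r ≤ K (1 - cos Δ) J`.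
      refine mul_nonneg_of_nonpos_of_nonpos (deriv_cutoff_nonpos hκ _) ?_
      have hJ := h.restoring_ge hκ s (ψ s) h2
      rw [gapVel_eq]
      set Δ := p.1 - ψ s
      set J := (1 + cos Δ) * hComp a b s (ψ s) + sin Δ * qComp a b s (ψ s)
      have hJr : 2 * r ≤ J := by linarith
      have hw := abs_le_of_mem_box hp
      have e1 : p.2 * sin Δ ≤ 2 * K * (1 - cos Δ) * r := by
        refine abs_le_of_sq_le_sq' ?_ (by
          have : 0 ≤ 1 - cos Δ := by linarith
          positivity) |>.2
        have e2 : p.2 ^ 2 ≤ W ^ 2 := sq_le_sq.2 (hw.trans (le_abs_self W))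
        have e3 := sin_sq_le_gap Δ
        calc (p.2 * sin Δ) ^ 2 = p.2 ^ 2 * sin Δ ^ 2 := by ring
          _ ≤ W ^ 2 * (2 * (1 - cos Δ)) := by gcongr
          _ ≤ (2 * K ^ 2 * κ * r ^ 2) * (2 * (1 - cos Δ)) := by
            have : 0 ≤ 2 * (1 - cos Δ) := by linarith
            gcongr
          _ ≤ (2 * K ^ 2 * (1 - cos Δ) * r ^ 2) * (2 * (1 - cos Δ)) := by
            have : 0 ≤ 2 * (1 - cos Δ) := by linarith
            gcongr
          _ = _ := by ring
      have e4 : 0 ≤ K * (1 - cos Δ) := mul_nonneg hK.le (by linarith)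
      nlinarith
    linarith

end Flow

/-! ## Near-monotonicity of the modulus of the order parameter -/

/-- Mean value inequality with right derivatives only, since the equation is one-sided at time `0`.
With `c = 0` and an integrating factor it replaces Grönwall's lemma below. -/
theorem add_le_of_deriv_ge {f f' : ℝ → ℝ} {c a b : ℝ} (ha : 0 ≤ a) (hab : a ≤ b)
    (hf : ContinuousOn f (Icc a b))
    (hd : ∀ x ∈ Ico a b, HasDerivWithinAt f (f' x) (Ici 0) x) (hc : ∀ x ∈ Ico a b, c ≤ f' x) :
    f a + c * (b - a) ≤ f b := by
  have := image_le_of_deriv_right_le_deriv_boundary (f := fun x => -f x) (f' := fun x => -f' x)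
    (a := a) (b := b) (B := fun x => -(f a + c * (x - a))) (B' := fun _ => -c) hf.neg
    (fun x hx => ((hd x hx).mono (Ici_subset_Ici.2 (ha.trans hx.1))).neg) (by simp)
    (by fun_prop) (fun x _ => by
      have := ((((hasDerivAt_id x).sub_const a).const_mul c).const_add (f a)).neg
      exact (this.congr_deriv (by ring)).hasDerivWithinAt)
    (fun x hx => by linarith [hc x hx]) (right_mem_Icc.2 hab)
  linarith

theorem deriv_nonpos_of_max_right {f : ℝ → ℝ} {f' a b : ℝ} (hab : a < b)
    (hd : HasDerivWithinAt f f' (Ici a) a) (hmax : ∀ x ∈ Icc a b, f x ≤ f a) : f' ≤ 0 := by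
  have h1 := hd.Ioi_of_Ici
  rw [hasDerivWithinAt_iff_tendsto_slope' (by simp)] at h1
  refine le_of_tendsto h1 ?_
  filter_upwards [Ioo_mem_nhdsGT hab] with x hx
  rw [slope_def_field]
  exact div_nonpos_of_nonpos_of_nonneg (by linarith [hmax x ⟨hx.1.le, hx.2.le⟩])
    (by linarith [hx.1])

/-- The modulus of the order parameter. -/
def modulus (a b : ℝ → ℝ) (t : ℝ) : ℝ := sqrt (Flow.Rsq a b t)

/-- The running maximum of the modulus. -/
def runMax (a b : ℝ → ℝ) (t : ℝ) : ℝ := sSup (modulus a b '' Icc 0 t)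

namespace Flow

variable {K W : ℝ} {a b : ℝ → ℝ} {F Ft Fθ : ℝ → ℝ × ℝ → ℝ}

theorem Rsq_nonneg (t : ℝ) : 0 ≤ Rsq a b t := by unfold Rsq; positivity

theorem modulus_nonneg (t : ℝ) : 0 ≤ modulus a b t := Real.sqrt_nonneg _

theorem modulus_sq (t : ℝ) : modulus a b t ^ 2 = Rsq a b t := Real.sq_sqrt (Rsq_nonneg t)

theorem modulus_le_one (h : Flow K W a b F Ft Fθ) (t : ℝ) : modulus a b t ≤ 1 := by
  rw [modulus, Real.sqrt_le_one]; exact h.Rsq_le_one t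

theorem continuous_modulus (h : Flow K W a b F Ft Fθ) : Continuous (modulus a b) :=
  h.continuous_Rsq.sqrt

theorem hComp_le_modulus (t x : ℝ) : hComp a b t x ≤ modulus a b t := by
  refine (abs_le_of_sq_le_sq' ?_ (modulus_nonneg t)).2
  rw [modulus_sq, Rsq_eq t x]
  nlinarith [sq_nonneg (qComp a b t x)]

/-- Averaging of the pointwise bound `cutoff ≥ (1 + cos Δ)/2 - sin² Δ / (2 κ)`, which holds since
`sin² Δ = (1 - cos Δ)(1 + cos Δ)`. The second moment alone cannot tell the phase from its antipode;
the mean cosine `R` does. -/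
theorem clusterMass_init (h : Flow K W a b F Ft Fθ) {t X κ x : ℝ} (hκ : 0 < κ)
    (hR : 0 < modulus a b t) (hI : dissip W a b F t ≤ X * modulus a b t ^ 2)
    (hxa : a t = modulus a b t * cos x) (hxb : b t = modulus a b t * sin x) :
    (1 + modulus a b t - X / κ) / 2 ≤ clusterMass W κ F t x := by
  have hF := h.cont_at t
  have hh : hComp a b t x = modulus a b t := by
    rw [hComp, hxa, hxb]
    linear_combination (modulus a b t) * Real.sin_sq_add_cos_sq x
  have hq : qComp a b t x = 0 := by rw [qComp, hxa, hxb]; ring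
  have hX : mean W (F t) (fun p => sin (p.1 - x) ^ 2) ≤ X := by
    have h1 : dissip W a b F t
        = modulus a b t ^ 2 * mean W (F t) fun p => sin (p.1 - x) ^ 2 := by
      rw [dissip, ← mean_const_mul]
      congr 1; ext p
      rw [S_eq t x, hh, hq]; ring
    rw [h1, mul_comm] at hI
    exact le_of_mul_le_mul_right hI (by positivity)
  have h2 := h.mean_mono t
    (P := fun p => (1 / 2) * cos (p.1 - x) + 1 / 2 - 1 / (2 * κ) * sin (p.1 - x) ^ 2)
    (Q := fun p => cutoff κ (1 - cos (p.1 - x))) (by fun_prop) (by fun_prop) fun p _ => by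
      set Δ := p.1 - x
      rcases le_or_gt (1 - cos Δ) κ with h3 | h3
      · rw [cutoff_eq_one hκ h3]
        have : 0 ≤ 1 / (2 * κ) * sin Δ ^ 2 := by positivity
        linarith [Real.cos_le_one Δ]
      · have h4 := cutoff_nonneg κ (1 - cos Δ)
        have h5 : (1 + cos Δ) / 2 ≤ 1 / (2 * κ) * sin Δ ^ 2 := by
          rw [Real.sin_sq, div_mul_eq_mul_div, le_div_iff₀ (by positivity)]
          nlinarith [Real.neg_one_le_cos Δ]
        linarith
  rw [mean_sub hF (by fun_prop) (by fun_prop), mean_add hF (by fun_prop) (by fun_prop),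
    mean_const_mul, mean_const_mul, h.mean_const, h.mean_cos_sub, hh] at h2
  have h3 : 1 / (2 * κ) * mean W (F t) (fun p => sin (p.1 - x) ^ 2) ≤ 1 / (2 * κ) * X := by
    gcongr
  have h4 : 1 / (2 * κ) * X = X / κ / 2 := by field_simp
  unfold clusterMass
  linarith

/-- A time of low dissipation starts a cluster that persists. -/
theorem exists_cluster (h : Flow K W a b F Ft Fθ) (hK : 0 < K) {t₁ T X κ x : ℝ} (ht₁ : 0 ≤ t₁)
    (hT : t₁ < T) (hκ : 0 < κ) (hR : 0 < modulus a b t₁)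
    (hI : dissip W a b F t₁ ≤ X * modulus a b t₁ ^ 2)
    (hX : X / κ + 6 * κ ≤ modulus a b t₁ / 2)
    (hW : 2 * W ^ 2 ≤ K ^ 2 * κ * modulus a b t₁ ^ 2)
    (hxa : a t₁ = modulus a b t₁ * cos x) (hxb : b t₁ = modulus a b t₁ * sin x) :
    ∃ ψ, IsFrame K a b T ψ ∧ ψ t₁ = x ∧
      ∀ t ∈ Ico t₁ T, (1 + modulus a b t₁ - X / κ) / 2 ≤ clusterMass W κ F t (ψ t) := by
  obtain ⟨ψ, hψ, hx⟩ := h.exists_frame hK (T := T) (t₁ := t₁) ⟨ht₁, hT.le⟩ x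
  refine ⟨ψ, hψ, hx, fun t ht => ?_⟩
  have h1 := h.clusterMass_init hκ hR hI hxa hxb
  rw [← hx] at h1
  refine h.clusterMass_ge hK hψ ht₁ ht.1 ht.2 hκ h1 (by linarith) ?_
  -- The margin `2 m - 1 - 6 κ` equals `R - X/κ - 6 κ`, hence is at least `R/2`.
  have h2 : modulus a b t₁ / 2 ≤ 2 * ((1 + modulus a b t₁ - X / κ) / 2) - 1 - 6 * κ := by linarith
  calc W ^ 2 ≤ 2 * K ^ 2 * κ * (modulus a b t₁ / 2) ^ 2 := by linarith
    _ ≤ _ := by gcongr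

theorem exists_phase (t : ℝ) :
    ∃ x, a t = modulus a b t * cos x ∧ b t = modulus a b t * sin x := by
  have h1 : ‖(⟨a t, b t⟩ : ℂ)‖ = modulus a b t := by
    rw [Complex.norm_eq_sqrt_sq_add_sq, modulus, Rsq]
  refine ⟨Complex.arg ⟨a t, b t⟩, ?_, ?_⟩
  · rw [← h1, Complex.norm_mul_cos_arg]
  · rw [← h1, Complex.norm_mul_sin_arg]

theorem dissip_nonneg (h : Flow K W a b F Ft Fθ) (t : ℝ) : 0 ≤ dissip W a b F t := by
  rw [← h.mean_const t 0]
  exact h.mean_mono t (by fun_prop) (by fun_prop) fun p _ => sq_nonneg _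

/-- The modulus never drops much below an earlier value. -/
theorem modulus_drop (h : Flow K W a b F Ft Fθ) (hK : 0 < K) {w : ℝ} (hw : 0 < w) (hW0 : 0 ≤ W)
    (hW : W ≤ K * w) {s t : ℝ} (hs : 0 ≤ s) (hst : s ≤ t) (hR : 26 * w ≤ modulus a b s ^ 2)
    (hRpos : 0 < modulus a b s) :
    modulus a b s - 3 * w / modulus a b s ≤ modulus a b t := by
  -- It suffices to start from the maximum on `[s, t]`, because `R - 3 w / R` increases with `R`. If
  -- the maximum is not at `t`, the derivative there is nonpositive and the dissipation is at most
  -- `w²`.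
  obtain ⟨s', hs', hmax⟩ := isCompact_Icc.exists_isMaxOn (nonempty_Icc.2 hst)
    h.continuous_modulus.continuousOn
  have hle : modulus a b s ≤ modulus a b s' := hmax (left_mem_Icc.2 hst)
  set R := modulus a b s' with hRdef
  have hRp : 0 < R := hRpos.trans_le hle
  have hmono : modulus a b s - 3 * w / modulus a b s ≤ R - 3 * w / R := by
    have : 3 * w / R ≤ 3 * w / modulus a b s := by gcongr
    linarith
  refine hmono.trans ?_
  rcases hs'.2.eq_or_lt with e | e
  · rw [← e]
    have : 0 ≤ 3 * w / R := by positivity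
    linarith
  have hs'0 : 0 ≤ s' := hs.trans hs'.1
  have hg : 2 * growth K W a b F s' ≤ 0 := by
    refine deriv_nonpos_of_max_right e
      ((h.hasDerivWithinAt_Rsq hs'0).mono (Ici_subset_Ici.2 hs'0)) fun x hx => ?_
    rw [← modulus_sq, ← modulus_sq]
    have : modulus a b x ≤ modulus a b s' := hmax ⟨hs'.1.trans hx.1, hx.2⟩
    gcongr
    exact modulus_nonneg x
  have hI : dissip W a b F s' ≤ w ^ 2 := by
    have h1 := h.two_mul_mean_freq_le hK s'
    have h2 := le_abs_self (mean W (F s') fun p => p.2 * S a b s' p.1)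
    unfold growth at hg
    have h3 : K * dissip W a b F s' ≤ W ^ 2 / K := by linarith
    have h4 : W ^ 2 / K ≤ (K * w) ^ 2 / K := by gcongr
    have h5 : (K * w) ^ 2 / K = K * w ^ 2 := by field_simp
    exact le_of_mul_le_mul_left (by linarith) hK
  have hRsq : 26 * w ≤ R ^ 2 := hR.trans (by gcongr)
  have hR1 : R ≤ 1 := h.modulus_le_one s'
  obtain ⟨x, hxa, hxb⟩ := exists_phase (a := a) (b := b) s'
  have hXκ : w ^ 2 / R ^ 2 / (w / R) = w / R := by field_simp
  have hwR : w / R ≤ R / 26 := by rw [div_le_iff₀ hRp]; linarith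
  -- The width `κ = w / R` balances the missing mass `X/κ = w/R` against the loss `2 κ` in
  -- `hComp_ge`; their sum is the drop `3 w / R`.
  obtain ⟨ψ, -, -, hM⟩ := h.exists_cluster hK (t₁ := s') (T := t + 1) (X := w ^ 2 / R ^ 2)
    (κ := w / R) hs'0 (by linarith) (by positivity) hRp
    (by rw [div_mul_cancel₀ _ (by positivity)]; exact hI)
    (by rw [hXκ]; linarith)
    (by
      have h1 : W ^ 2 ≤ (K * w) ^ 2 := by gcongr
      have h2 : K ^ 2 * (w / R) * R ^ 2 = K ^ 2 * w * R := by field_simp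
      rw [h2]
      have h3 : 2 * w ≤ R := by nlinarith
      calc 2 * W ^ 2 ≤ K ^ 2 * w * (2 * w) := by linarith
        _ ≤ K ^ 2 * w * R := by gcongr) hxa hxb
  have h1 := hM t ⟨e.le, by linarith⟩
  have h2 := h.hComp_ge (κ := w / R) (by positivity) t (ψ t)
  have h3 := hComp_le_modulus (a := a) (b := b) t (ψ t)
  rw [hXκ] at h1
  have h4 : 3 * w / R = 3 * (w / R) := by ring
  linarith

theorem bddAbove_modulus (h : Flow K W a b F Ft Fθ) (t : ℝ) :
    BddAbove (modulus a b '' Icc 0 t) :=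
  ⟨1, by rintro _ ⟨s, -, rfl⟩; exact h.modulus_le_one s⟩

theorem modulus_le_runMax (h : Flow K W a b F Ft Fθ) {s t : ℝ} (hs : 0 ≤ s) (hst : s ≤ t) :
    modulus a b s ≤ runMax a b t :=
  le_csSup (h.bddAbove_modulus t) ⟨s, ⟨hs, hst⟩, rfl⟩

theorem exists_runMax_eq (h : Flow K W a b F Ft Fθ) {t : ℝ} (ht : 0 ≤ t) :
    ∃ s ∈ Icc 0 t, modulus a b s = runMax a b t := by
  have := (isCompact_Icc.image_of_continuousOn h.continuous_modulus.continuousOn).sSup_mem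
    ((nonempty_Icc.2 ht).image (modulus a b))
  exact this

theorem runMax_mono (h : Flow K W a b F Ft Fθ) {s t : ℝ} (hs : 0 ≤ s) (hst : s ≤ t) :
    runMax a b s ≤ runMax a b t := by
  obtain ⟨u, hu, hu'⟩ := h.exists_runMax_eq hs
  rw [← hu']
  exact h.modulus_le_runMax hu.1 (hu.2.trans hst)

theorem runMax_sub_le (h : Flow K W a b F Ft Fθ) (hK : 0 < K) {w : ℝ} (hw : 0 < w) (hW0 : 0 ≤ W)
    (hW : W ≤ K * w) (hR : 26 * w ≤ modulus a b 0 ^ 2)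
    (hRpos : 0 < modulus a b 0) {t : ℝ} (ht : 0 ≤ t) :
    runMax a b t - 3 * w / runMax a b t ≤ modulus a b t := by
  obtain ⟨s, hs, hs'⟩ := h.exists_runMax_eq ht
  have h0 : modulus a b 0 ≤ modulus a b s := by
    rw [hs']; exact h.modulus_le_runMax le_rfl ht
  rw [← hs']
  exact h.modulus_drop hK hw hW0 hW hs.1 hs.2 (hR.trans (by gcongr)) (hRpos.trans_le h0)

/-- A substantial dissipation raises the modulus within a time `1 / (6 K ρ)`. -/
theorem exists_modulus_gain (h : Flow K W a b F Ft Fθ) (hK : 0 < K) (hW0 : 0 ≤ W) {s ρ : ℝ}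
    (hs : 0 ≤ s) (hρ : 0 < ρ) (hρ1 : ρ ≤ 1) (hW : W ≤ K * (ρ ^ 3 / 1000000))
    (hR : Rsq a b s ≤ 2 * ρ ^ 2) (hI : ρ ^ 4 / 10 ≤ dissip W a b F s) :
    ∃ u ∈ Icc s (s + 1 / (6 * K * ρ)), modulus a b s + 12 / 10000 * ρ ^ 2 ≤ modulus a b u := by
  set τ := 1 / (6 * K * ρ) with hτ
  have hτ0 : 0 < τ := by positivity
  have hms : modulus a b s ≤ 3 / 2 * ρ := by
    refine (abs_le_of_sq_le_sq' ?_ (by positivity)).2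
    rw [modulus_sq]; nlinarith
  -- If `R` reaches `2 ρ`, the gain is already at least `ρ / 2`. Otherwise `R ≤ 2 ρ` throughout, and
  -- the dissipation decays at rate at most `6 K ρ`.
  by_cases hcase : ∃ u ∈ Icc s (s + τ), 4 * ρ ^ 2 ≤ Rsq a b u
  · obtain ⟨u, hu, hu'⟩ := hcase
    refine ⟨u, hu, ?_⟩
    have h1 : 2 * ρ ≤ modulus a b u := by
      refine (abs_le_of_sq_le_sq' ?_ (modulus_nonneg u)).2
      rw [modulus_sq]; linarith
    nlinarith
  push Not at hcase
  have hR2 : ∀ u ∈ Icc s (s + τ), modulus a b u ≤ 2 * ρ := fun u hu => by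
    refine (abs_le_of_sq_le_sq' ?_ (by positivity)).2
    rw [modulus_sq]; linarith [hcase u hu]
  refine ⟨s + τ, ⟨by linarith, le_rfl⟩, ?_⟩
  have hWK : W ^ 2 / K ≤ K * (ρ ^ 6 / 1000000000000) := by
    rw [div_le_iff₀ hK]
    calc W ^ 2 ≤ (K * (ρ ^ 3 / 1000000)) ^ 2 := by gcongr
      _ = _ := by ring
  choose! D hD hD' using fun (t : ℝ) (ht : 0 ≤ t) => h.hasDerivWithinAt_dissip hK ht
  have hIlow : ∀ u ∈ Icc s (s + τ), 35 / 1000 * ρ ^ 4 ≤ dissip W a b F u := by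
    intro u hu
    -- This shift absorbs the frequency error: `6 K ρ e` bounds `2 W²/K`. Over the time `τ` the
    -- shifted dissipation loses at most a factor `exp 1`, so `ρ⁴/10` remains above `0.035 ρ⁴`.
    set e : ℝ := ρ ^ 5 / 3000000000000 with he
    have h1 := add_le_of_deriv_ge (c := 0) hs hu.1
      (f := fun v => exp (6 * K * ρ * (v - s)) * (dissip W a b F v + e))
      (f' := fun v => exp (6 * K * ρ * (v - s)) * (6 * K * ρ) * (dissip W a b F v + e)
        + exp (6 * K * ρ * (v - s)) * D v)
      (by have := h.continuous_dissip; fun_prop)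
      (fun v hv => by
        have h2 : HasDerivAt (fun v => exp (6 * K * ρ * (v - s)))
            (exp (6 * K * ρ * (v - s)) * (6 * K * ρ)) v := by
          have := (((hasDerivAt_id v).sub_const s).const_mul (6 * K * ρ)).exp
          exact this.congr_deriv (by simp)
        exact h2.hasDerivWithinAt.mul ((hD v (hs.trans hv.1)).add_const e))
      (fun v hv => by
        have h2 := hD' v (hs.trans hv.1)
        have h3 := hR2 v ⟨hv.1, hv.2.le.trans hu.2⟩
        have h4 := h.dissip_nonneg v
        have h5 : 3 * K * sqrt (Rsq a b v) * dissip W a b F v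
            ≤ 3 * K * (2 * ρ) * dissip W a b F v := by gcongr; exact h3
        have h6 : 2 * W ^ 2 / K = 2 * (W ^ 2 / K) := by ring
        have h7 : 6 * K * ρ * e = 2 * (K * (ρ ^ 6 / 1000000000000)) := by rw [he]; ring
        rw [mul_assoc, ← mul_add]
        refine mul_nonneg (Real.exp_pos _).le ?_
        rw [mul_add]
        linarith)
    rw [sub_self, mul_zero, Real.exp_zero, one_mul, zero_mul, add_zero] at h1
    have hE : exp (6 * K * ρ * (u - s)) ≤ 2.7182818286 := by
      have h2 : 6 * K * ρ * (u - s) ≤ 1 := by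
        have : 6 * K * ρ * τ = 1 := by rw [hτ]; field_simp
        have h3 : 6 * K * ρ * (u - s) ≤ 6 * K * ρ * τ := by
          gcongr; linarith [hu.2]
        linarith
      exact (Real.exp_le_exp.2 h2).trans Real.exp_one_lt_d9.le
    have h4 := h.dissip_nonneg u
    have he0 : 0 ≤ e := by positivity
    have h5 : exp (6 * K * ρ * (u - s)) * (dissip W a b F u + e)
        ≤ 2.7182818286 * (dissip W a b F u + e) := by gcongr
    have h6 : e ≤ ρ ^ 4 / 3000000000000 := by
      rw [he]
      have : ρ ^ 5 ≤ ρ ^ 4 := pow_le_pow_of_le_one hρ.le hρ1 (by norm_num)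
      linarith
    nlinarith
  have hgain := add_le_of_deriv_ge (c := 34 / 1000 * K * ρ ^ 4) hs (by linarith : s ≤ s + τ)
    h.continuous_Rsq.continuousOn (fun v hv => h.hasDerivWithinAt_Rsq (hs.trans hv.1))
    (fun v hv => by
      have h1 := hIlow v ⟨hv.1, hv.2.le⟩
      have h2 := h.two_mul_mean_freq_le hK v
      have h3 := le_abs_self (mean W (F v) fun p => p.2 * S a b v p.1)
      unfold growth
      have h4 : K * (35 / 1000 * ρ ^ 4) ≤ K * dissip W a b F v := by gcongr
      have h5 : ρ ^ 6 ≤ ρ ^ 4 := pow_le_pow_of_le_one hρ.le hρ1 (by norm_num)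
      have h6 : K * (ρ ^ 6 / 1000000000000) ≤ K * (ρ ^ 4 / 1000000000000) := by gcongr
      have h7 : 0 ≤ K * ρ ^ 4 := by positivity
      linarith)
  have h1 : 34 / 1000 * K * ρ ^ 4 * (s + τ - s) = 34 / 6000 * ρ ^ 3 := by
    rw [hτ]; field_simp; ring
  rw [h1, ← modulus_sq, ← modulus_sq] at hgain
  by_contra hlt
  rw [not_le] at hlt
  have h2 := modulus_nonneg (a := a) (b := b) s
  have h3 := hR2 (s + τ) ⟨by linarith, le_rfl⟩
  have h4 := modulus_nonneg (a := a) (b := b) (s + τ)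
  nlinarith [sq_nonneg ρ, mul_pos hρ hρ]

/-- The gain of `R` exceeds by far the gap `3 w / U` between `R` and its running maximum `U`, so it
passes to `U`. -/
theorem runMax_gain (h : Flow K W a b F Ft Fθ) (hK : 0 < K) (hW0 : 0 ≤ W) {s ρ w : ℝ}
    (hw : 0 < w) (hW : W ≤ K * w) (hwR : 26 * w ≤ modulus a b 0 ^ 2) (hRpos : 0 < modulus a b 0)
    (hs : 0 ≤ s) (hρ : 0 < ρ) (hρ1 : ρ ≤ 1) (hwρ : w ≤ ρ ^ 3 / 1000000)
    (hρs : ρ ≤ runMax a b s)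
    (hR : Rsq a b s ≤ 2 * ρ ^ 2) (hI : ρ ^ 4 / 10 ≤ dissip W a b F s) :
    runMax a b s + ρ ^ 2 / 1000 ≤ runMax a b (s + 1 / (6 * K * ρ)) := by
  obtain ⟨u, hu, hu'⟩ := h.exists_modulus_gain hK hW0 hs hρ hρ1
    (hW.trans (by gcongr)) hR hI
  have h1 := h.runMax_sub_le hK hw hW0 hW hwR hRpos hs
  have h2 := h.modulus_le_runMax (hs.trans hu.1) hu.2
  have h3 : 3 * w / runMax a b s ≤ 3 * (ρ ^ 3 / 1000000) / ρ := by gcongr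
  have h4 : 3 * (ρ ^ 3 / 1000000) / ρ = 3 / 1000000 * ρ ^ 2 := by field_simp
  nlinarith [sq_nonneg ρ]

end Flow

/-! ## The dyadic times -/

/-- The properties of the modulus of the order parameter on which the dyadic construction rests. -/
structure IsModulus (R : ℝ → ℝ) : Prop where
  deriv : ∀ t, 0 ≤ t → HasDerivWithinAt R (dotR R t) (Ici 0) t
  cont_dot : ContinuousOn (dotR R) (Ici 0)
  pos_zero : 0 < R 0
  nonneg : ∀ t, 0 ≤ R t
  le_one : ∀ t, 0 ≤ t → R t ≤ 1

theorem level_zero (R : ℝ → ℝ) : level R 0 = R 0 := by simp [level]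

theorem level_succ (R : ℝ → ℝ) (k : ℕ) : level R (k + 1) = sqrt 2 * level R k := by
  unfold level; ring

theorem level_succ_sq (R : ℝ → ℝ) (k : ℕ) : level R (k + 1) ^ 2 = 2 * level R k ^ 2 := by
  rw [level_succ, mul_pow, Real.sq_sqrt (by norm_num)]

theorem rTime_le_succ (R : ℝ → ℝ) (k : ℕ) : rTime R k ≤ rTime R (k + 1) := by
  rw [rTime]
  refine le_sInf ?_
  rintro _ ⟨t, rfl, ht, -⟩
  exact ht

theorem rTime_mono (R : ℝ → ℝ) : Monotone (rTime R) := monotone_nat_of_le_succ (rTime_le_succ R)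

theorem rTime_nonneg (R : ℝ → ℝ) (k : ℕ) : 0 ≤ rTime R k := rTime_mono R (Nat.zero_le k)

theorem sq_lt_of_mem {R : ℝ → ℝ} {k : ℕ} {t : ℝ} (h1 : rTime R k ≤ t)
    (h2 : (t : EReal) < rTime R (k + 1)) : R t ^ 2 < 2 * level R k ^ 2 := by
  by_contra h
  rw [not_lt] at h
  refine absurd h2 (not_lt.2 ?_)
  rw [rTime]
  exact sInf_le ⟨t, rfl, h1, h⟩

theorem nonneg_of_rTime_le {R : ℝ → ℝ} {k : ℕ} {t : ℝ} (h1 : rTime R k ≤ t) : 0 ≤ t :=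
  EReal.coe_nonneg.1 ((rTime_nonneg R k).trans h1)

namespace IsModulus

variable {R : ℝ → ℝ}

theorem cont (h : IsModulus R) : ContinuousOn R (Ici 0) :=
  fun t ht => (h.deriv t ht).continuousWithinAt

theorem level_pos (h : IsModulus R) (k : ℕ) : 0 < level R k := by
  have := h.pos_zero
  unfold level; positivity

theorem level_mono (h : IsModulus R) : Monotone (level R) := by
  refine monotone_nat_of_le_succ fun k => ?_
  have h1 := h.level_pos k
  have h2 := level_succ_sq R k
  nlinarith [h.level_pos (k + 1)]

/-- Unlike `sq_lt_of_mem`, this needs no lower bound on `t`: before `r_k` a stronger bound with a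
smaller level holds. -/
theorem sq_lt (h : IsModulus R) {t : ℝ} (ht : 0 ≤ t) :
    ∀ k, (t : EReal) < rTime R (k + 1) → R t ^ 2 < 2 * level R k ^ 2 := by
  intro k
  induction k with
  | zero => exact fun h2 => sq_lt_of_mem (by simpa [rTime] using ht) h2
  | succ k ih =>
    intro h2
    rcases le_or_gt (rTime R (k + 1)) (t : EReal) with h3 | h3
    · exact sq_lt_of_mem h3 h2
    · have := ih h3
      have h4 := level_succ_sq R k
      have h5 := h.level_pos k
      nlinarith

theorem exists_rTime_eq (h : IsModulus R) : ∀ k, rTime R k < ⊤ →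
    ∃ r : ℝ, 0 ≤ r ∧ rTime R k = r ∧ level R k ≤ R r := by
  intro k
  induction k with
  | zero => exact fun _ => ⟨0, le_rfl, by simp [rTime], by rw [level_zero]⟩
  | succ k ih =>
    intro hk
    obtain ⟨r, hr0, hr, -⟩ := ih ((rTime_le_succ R k).trans_lt hk)
    set A : Set ℝ := {t | r ≤ t ∧ 2 * level R k ^ 2 ≤ R t ^ 2} with hA
    have hAE : rTime R (k + 1) = sInf ((fun t : ℝ => (t : EReal)) '' A) := by
      rw [rTime, hr]
      congr 1; ext τ
      simp only [hA, mem_ofPred_eq, mem_image, EReal.coe_le_coe_iff]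
      constructor
      · rintro ⟨t, rfl, h1, h2⟩; exact ⟨t, ⟨h1, h2⟩, rfl⟩
      · rintro ⟨t, ⟨h1, h2⟩, rfl⟩; exact ⟨t, rfl, h1, h2⟩
    have hne : A.Nonempty := by
      by_contra hne
      rw [not_nonempty_iff_eq_empty] at hne
      rw [hAE, hne] at hk
      simp at hk
    have hbdd : BddBelow A := ⟨r, fun t ht => ht.1⟩
    have hcl : IsClosed A := by
      have h1 : ContinuousOn (fun t => R t ^ 2) (Ici r) :=
        (h.cont.mono (Ici_subset_Ici.2 hr0)).pow 2
      have := h1.preimage_isClosed_of_isClosed isClosed_Ici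
        (isClosed_Ici (a := 2 * level R k ^ 2))
      exact this
    have hmem := hcl.csInf_mem hne hbdd
    refine ⟨sInf A, hr0.trans hmem.1, ?_, ?_⟩
    · rw [hAE]
      refine le_antisymm (sInf_le ⟨_, hmem, rfl⟩) (le_sInf ?_)
      rintro _ ⟨t, ht, rfl⟩
      exact EReal.coe_le_coe_iff.2 (csInf_le hbdd ht)
    · refine (abs_le_of_sq_le_sq' ?_ (h.nonneg _)).2
      rw [level_succ_sq]; exact hmem.2

theorem level_le_one (h : IsModulus R) {k : ℕ} (hk : rTime R k < ⊤) : level R k ≤ 1 := by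
  obtain ⟨r, hr0, -, hr⟩ := h.exists_rTime_eq k hk
  exact hr.trans (h.le_one r hr0)

/-- The levels grow geometrically, whereas a level that is reached is at most `1`. -/
theorem exists_bound (h : IsModulus R) : ∃ N, ∀ k, rTime R k < ⊤ → k ≤ N := by
  have h1 : (1 : ℝ) < sqrt 2 := by
    rw [Real.lt_sqrt (by norm_num)]; norm_num
  obtain ⟨N, hN⟩ := pow_unbounded_of_one_lt (1 / R 0) h1
  refine ⟨N, fun k hk => ?_⟩
  by_contra hlt
  rw [not_le] at hlt
  have h2 := h.level_le_one hk
  have h3 := h.level_mono hlt.le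
  have h4 : 1 < level R N := by
    unfold level
    rwa [div_lt_iff₀ h.pos_zero] at hN
  linarith

theorem bddAbove_index (h : IsModulus R) {τ : EReal} (hτ : τ < ⊤) :
    BddAbove {k : ℕ | rTime R k ≤ τ} := by
  obtain ⟨N, hN⟩ := h.exists_bound
  exact ⟨N, fun k hk => hN k (lt_of_le_of_lt hk hτ)⟩

theorem le_indexAt (h : IsModulus R) {τ : EReal} (hτ : τ < ⊤) {k : ℕ} (hk : rTime R k ≤ τ) :
    k ≤ indexAt R τ := le_csSup (h.bddAbove_index hτ) hk

theorem rTime_indexAt_le (h : IsModulus R) {τ : EReal} (hτ : τ < ⊤) (hτ0 : 0 ≤ τ) :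
    rTime R (indexAt R τ) ≤ τ :=
  Nat.sSup_mem (s := {k : ℕ | rTime R k ≤ τ}) ⟨0, by simpa [rTime] using hτ0⟩
    (h.bddAbove_index hτ)

theorem lt_rTime_indexAt_succ (h : IsModulus R) {τ : EReal} (hτ : τ < ⊤) :
    τ < rTime R (indexAt R τ + 1) := by
  by_contra hlt
  rw [not_lt] at hlt
  have := h.le_indexAt hτ hlt
  omega

theorem indexAt_eq (h : IsModulus R) {τ : EReal} (hτ : τ < ⊤) {k : ℕ} (h1 : rTime R k ≤ τ)
    (h2 : τ < rTime R (k + 1)) : indexAt R τ = k := by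
  refine le_antisymm ?_ (h.le_indexAt hτ h1)
  by_contra hlt
  rw [not_le] at hlt
  have h3 := rTime_mono R (Nat.succ_le_of_lt hlt)
  have h4 := h.rTime_indexAt_le hτ ((rTime_nonneg R k).trans h1)
  exact absurd (h3.trans h4) (not_le.2 h2)

/-! ### The initial time -/

section InitialTime

variable {K : ℝ}

/-- A slope above `c` during a time `2 / c` would raise `R` by `2`, beyond its bound `1`. Hence the
sets that define `T_{-1}^k` are nonempty. -/
theorem exists_dotR_le (h : IsModulus R) {c r : ℝ} (hc : 0 < c) (hr : 0 ≤ r) :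
    ∃ t, r ≤ t ∧ dotR R t ≤ c := by
  by_contra! hlt
  have h1 := add_le_of_deriv_ge (c := c) hr (by have := div_pos two_pos hc; linarith : r ≤ r + 2 / c)
    (h.cont.mono fun x hx => hr.trans hx.1) (fun x hx => h.deriv x (hr.trans hx.1))
    fun x hx => (hlt x hx.1).le
  have h2 : c * (r + 2 / c - r) = 2 := by field_simp; ring
  have h3 := h.nonneg r
  have h4 := h.le_one (r + 2 / c) (by positivity)
  linarith

theorem initialTimeAt_mem (h : IsModulus R) (hK : 0 < K) {k : ℕ} (hk : rTime R k < ⊤) :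
    rTime R k ≤ (initialTimeAt R K k : EReal) ∧
      dotR R (initialTimeAt R K k) ≤ K * level R k ^ 3 / constQ := by
  obtain ⟨r, hr0, hr, -⟩ := h.exists_rTime_eq k hk
  have hpos : 0 < K * level R k ^ 3 / constQ := by
    have := h.level_pos k
    unfold constQ; positivity
  have hset : {t : ℝ | rTime R k ≤ (t : EReal) ∧ dotR R t ≤ K * level R k ^ 3 / constQ}
      = {t | r ≤ t ∧ dotR R t ≤ K * level R k ^ 3 / constQ} := by
    rw [hr]; simp
  have hcl : IsClosed {t | r ≤ t ∧ dotR R t ≤ K * level R k ^ 3 / constQ} :=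
    (h.cont_dot.mono (Ici_subset_Ici.2 hr0)).preimage_isClosed_of_isClosed isClosed_Ici
        (isClosed_Iic (a := K * level R k ^ 3 / constQ))
  have := hcl.csInf_mem (h.exists_dotR_le hpos hr0) ⟨r, fun t ht => ht.1⟩
  rw [← hset] at this
  exact this

theorem initialTimeAt_le {k : ℕ} {t : ℝ} (h1 : rTime R k ≤ (t : EReal))
    (h2 : dotR R t ≤ K * level R k ^ 3 / constQ) : initialTimeAt R K k ≤ t := by
  refine csInf_le ⟨0, fun s hs => ?_⟩ ⟨h1, h2⟩
  exact nonneg_of_rTime_le hs.1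

theorem finite_initialTimes (h : IsModulus R) (K : ℝ) :
    {T : ℝ | ∃ k : ℕ, rTime R k < ⊤ ∧ T = initialTimeAt R K k}.Finite := by
  obtain ⟨N, hN⟩ := h.exists_bound
  refine ((finite_Iic N).image (initialTimeAt R K)).subset ?_
  rintro _ ⟨k, hk, rfl⟩
  exact ⟨k, hN k hk, rfl⟩

theorem exists_initialTime_eq (h : IsModulus R) (K : ℝ) :
    ∃ k : ℕ, rTime R k < ⊤ ∧ initialTime R K = initialTimeAt R K k :=
  Set.Nonempty.csInf_mem
    (s := {T : ℝ | ∃ k : ℕ, rTime R k < ⊤ ∧ T = initialTimeAt R K k})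
    ⟨_, 0, by simp [rTime], rfl⟩ (h.finite_initialTimes K)

theorem initialTime_nonneg (h : IsModulus R) (hK : 0 < K) : 0 ≤ initialTime R K := by
  obtain ⟨k, hk, he⟩ := h.exists_initialTime_eq K
  rw [he]
  exact nonneg_of_rTime_le (h.initialTimeAt_mem hK hk).1

theorem rTime_kZero_le (h : IsModulus R) (hK : 0 < K) :
    rTime R (kZero R K) ≤ (initialTime R K : EReal) :=
  h.rTime_indexAt_le (EReal.coe_lt_top _) (EReal.coe_nonneg.2 (h.initialTime_nonneg hK))

theorem lt_rTime_kZero_succ (h : IsModulus R) :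
    (initialTime R K : EReal) < rTime R (kZero R K + 1) :=
  h.lt_rTime_indexAt_succ (EReal.coe_lt_top _)

/-- The minimum is attained at some index `k` with `r_k ≤ t_0`, hence `k ≤ k_0`, and the threshold
increases with the level. -/
theorem dotR_initialTime_le (h : IsModulus R) (hK : 0 < K) :
    dotR R (initialTime R K) ≤ K * level R (kZero R K) ^ 3 / constQ := by
  obtain ⟨k, hk, he⟩ := h.exists_initialTime_eq K
  obtain ⟨h1, h2⟩ := h.initialTimeAt_mem hK hk
  rw [← he] at h1 h2
  have h3 := h.level_mono (h.le_indexAt (EReal.coe_lt_top _) h1)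
  have h4 := h.level_pos k
  refine h2.trans ?_
  have : (0 : ℝ) < constQ := by unfold constQ; norm_num
  unfold kZero
  gcongr

theorem lt_dotR_of_lt_initialTime (h : IsModulus R) {t : ℝ}
    (ht : t < initialTime R K) {k : ℕ} (hk : rTime R k ≤ (t : EReal)) :
    K * level R k ^ 3 / constQ < dotR R t := by
  by_contra hle
  rw [not_lt] at hle
  have h1 := initialTimeAt_le hk hle
  have h2 : initialTime R K ≤ initialTimeAt R K k :=
    csInf_le (h.finite_initialTimes K).bddBelow
      ⟨k, hk.trans_lt (EReal.coe_lt_top _), rfl⟩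
  linarith

end InitialTime

end IsModulus

/-! ## Growth and decay of the quadratic functionals -/

/-- The frequencies are small compared with the cube of the initial order parameter. -/
structure Tame (K W w : ℝ) (a b : ℝ → ℝ) : Prop where
  K_pos : 0 < K
  W_nonneg : 0 ≤ W
  w_pos : 0 < w
  W_le : W ≤ K * w
  w_le : w ≤ modulus a b 0 ^ 3 / 1000000
  R_pos : 0 < modulus a b 0

/-- The square of the `L²` norm. -/
def sqNorm (W : ℝ) (F : ℝ → ℝ × ℝ → ℝ) (t : ℝ) : ℝ := mean W (fun p => F t p ^ 2) fun _ => 1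

/-- The weight that vanishes on `y ≤ η` and grows linearly in `y`. -/
def weight (η y : ℝ) : ℝ := max (y - η) 0 ^ 2 / y

/-- The derivative of the weight. -/
def weightDeriv (η y : ℝ) : ℝ := max (y - η) 0 * (y + η) / y ^ 2

/-! ### The weight in the gap variable -/

section Weight

variable {η y : ℝ}

theorem weight_eq_zero (hy : y ≤ η) : weight η y = 0 := by
  rw [weight, max_eq_right (by linarith)]; simp

theorem weightDeriv_eq_zero (hy : y ≤ η) : weightDeriv η y = 0 := by
  rw [weightDeriv, max_eq_right (by linarith)]; simp

theorem weight_nonneg (hη : 0 < η) (y : ℝ) : 0 ≤ weight η y := by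
  rcases le_or_gt y η with h | h
  · rw [weight_eq_zero h]
  · unfold weight
    have : 0 < y := hη.trans h
    positivity

theorem weight_le (hη : 0 < η) (hy : 0 ≤ y) : weight η y ≤ y := by
  rcases le_or_gt y η with h | h
  · rw [weight_eq_zero h]; exact hy
  · have : 0 < y := hη.trans h
    rw [weight, max_eq_left (by linarith), div_le_iff₀ this]
    nlinarith

theorem le_weight (hη : 0 < η) (y : ℝ) : y - 2 * η ≤ weight η y := by
  rcases le_or_gt y η with h | h
  · rw [weight_eq_zero h]; linarith
  · have : 0 < y := hη.trans h
    rw [weight, max_eq_left (by linarith), le_div_iff₀ this]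
    nlinarith [sq_nonneg η]

theorem hasDerivAt_weight (hη : 0 < η) (y : ℝ) : HasDerivAt (weight η) (weightDeriv η y) y := by
  rcases lt_or_ge y η with h | h
  · rw [weightDeriv_eq_zero h.le]
    refine (hasDerivAt_const y (0 : ℝ)).congr_of_eventuallyEq ?_
    filter_upwards [Iio_mem_nhds h] with u hu using weight_eq_zero (le_of_lt hu)
  · have hy : 0 < y := hη.trans_le h
    have h1 : HasDerivAt (fun y => max (y - η) 0 ^ 2) (2 * max (y - η) 0) y := by
      rcases h.eq_or_lt with e | e
      · subst e
        rw [sub_self, max_self, mul_zero, hasDerivAt_iff_isLittleO]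
        have h2 : (fun x => max (x - η) 0 ^ 2 - max (η - η) 0 ^ 2 - (x - η) • (0 : ℝ))
            = fun x => max (x - η) 0 ^ 2 := by ext x; simp
        rw [h2]
        have h3 : (fun x => max (x - η) 0 ^ 2) =O[nhds η] fun x => (x - η) ^ 2 := by
          refine Asymptotics.IsBigO.of_bound 1 (Filter.Eventually.of_forall fun x => ?_)
          rw [one_mul, Real.norm_eq_abs, Real.norm_eq_abs, abs_of_nonneg (sq_nonneg _),
            abs_of_nonneg (sq_nonneg _)]
          rcases le_total (x - η) 0 with h4 | h4
          · rw [max_eq_right h4]; linarith [sq_nonneg (x - η)]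
          · rw [max_eq_left h4]
        refine h3.trans_isLittleO ?_
        simpa using Asymptotics.isLittleO_pow_sub_sub η (m := 2) (by norm_num)
      · rw [max_eq_left (by linarith)]
        have h2 := ((hasDerivAt_id y).sub_const η).pow 2
        refine (h2.congr_of_eventuallyEq ?_).congr_deriv (by simp)
        filter_upwards [Ioi_mem_nhds e] with u hu
        rw [mem_Ioi] at hu
        rw [max_eq_left (by linarith)]; rfl
    have h2 := h1.div (hasDerivAt_id y) hy.ne'
    refine h2.congr_deriv ?_
    rw [weightDeriv, max_eq_left (by linarith)]
    simp only [id]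
    ring

theorem continuous_weightDeriv (hη : 0 < η) : Continuous (weightDeriv η) := by
  rw [continuous_iff_continuousAt]
  intro y
  rcases lt_or_ge y η with h | h
  · refine (continuousAt_const (y := (0 : ℝ))).congr ?_
    filter_upwards [Iio_mem_nhds h] with u hu using (weightDeriv_eq_zero (le_of_lt hu)).symm
  · have hy : 0 < y := hη.trans_le h
    unfold weightDeriv
    have : y ^ 2 ≠ 0 := by positivity
    fun_prop (disch := assumption)

theorem continuous_weight (hη : 0 < η) : Continuous (weight η) :=
  continuous_iff_continuousAt.2 fun y => (hasDerivAt_weight hη y).continuousAt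

end Weight

/-- The weighted `L²` functional in the frame `ψ`. -/
def weightedSq (W η : ℝ) (F : ℝ → ℝ × ℝ → ℝ) (ψ : ℝ → ℝ) (t : ℝ) : ℝ :=
  mean W (fun p => F t p ^ 2) fun p => weight η (1 - cos (p.1 - ψ t))

namespace Flow

variable {K W w : ℝ} {a b : ℝ → ℝ} {F Ft Fθ : ℝ → ℝ × ℝ → ℝ}

theorem mean_sq_mono (h : Flow K W a b F Ft Fθ) (t : ℝ) {P Q : ℝ × ℝ → ℝ} (hP : Continuous P)
    (hQ : Continuous Q) (hPQ : ∀ p ∈ box W, P p ≤ Q p) :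
    mean W (fun p => F t p ^ 2) P ≤ mean W (fun p => F t p ^ 2) Q :=
  Kuramoto.mean_mono ((h.cont_at t).pow 2) (fun _ => sq_nonneg _) hP hQ hPQ

theorem sqNorm_nonneg (h : Flow K W a b F Ft Fθ) (t : ℝ) : 0 ≤ sqNorm W F t := by
  have := h.mean_sq_mono t (P := fun _ => 0) (Q := fun _ => 1) (by fun_prop) (by fun_prop)
    (fun _ _ => zero_le_one)
  simpa [mean, sqNorm] using this

theorem continuous_mean_sq (h : Flow K W a b F Ft Fθ) {Φ : ℝ → ℝ × ℝ → ℝ}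
    (hΦ : Continuous (Function.uncurry Φ)) :
    Continuous fun t => mean W (fun p => F t p ^ 2) (Φ t) := by
  have := h.cont
  exact continuous_parametric_integral_of_continuous (f := fun t p => Φ t p * F t p ^ 2)
    (by fun_prop) (isCompact_box W)

/-- The norm changes only through the divergence, and minus the divergence at `θ` is `K` times the
component of the order parameter along `θ`. -/
theorem hasDerivWithinAt_sqNorm (h : Flow K W a b F Ft Fθ) (hK : 0 < K) {t : ℝ} (ht : 0 ≤ t) :
    ∃ D, HasDerivWithinAt (sqNorm W F) D (Ici 0) t ∧ D ≤ K * modulus a b t * sqNorm W F t := by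
  have h1 := h.hasDerivWithinAt_mean_sq (Φ := fun _ _ => 1) (Φt := fun _ _ => 0)
    (Φθ := fun _ _ => 0) (T := t + 1) (by fun_prop) (by fun_prop) (by fun_prop)
    (fun s _ θ => hasDerivWithinAt_const _ _ _) (fun _ θ => hasDerivAt_const _ _)
    (fun _ _ => rfl) ⟨ht, by linarith⟩
  refine ⟨_, h1, ?_⟩
  rw [sqNorm, ← mean_const_mul]
  refine h.mean_sq_mono t (by unfold vel velDiv; fun_prop) (by fun_prop) fun p _ => ?_
  have h2 := hComp_le_modulus (a := a) (b := b) t p.1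
  have h3 : velDiv K a b t p = -K * hComp a b t p.1 := by unfold velDiv hComp; ring
  rw [h3]
  nlinarith

theorem sqNorm_le_exp (h : Flow K W a b F Ft Fθ) (hK : 0 < K) {s t : ℝ} (hs : 0 ≤ s)
    (hst : s ≤ t) : sqNorm W F t ≤ sqNorm W F s * exp (K * (t - s)) := by
  choose! D hD hD' using fun (t : ℝ) (ht : 0 ≤ t) => h.hasDerivWithinAt_sqNorm hK ht
  have hc : Continuous (sqNorm W F) := h.continuous_mean_sq (Φ := fun _ _ => 1) (by fun_prop)
  have h1 := add_le_of_deriv_ge (c := 0) hs hst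
    (f := fun v => -(exp (-K * (v - s)) * sqNorm W F v))
    (f' := fun v => -(exp (-K * (v - s)) * (-K) * sqNorm W F v + exp (-K * (v - s)) * D v))
    (by fun_prop)
    (fun v hv => by
      have h2 : HasDerivAt (fun v => exp (-K * (v - s))) (exp (-K * (v - s)) * (-K)) v := by
        have := (((hasDerivAt_id v).sub_const s).const_mul (-K)).exp
        exact this.congr_deriv (by simp)
      exact (h2.hasDerivWithinAt.mul (hD v (hs.trans hv.1))).neg)
    (fun v hv => by
      have h2 := hD' v (hs.trans hv.1)
      have h3 := h.modulus_le_one v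
      have h4 := h.sqNorm_nonneg v
      have h5 : K * modulus a b v * sqNorm W F v ≤ K * 1 * sqNorm W F v := by gcongr
      have h6 := Real.exp_pos (-K * (v - s))
      nlinarith)
  simp only [sub_self, mul_zero, Real.exp_zero, one_mul, zero_mul, add_zero] at h1
  have h2 : exp (-K * (t - s)) * exp (K * (t - s)) = 1 := by
    rw [← Real.exp_add]; simp
  have h3 : exp (-K * (t - s)) * sqNorm W F t ≤ sqNorm W F s := by linarith
  calc sqNorm W F t = exp (-K * (t - s)) * sqNorm W F t * exp (K * (t - s)) := by
        rw [mul_right_comm, h2, one_mul]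
    _ ≤ _ := by gcongr

/-- The scalar inequality behind `weight_rate_le`. Inside the cluster region `J` is of order `ρ`,
and `2 K J η y` beats the frequency term `c (y + η)`. Outside it `J` may be as low as `-2`, but `y`
is of order `ρ` at least, and a tenth of the decay `K H` absorbs every error. -/
theorem rate_bound {r ρ H J y η c : ℝ} (hK : 0 < K) (hr0 : 0 < r) (hrρ : r ≤ ρ) (hρ1 : ρ ≤ 1)
    (hη : η = r ^ 2 / 4000) (hy : η < y) (hH : 93 / 100 * ρ ≤ H) (hJ : -2 ≤ J)
    (hJ' : y ≤ 2 * (ρ / 50) → 174 / 100 * ρ ≤ J) (hc : c ≤ K * (r ^ 3 / 1000000)) :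
    c * (y + η) - 2 * K * J * η * y ≤ 1 / 10 * K * H * (y - η) * y := by
  have hη0 : 0 < η := by rw [hη]; positivity
  have hy0 : 0 < y := hη0.trans hy
  have hρ : 0 < ρ := hr0.trans_le hrρ
  have hH0 : 0 ≤ H := by linarith
  have hr3 : r ^ 3 ≤ r ^ 2 := pow_le_pow_of_le_one hr0.le (hrρ.trans hρ1) (by norm_num)
  have h5 : c * (y + η) ≤ K * (r ^ 3 / 1000000) * (y + η) := by gcongr
  rcases le_or_gt y (2 * (ρ / 50)) with h2 | h2
  · have h4 : 174 / 100 * r ≤ J := by linarith [hJ' h2]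
    have h6 : K * (r ^ 3 / 1000000) * (y + η) ≤ K * (r ^ 3 / 1000000) * (2 * y) := by
      gcongr; linarith
    have h7 : 2 * K * (174 / 100 * r) * η * y ≤ 2 * K * J * η * y := by gcongr
    have h8 : 2 * K * (174 / 100 * r) * η * y = 348 / 400000 * (K * r ^ 3 * y) := by
      rw [hη]; ring
    have h9 : 0 ≤ 1 / 10 * K * H * (y - η) * y := by
      have : 0 ≤ y - η := by linarith
      positivity
    have h10 : 0 ≤ K * r ^ 3 * y := by positivity
    linarith
  · have h6 : K * (r ^ 3 / 1000000) * (y + η) ≤ K * (r ^ 2 / 1000000) * (2 * y) := by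
      gcongr; linarith
    have h7 : 2 * K * η * y * (-2) ≤ 2 * K * η * y * J := by gcongr
    have h8 : 2 * K * η * y = r ^ 2 / 2000 * (K * y) := by rw [hη]; ring
    have hr2 : r ^ 2 ≤ ρ ^ 2 := by gcongr
    have hyη : ρ / 26 ≤ y - η := by
      have : ρ ^ 2 ≤ ρ := by nlinarith
      rw [hη]; linarith
    have h9 : 1 / 10 * K * (93 / 100 * ρ) * (ρ / 26) * y ≤ 1 / 10 * K * H * (y - η) * y := by
      gcongr
    have h10 : 0 ≤ K * y := by positivity
    have h11 : r ^ 2 * (K * y) ≤ ρ ^ 2 * (K * y) := by gcongr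
    have h12 : 0 ≤ ρ ^ 2 * (K * y) := by positivity
    linarith

/-- The bounds in the frame of a cluster of relative mass close to `(1 + ρ) / 2`. -/
theorem weight_rate_le (h : Flow K W a b F Ft Fθ) (hT : Tame K W w a b) {t x ρ : ℝ}
    (hρ0 : modulus a b 0 ≤ ρ) (hρ1 : ρ ≤ 1)
    (hM : (1 + 97 / 100 * ρ) / 2 ≤ clusterMass W (ρ / 50) F t x) {p : ℝ × ℝ} (hp : p ∈ box W) :
    weightDeriv (modulus a b 0 ^ 2 / 4000) (1 - cos (p.1 - x)) * gapVel K a b t x (p.1 - x) p.2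
      + K * (hComp a b t x * cos (p.1 - x) + qComp a b t x * sin (p.1 - x))
        * weight (modulus a b 0 ^ 2 / 4000) (1 - cos (p.1 - x))
      ≤ -(9 / 10 * K * hComp a b t x) * weight (modulus a b 0 ^ 2 / 4000) (1 - cos (p.1 - x)) := by
  have hK := hT.K_pos
  set r := modulus a b 0 with hr
  have hr0 : 0 < r := hT.R_pos
  have hρ : 0 < ρ := hr0.trans_le hρ0
  set η := r ^ 2 / 4000 with hη
  have hη0 : 0 < η := by positivity
  have hh := h.hComp_ge (κ := ρ / 50) (by positivity) t x
  have hJ := h.restoring_ge (κ := ρ / 50) (by positivity) t x (Δ := p.1 - x)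
  have hJ2 := h.abs_restoring_le t x (p.1 - x)
  rw [gapVel_eq]
  set Δ := p.1 - x
  set H := hComp a b t x
  set q := qComp a b t x
  set J := (1 + cos Δ) * H + sin Δ * q with hJdef
  have hJH : H * cos Δ + q * sin Δ = J - H := by rw [hJdef]; ring
  rw [hJH]
  set y := 1 - cos Δ with hy
  rcases le_or_gt y η with h1 | h1
  · rw [weight_eq_zero h1, weightDeriv_eq_zero h1]; simp
  have hy0 : 0 < y := hη0.trans h1
  have hw := abs_le_of_mem_box hp
  have hws : p.2 * sin Δ ≤ K * (r ^ 3 / 1000000) := by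
    have e1 : |p.2 * sin Δ| ≤ W := by
      rw [abs_mul]
      have := Real.abs_sin_le_one Δ
      nlinarith [abs_nonneg p.2, abs_nonneg (sin Δ)]
    have e2 : K * w ≤ K * (r ^ 3 / 1000000) := by gcongr; exact hT.w_le
    linarith [le_abs_self (p.2 * sin Δ), hT.W_le]
  have hHρ : 93 / 100 * ρ ≤ H := by linarith
  have key := rate_bound hK hr0 hρ0 hρ1 hη h1 hHρ (abs_le.1 hJ2).1
    (fun h2 => by linarith [hJ h2]) hws
  rw [weight, weightDeriv, max_eq_left (by linarith)]
  -- For a linear weight the terms in `J` from transport and divergence would cancel exactly,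
  -- leaving `-K H`. The cutoff leaves the remainder `-2 K J η (y - η) / y`.
  have h2 : (y - η) * (y + η) / y ^ 2 * (p.2 * sin Δ - K * y * J)
      + K * (J - H) * ((y - η) ^ 2 / y) - -(9 / 10 * K * H) * ((y - η) ^ 2 / y)
      = (y - η) / y ^ 2 * (p.2 * sin Δ * (y + η) - 2 * K * J * η * y
        - 1 / 10 * K * H * (y - η) * y) := by
    field_simp; ring
  have h3 : 0 ≤ (y - η) / y ^ 2 := div_nonneg (by linarith) (by positivity)
  have h4 := mul_nonpos_of_nonneg_of_nonpos h3 (sub_nonpos.2 key)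
  linarith

theorem weightedSq_nonneg (h : Flow K W a b F Ft Fθ) {ψ : ℝ → ℝ} {η : ℝ} (hη : 0 < η) (t : ℝ) :
    0 ≤ weightedSq W η F ψ t := by
  have hc := continuous_weight hη
  have := h.mean_sq_mono t (P := fun _ => 0) (Q := fun p => weight η (1 - cos (p.1 - ψ t)))
    (by fun_prop) (by fun_prop) (fun _ _ => weight_nonneg hη _)
  simpa [mean, weightedSq] using this

theorem weightedSq_le (h : Flow K W a b F Ft Fθ) {ψ : ℝ → ℝ} {η : ℝ} (hη : 0 < η) (t : ℝ) :
    weightedSq W η F ψ t ≤ 2 * sqNorm W F t := by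
  have hc := continuous_weight hη
  rw [sqNorm, ← mean_const_mul]
  refine h.mean_sq_mono t (by fun_prop) (by fun_prop) (fun p _ => ?_)
  have h1 := Real.neg_one_le_cos (p.1 - ψ t)
  have h2 := Real.cos_le_one (p.1 - ψ t)
  linarith [weight_le hη (y := 1 - cos (p.1 - ψ t)) (by linarith)]

/-- Decay of the weighted functional in the frame of a cluster. -/
theorem weightedSq_decay (h : Flow K W a b F Ft Fθ) (hT : Tame K W w a b) {T ρ s t : ℝ}
    {ψ : ℝ → ℝ} (hψ : IsFrame K a b T ψ) (hρ0 : modulus a b 0 ≤ ρ) (hρ1 : ρ ≤ 1) (hs : 0 ≤ s)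
    (hst : s ≤ t) (htT : t < T)
    (hM : ∀ u ∈ Ico s t, (1 + 97 / 100 * ρ) / 2 ≤ clusterMass W (ρ / 50) F u (ψ u)) :
    weightedSq W (modulus a b 0 ^ 2 / 4000) F ψ t
      ≤ weightedSq W (modulus a b 0 ^ 2 / 4000) F ψ s
        * exp (-(9 / 10 * K * ∫ u in s..t, hComp a b u (ψ u))) := by
  set η := modulus a b 0 ^ 2 / 4000 with hη
  have hη0 : 0 < η := by have := hT.R_pos; positivity
  have hcψ := hψ.cont
  have hca := h.cont_a
  have hcb := h.cont_b
  have hcw := continuous_weight hη0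
  have hcwd := continuous_weightDeriv hη0
  have hcH : Continuous fun u => hComp a b u (ψ u) := by unfold hComp; fun_prop
  have hcY : Continuous (weightedSq W η F ψ) :=
    h.continuous_mean_sq (Φ := fun t p => weight η (1 - cos (p.1 - ψ t))) (by fun_prop)
  set E : ℝ → ℝ := fun v => exp (9 / 10 * K * ∫ u in s..v, hComp a b u (ψ u)) with hE
  have hEd : ∀ v, HasDerivAt E (E v * (9 / 10 * K * hComp a b v (ψ v))) v := fun v =>
    ((intervalIntegral.integral_hasDerivAt_right (hcH.intervalIntegrable _ _)
      (hcH.stronglyMeasurableAtFilter _ _) hcH.continuousAt).const_mul (9 / 10 * K)).exp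
  have hcE : Continuous E := continuous_iff_continuousAt.2 fun v => (hEd v).continuousAt
  have h1 := add_le_of_deriv_ge (c := 0) hs hst
    (f := fun v => -(E v * weightedSq W η F ψ v))
    (by fun_prop)
    (fun v hv => ((hEd v).hasDerivWithinAt.mul (h.hasDerivWithinAt_frame_sq hψ
      (hasDerivAt_weight hη0) hcwd ⟨hs.trans hv.1, hv.2.trans htT⟩)).neg)
    (fun v hv => by
      have h2 := h.mean_sq_mono v
        (P := fun p => weightDeriv η (1 - cos (p.1 - ψ v)) * gapVel K a b v (ψ v) (p.1 - ψ v) p.2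
          + K * (hComp a b v (ψ v) * cos (p.1 - ψ v) + qComp a b v (ψ v) * sin (p.1 - ψ v))
            * weight η (1 - cos (p.1 - ψ v)))
        (Q := fun p => -(9 / 10 * K * hComp a b v (ψ v)) * weight η (1 - cos (p.1 - ψ v)))
        (by unfold gapVel; fun_prop) (by fun_prop)
        (fun p hp => h.weight_rate_le hT hρ0 hρ1 (hM v hv) hp)
      rw [mean_const_mul] at h2
      have h3 : 0 < E v := Real.exp_pos _
      have h4 : E v * (mean W (fun p => F v p ^ 2) fun p =>
          weightDeriv η (1 - cos (p.1 - ψ v)) * gapVel K a b v (ψ v) (p.1 - ψ v) p.2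
          + K * (hComp a b v (ψ v) * cos (p.1 - ψ v) + qComp a b v (ψ v) * sin (p.1 - ψ v))
            * weight η (1 - cos (p.1 - ψ v)))
          ≤ E v * (-(9 / 10 * K * hComp a b v (ψ v)) * weightedSq W η F ψ v) := by
        gcongr
        exact h2
      unfold weightedSq at h4
      linarith)
  have hEs : E s = 1 := by simp [hE]
  simp only [hEs, one_mul, zero_mul, add_zero] at h1
  have h2 : E t * exp (-(9 / 10 * K * ∫ u in s..t, hComp a b u (ψ u))) = 1 := by
    rw [hE, ← Real.exp_add]; simp
  calc weightedSq W η F ψ t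
      = E t * weightedSq W η F ψ t * exp (-(9 / 10 * K * ∫ u in s..t, hComp a b u (ψ u))) := by
        rw [mul_right_comm, h2, one_mul]
    _ ≤ _ := by gcongr; linarith

end Flow

namespace Flow

variable {K W w : ℝ} {a b : ℝ → ℝ} {F Ft Fθ : ℝ → ℝ × ℝ → ℝ}

/-! ## Characteristics near a cluster -/

theorem hasDerivWithinAt_char_gap {T ω : ℝ} {ψ x : ℝ → ℝ} (hψ : IsFrame K a b T ψ)
    (hx : ∀ t, 0 ≤ t → HasDerivWithinAt x (vel K a b t (x t, ω)) (Ici 0) t) {t : ℝ}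
    (ht : t ∈ Ico 0 T) :
    HasDerivWithinAt (fun s => 1 - cos (x s - ψ s)) (gapVel K a b t (ψ t) (x t - ψ t) ω)
      (Ici 0) t := by
  have h1 := ((hx t ht.1).sub (hψ.deriv t ht)).cos.const_sub 1
  refine h1.congr_deriv ?_
  rw [← vel_sub_frame t (ψ t) (x t, ω)]
  simp only [Pi.sub_apply]
  ring

/-- A characteristic that starts in the cluster is attracted by its centre. -/
theorem char_gap_le (h : Flow K W a b F Ft Fθ) (hK : 0 < K) {T ρ t₁ t ω : ℝ} {ψ x : ℝ → ℝ}
    (hψ : IsFrame K a b T ψ) (hρ : 0 < ρ) (hWρ : W ≤ K * ρ ^ 2 / 1000) (ht₁ : 0 ≤ t₁)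
    (ht : t₁ ≤ t) (htT : t < T)
    (hM : ∀ u ∈ Ico t₁ t, (1 + 97 / 100 * ρ) / 2 ≤ clusterMass W (ρ / 50) F u (ψ u))
    (hx : ∀ t, 0 ≤ t → HasDerivWithinAt x (vel K a b t (x t, ω)) (Ici 0) t) (hω : |ω| ≤ W)
    (hx₁ : 1 - cos (x t₁ - ψ t₁) ≤ 2 * (ρ / 50)) :
    1 - cos (x t - ψ t) ≤ 2 * (ρ / 50) * exp (-(K * ρ * (t - t₁))) + W / (K * ρ) := by
  have hcx : ContinuousOn x (Ici 0) := fun s hs => (hx s hs).continuousWithinAt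
  have hcy : ContinuousOn (fun s => 1 - cos (x s - ψ s)) (Icc t₁ t) := by
    have h1 : ContinuousOn x (Icc t₁ t) := hcx.mono fun s hs => ht₁.trans hs.1
    have h2 : ContinuousOn ψ (Icc t₁ t) := hψ.cont.continuousOn
    exact continuousOn_const.sub (Real.continuous_cos.comp_continuousOn (h1.sub h2))
  have hrate : ∀ s ∈ Ico t₁ t, 1 - cos (x s - ψ s) ≤ 2 * (ρ / 50) →
      gapVel K a b s (ψ s) (x s - ψ s) ω ≤ W - K * ρ * (1 - cos (x s - ψ s)) := by
    intro s hs hy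
    have hJ := h.restoring_ge (κ := ρ / 50) (by positivity) s (ψ s) hy
    have hm := hM s hs
    rw [gapVel_eq]
    set Δ := x s - ψ s
    set J := (1 + cos Δ) * hComp a b s (ψ s) + sin Δ * qComp a b s (ψ s)
    have hJρ : ρ ≤ J := by linarith
    have e1 : |ω * sin Δ| ≤ W := by
      rw [abs_mul]
      have := Real.abs_sin_le_one Δ
      nlinarith [abs_nonneg ω, abs_nonneg (sin Δ)]
    have e2 : 0 ≤ K * (1 - cos Δ) := mul_nonneg hK.le (by linarith [Real.cos_le_one Δ])
    have e3 : K * (1 - cos Δ) * ρ ≤ K * (1 - cos Δ) * J := by gcongr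
    linarith [le_abs_self (ω * sin Δ)]
  have hder : ∀ s ∈ Ico t₁ t, HasDerivWithinAt (fun s => 1 - cos (x s - ψ s))
      (gapVel K a b s (ψ s) (x s - ψ s) ω) (Ici 0) s := fun s hs =>
    hasDerivWithinAt_char_gap hψ hx ⟨ht₁.trans hs.1, hs.2.trans htT⟩
  -- The rate estimate is valid only while the gap is at most `ρ / 25`, so trapping below that value
  -- comes before the exponential estimate. At the edge the contraction `K ρ² / 25` exceeds `W`.
  have htrap := image_le_of_deriv_right_lt_deriv_boundary (a := t₁) (b := t)
    (B := fun _ => 2 * (ρ / 50)) (B' := fun _ => 0) hcy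
    (fun s hs => (hder s hs).mono (Ici_subset_Ici.2 (ht₁.trans hs.1))) hx₁
    (fun s => hasDerivAt_const _ _) (fun s hs he => by
      have h1 := hrate s hs he.le
      rw [he] at h1
      have : 0 < K * ρ ^ 2 := by positivity
      nlinarith)
  have h1 := add_le_of_deriv_ge (c := 0) ht₁ ht
    (f := fun s => -(exp (K * ρ * (s - t₁)) * (1 - cos (x s - ψ s) - W / (K * ρ))))
    (f' := fun s => -(exp (K * ρ * (s - t₁)) * (K * ρ) * (1 - cos (x s - ψ s) - W / (K * ρ))
      + exp (K * ρ * (s - t₁)) * gapVel K a b s (ψ s) (x s - ψ s) ω))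
    (by
      have : ContinuousOn (fun s => exp (K * ρ * (s - t₁))) (Icc t₁ t) := by fun_prop
      exact (this.mul (hcy.sub continuousOn_const)).neg)
    (fun s hs => by
      have h2 : HasDerivAt (fun s => exp (K * ρ * (s - t₁)))
          (exp (K * ρ * (s - t₁)) * (K * ρ)) s := by
        have := (((hasDerivAt_id s).sub_const t₁).const_mul (K * ρ)).exp
        exact this.congr_deriv (by simp)
      exact (h2.hasDerivWithinAt.mul ((hder s hs).sub_const _)).neg)
    (fun s hs => by
      have h2 := hrate s hs (htrap ⟨hs.1, hs.2.le⟩)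
      have h3 : K * ρ * (W / (K * ρ)) = W := by field_simp
      have h4 := Real.exp_pos (K * ρ * (s - t₁))
      have h5 : K * ρ * (1 - cos (x s - ψ s) - W / (K * ρ))
          + gapVel K a b s (ψ s) (x s - ψ s) ω ≤ 0 := by
        rw [mul_sub, h3]; linarith
      have h6 := mul_nonpos_of_nonneg_of_nonpos h4.le h5
      linarith)
  simp only [sub_self, mul_zero, Real.exp_zero, one_mul, zero_mul, add_zero] at h1
  have hWρ' : 0 ≤ W / (K * ρ) := div_nonneg ((abs_nonneg _).trans hω) (by positivity)
  have h2 : exp (K * ρ * (t - t₁)) * (1 - cos (x t - ψ t) - W / (K * ρ)) ≤ 2 * (ρ / 50) := by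
    linarith
  have h3 : exp (-(K * ρ * (t - t₁))) * exp (K * ρ * (t - t₁)) = 1 := by
    rw [← Real.exp_add]; simp
  have h4 := mul_le_mul_of_nonneg_left h2 (Real.exp_pos (-(K * ρ * (t - t₁)))).le
  rw [← mul_assoc, h3, one_mul] at h4
  linarith

/-! ## The time during which the order parameter points away from the cluster -/

/-- If the component along the cluster is small while `R` is about `ℓ`, the orthogonal component is
large. Then `S²` is at least `0.4 ℓ²` on the cluster, which holds half of the mass. -/
theorem dissip_ge_of_hComp_le (h : Flow K W a b F Ft Fθ) {κ ℓ t x : ℝ} (hκ : 0 < κ)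
    (hκ1 : κ ≤ 1 / 50) (hℓ : 0 < ℓ) (hℓ1 : ℓ ≤ 1) (hR : 99 / 100 * ℓ ≤ modulus a b t)
    (hM : 1 / 2 ≤ clusterMass W κ F t x) (hh0 : 0 ≤ hComp a b t x)
    (hh : 9 / 10 * hComp a b t x ≤ ℓ / 4) : ℓ ^ 4 / 10 ≤ dissip W a b F t := by
  have h1 : (99 / 100 * ℓ) ^ 2 ≤ modulus a b t ^ 2 := by gcongr
  rw [modulus_sq, Rsq_eq t x] at h1
  set H := hComp a b t x
  set q := qComp a b t x
  have hH2 : H ^ 2 ≤ (5 / 18 * ℓ) ^ 2 := by gcongr; linarith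
  have h2 := h.mean_mono t (P := fun p => 4 / 10 * ℓ ^ 2 * cutoff κ (1 - cos (p.1 - x)))
    (Q := fun p => S a b t p.1 ^ 2) (by fun_prop) (by fun_prop) (fun p _ => by
      rw [S_eq t x]
      change _ ≤ (H * sin (p.1 - x) - q * cos (p.1 - x)) ^ 2
      set Δ := p.1 - x
      rcases le_or_gt (2 * κ) (1 - cos Δ) with h3 | h3
      · rw [cutoff_eq_zero hκ h3, mul_zero]; positivity
      · have h4 := cutoff_le_one κ (1 - cos Δ)
        have h5 : 4 / 10 * ℓ ^ 2 * cutoff κ (1 - cos Δ) ≤ 4 / 10 * ℓ ^ 2 := by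
          nlinarith [sq_nonneg ℓ]
        refine h5.trans ?_
        have hcos : 96 / 100 ≤ cos Δ := by linarith
        have hsin : sin Δ ^ 2 ≤ 8 / 100 := by linarith [sin_sq_le_gap Δ]
        have hcos2 : (96 / 100) ^ 2 ≤ cos Δ ^ 2 := by gcongr
        have h6 : 0 ≤ (2 * (H * sin Δ) - q * cos Δ) ^ 2 := sq_nonneg _
        have h7 : H ^ 2 * sin Δ ^ 2 ≤ (5 / 18 * ℓ) ^ 2 * (8 / 100) := by gcongr
        have h8 : q ^ 2 * (96 / 100) ^ 2 ≤ q ^ 2 * cos Δ ^ 2 := by gcongr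
        nlinarith)
  rw [mean_const_mul] at h2
  have h3 : 4 / 10 * ℓ ^ 2 * (1 / 2) ≤ 4 / 10 * ℓ ^ 2 * clusterMass W κ F t x := by gcongr
  have h4 : ℓ ^ 4 ≤ ℓ ^ 2 := pow_le_pow_of_le_one hℓ.le hℓ1 (by norm_num)
  have h5 : 0 ≤ ℓ ^ 2 := sq_nonneg ℓ
  have h6 : 4 / 10 * ℓ ^ 2 * clusterMass W κ F t x ≤ dissip W a b F t := h2
  linarith

theorem monotone_runMax (h : Flow K W a b F Ft Fθ) : Monotone (runMax a b) := by
  intro s t hst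
  rcases le_or_gt 0 s with hs | hs
  · exact h.runMax_mono hs hst
  · have : runMax a b s = 0 := by
      -- At negative times the running maximum is the supremum of the empty set, which is `0` by
      -- convention.
      rw [runMax, Icc_eq_empty (not_le.2 hs), image_empty, Real.sSup_empty]
    rw [this]
    exact Real.sSup_nonneg (by rintro _ ⟨u, -, rfl⟩; exact modulus_nonneg u)

theorem Tame.small (hT : Tame K W w a b) (h : Flow K W a b F Ft Fθ) :
    26 * w ≤ modulus a b 0 ^ 2 := by
  have h1 := hT.w_le
  have h2 := hT.R_pos
  have h3 : modulus a b 0 ^ 3 ≤ modulus a b 0 ^ 2 :=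
    pow_le_pow_of_le_one h2.le (h.modulus_le_one 0) (by norm_num)
  have h4 : 0 < modulus a b 0 ^ 2 := by positivity
  linarith

theorem modulus_ge_of_le_runMax (h : Flow K W a b F Ft Fθ) (hT : Tame K W w a b) {t ℓ : ℝ}
    (ht : 0 ≤ t) (hℓ : modulus a b 0 ≤ ℓ) (hℓt : ℓ ≤ runMax a b t) :
    99 / 100 * ℓ ≤ modulus a b t := by
  have h1 := h.runMax_sub_le hT.K_pos hT.w_pos hT.W_nonneg hT.W_le (Tame.small hT h) hT.R_pos ht
  have h2 := hT.R_pos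
  have h3 : 0 < ℓ := h2.trans_le hℓ
  have hℓ1 : ℓ ≤ 1 := by
    obtain ⟨s, -, hs⟩ := h.exists_runMax_eq ht
    exact hℓt.trans (hs ▸ h.modulus_le_one s)
  have h4 : 3 * w / runMax a b t ≤ 3 * w / ℓ := by
    have := hT.w_pos
    gcongr
  have h5 : 3 * w / ℓ ≤ ℓ / 100 := by
    rw [div_le_iff₀ h3]
    have h6 : modulus a b 0 ^ 3 ≤ ℓ ^ 3 := by gcongr
    have h7 : ℓ ^ 3 ≤ ℓ ^ 2 := pow_le_pow_of_le_one h3.le hℓ1 (by norm_num)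
    have := hT.w_le
    nlinarith
  linarith

/-- The component of the order parameter along a cluster is at least comparable to the level,
except during a time that is controlled by the gain of the modulus. -/
theorem integral_hComp_ge (h : Flow K W a b F Ft Fθ) (hT : Tame K W w a b) {κ ℓ s t : ℝ}
    {ψ : ℝ → ℝ} (hψ : Continuous ψ) (hκ : 0 < κ) (hκ1 : κ ≤ 1 / 50) (hs : 0 ≤ s) (hst : s ≤ t)
    (hℓ0 : modulus a b 0 ≤ ℓ) (hℓ1 : ℓ ≤ 1)
    (hM : ∀ u ∈ Ico s t, 1 / 2 ≤ clusterMass W κ F u (ψ u))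
    (hh : ∀ u ∈ Ico s t, 0 ≤ hComp a b u (ψ u)) (hU : ∀ u ∈ Ico s t, ℓ ≤ runMax a b u)
    (hU2 : ∀ u ∈ Ico s t, runMax a b u ^ 2 ≤ 2 * ℓ ^ 2) :
    K * ℓ / 4 * (t - s) - 100 / ℓ ≤ 9 / 10 * K * ∫ u in s..t, hComp a b u (ψ u) := by
  have hK := hT.K_pos
  have hℓ : 0 < ℓ := hT.R_pos.trans_le hℓ0
  have hca := h.cont_a
  have hcb := h.cont_b
  have hcH : Continuous fun u => hComp a b u (ψ u) := by unfold hComp; fun_prop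
  set τ := 1 / (6 * K * ℓ) with hτ
  have hτ0 : 0 < τ := by positivity
  -- Truncation at `2 ℓ` is needed because `u + τ` may pass `t`, where the level no longer bounds
  -- the running maximum. The gain `ℓ²/1000` survives it.
  set V : ℝ → ℝ := fun u => min (runMax a b u) (2 * ℓ) with hV
  have hVm : Monotone V := h.monotone_runMax.min monotone_const
  have hVi : ∀ c d, IntervalIntegrable V volume c d := fun c d => hVm.intervalIntegrable
  have hVi' : ∀ c d, IntervalIntegrable (fun u => V (u + τ)) volume c d := fun c d =>
    (hVm.comp (monotone_id.add_const τ)).intervalIntegrable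
  -- Any deficit of the decay rate is paid for by the increment of `V` over the time `τ`. Integrated
  -- over time, the increments telescope to at most `2 ℓ τ`.
  have hpt : ∀ u ∈ Ioo s t, K * ℓ / 4 - 9 / 10 * K * hComp a b u (ψ u)
      ≤ 250 * K / ℓ * (V (u + τ) - V u) := by
    intro u hu
    have hu' : u ∈ Ico s t := ⟨hu.1.le, hu.2⟩
    have hu0 : 0 ≤ u := hs.trans hu.1.le
    have hVn : 0 ≤ 250 * K / ℓ * (V (u + τ) - V u) := by
      have := sub_nonneg.2 (hVm (by linarith : u ≤ u + τ))
      positivity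
    rcases le_or_gt (ℓ / 4) (9 / 10 * hComp a b u (ψ u)) with h1 | h1
    · nlinarith
    have hR := h.modulus_ge_of_le_runMax hT hu0 hℓ0 (hU u hu')
    have hI := h.dissip_ge_of_hComp_le hκ hκ1 hℓ hℓ1 hR (hM u hu') (hh u hu') h1.le
    have hUle : runMax a b u ≤ 3 / 2 * ℓ := by
      refine (abs_le_of_sq_le_sq' ((hU2 u hu').trans ?_) (by positivity)).2
      nlinarith
    have hg := h.runMax_gain hK hT.W_nonneg hT.w_pos hT.W_le (Tame.small hT h) hT.R_pos hu0 hℓ hℓ1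
      (hT.w_le.trans (by have := hT.R_pos; gcongr)) (hU u hu')
      ((by
        rw [← modulus_sq]
        have h2 := h.modulus_le_runMax hu0 le_rfl
        have h3 := modulus_nonneg (a := a) (b := b) u
        exact (pow_le_pow_left₀ h3 h2 2).trans (hU2 u hu'))) hI
    have hVg : V u + ℓ ^ 2 / 1000 ≤ V (u + τ) := by
      have h2 : V u = runMax a b u := min_eq_left (by linarith)
      rw [h2]
      refine le_min hg ?_
      nlinarith
    have h3 : K * ℓ / 4 = 250 * K / ℓ * (ℓ ^ 2 / 1000) := by field_simp; ring
    have h4 : 250 * K / ℓ * (ℓ ^ 2 / 1000) ≤ 250 * K / ℓ * (V (u + τ) - V u) := by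
      gcongr; linarith
    have h5 := mul_nonneg hK.le (hh u hu')
    linarith
  have hint := intervalIntegral.integral_mono_on_of_le_Ioo hst
    (f := fun u => K * ℓ / 4 - 9 / 10 * K * hComp a b u (ψ u))
    (g := fun u => 250 * K / ℓ * (V (u + τ) - V u))
    ((by fun_prop : Continuous fun u =>
      K * ℓ / 4 - 9 / 10 * K * hComp a b u (ψ u)).intervalIntegrable _ _)
    (((hVi' s t).sub (hVi s t)).const_mul _) hpt
  rw [intervalIntegral.integral_sub intervalIntegrable_const
    ((hcH.intervalIntegrable _ _).const_mul _), intervalIntegral.integral_const,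
    intervalIntegral.integral_const_mul, intervalIntegral.integral_const_mul,
    intervalIntegral.integral_sub (hVi' s t) (hVi s t),
    intervalIntegral.integral_comp_add_right V τ,
    intervalIntegral.integral_interval_sub_interval_comm (hVi _ _) (hVi _ _) (hVi _ _)] at hint
  have hb1 : 0 ≤ ∫ u in s..s + τ, V u :=
    intervalIntegral.integral_nonneg (by linarith) fun u hu => le_min
      (Real.sSup_nonneg (by rintro _ ⟨u, -, rfl⟩; exact modulus_nonneg u)) (by positivity)
  have hb2 : ∫ u in t..t + τ, V u ≤ τ * (2 * ℓ) := by
    have := intervalIntegral.integral_mono_on (by linarith : t ≤ t + τ) (hVi _ _)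
      (intervalIntegrable_const (c := 2 * ℓ)) fun u _ => min_le_right _ _
    simp only [intervalIntegral.integral_const, add_sub_cancel_left, smul_eq_mul] at this
    exact this
  rw [intervalIntegral.integral_symm s (s + τ), intervalIntegral.integral_symm t (t + τ)] at hint
  have h6 : 250 * K / ℓ * (τ * (2 * ℓ)) ≤ 100 / ℓ := by
    rw [hτ]
    have : 250 * K / ℓ * (1 / (6 * K * ℓ) * (2 * ℓ)) = (500 / 6) / ℓ := by field_simp; norm_num
    rw [this]; gcongr; norm_num
  have h7 : 250 * K / ℓ * (-(∫ u in s..s + τ, V u) - -∫ u in t..t + τ, V u)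
      ≤ 250 * K / ℓ * (τ * (2 * ℓ)) := by
    gcongr; linarith
  rw [smul_eq_mul] at hint
  linarith

end Flow

namespace Flow

variable {K W w : ℝ} {a b : ℝ → ℝ} {F Ft Fθ : ℝ → ℝ × ℝ → ℝ} {R : ℝ → ℝ}

/-! ## The modulus as a function of time -/

theorem modulus_pos (h : Flow K W a b F Ft Fθ) (hT : Tame K W w a b) {t : ℝ} (ht : 0 ≤ t) :
    0 < modulus a b t := by
  have h1 := h.modulus_ge_of_le_runMax hT ht le_rfl (h.modulus_le_runMax le_rfl ht)
  have := hT.R_pos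
  linarith

theorem hasDerivWithinAt_modulus (h : Flow K W a b F Ft Fθ) (hT : Tame K W w a b)
    (hR : ∀ t, 0 ≤ t → R t = modulus a b t) {t : ℝ} (ht : 0 ≤ t) :
    HasDerivWithinAt R (growth K W a b F t / modulus a b t) (Ici 0) t := by
  have hpos := h.modulus_pos hT ht
  have hpos2 : Rsq a b t ≠ 0 := by
    rw [← modulus_sq]; positivity
  have h1 := (h.hasDerivWithinAt_Rsq ht).sqrt hpos2
  refine (h1.congr (fun s hs => hR s hs) (hR t ht)).congr_deriv ?_
  rw [mul_div_mul_left _ _ two_ne_zero]; rfl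

theorem dotR_eq (h : Flow K W a b F Ft Fθ) (hT : Tame K W w a b)
    (hR : ∀ t, 0 ≤ t → R t = modulus a b t) {t : ℝ} (ht : 0 ≤ t) :
    dotR R t = growth K W a b F t / modulus a b t :=
  (h.hasDerivWithinAt_modulus hT hR ht).derivWithin (uniqueDiffOn_Ici 0 t ht)

theorem isModulus (h : Flow K W a b F Ft Fθ) (hT : Tame K W w a b)
    (hR : ∀ t, 0 ≤ t → R t = modulus a b t) (hnn : ∀ t, 0 ≤ R t) : IsModulus R where
  deriv t ht := by
    rw [h.dotR_eq hT hR ht]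
    exact h.hasDerivWithinAt_modulus hT hR ht
  cont_dot := by
    refine ContinuousOn.congr (f := fun t => growth K W a b F t / modulus a b t) ?_
      fun t ht => h.dotR_eq hT hR ht
    exact h.continuous_growth.continuousOn.div h.continuous_modulus.continuousOn
      fun t ht => (h.modulus_pos hT ht).ne'
  pos_zero := by rw [hR 0 le_rfl]; exact hT.R_pos
  nonneg := hnn
  le_one t ht := by rw [hR t ht]; exact h.modulus_le_one t

theorem Tame.W_sq_le (hT : Tame K W w a b) : W ^ 2 ≤ K ^ 2 * (modulus a b 0 ^ 6 / 10 ^ 12) := by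
  have h1 := hT.W_le
  have h2 := hT.w_le
  have h3 := hT.W_nonneg
  have h4 := hT.K_pos
  have h5 := hT.w_pos
  calc W ^ 2 ≤ (K * w) ^ 2 := by gcongr
    _ ≤ (K * (modulus a b 0 ^ 3 / 1000000)) ^ 2 := by gcongr
    _ = _ := by ring

/-- At a time of slow growth of the modulus, most of the mass is close to the phase of the order
parameter, and it stays in the frame that starts there. -/
theorem exists_initial_cluster (h : Flow K W a b F Ft Fθ) (hT : Tame K W w a b) {t₁ T ℓ x : ℝ}
    (ht₁ : 0 ≤ t₁) (htT : t₁ < T) (hR0 : modulus a b 0 ≤ modulus a b t₁) (hℓ0 : 0 ≤ ℓ)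
    (hℓ : ℓ ≤ modulus a b t₁)
    (hg : growth K W a b F t₁ / modulus a b t₁ ≤ K * ℓ ^ 3 / constQ)
    (hxa : a t₁ = modulus a b t₁ * cos x) (hxb : b t₁ = modulus a b t₁ * sin x) :
    ∃ ψ, IsFrame K a b T ψ ∧ ψ t₁ = x ∧ ∀ t ∈ Ico t₁ T,
      (1 + 97 / 100 * modulus a b t₁) / 2
        ≤ clusterMass W (modulus a b t₁ / 50) F t (ψ t) := by
  have hK := hT.K_pos
  have hr := hT.R_pos
  have hW2 := Tame.W_sq_le hT
  set ρ := modulus a b t₁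
  set r := modulus a b 0
  have hρ : 0 < ρ := hr.trans_le hR0
  have hρ1 : ρ ≤ 1 := h.modulus_le_one t₁
  have h6 : r ^ 6 ≤ ρ ^ 6 := by gcongr
  have h64 : ρ ^ 6 ≤ ρ ^ 4 := pow_le_pow_of_le_one hρ.le hρ1 (by norm_num)
  have h63 : ρ ^ 6 ≤ ρ ^ 3 := pow_le_pow_of_le_one hρ.le hρ1 (by norm_num)
  -- `K I ≤ 2 K ρ⁴ / Q + W²/K` with `Q = 3600` gives `ρ⁴/1800` plus a negligible term. With `κ =
  -- ρ/50` the missing mass is `X/κ = ρ/34 < 0.03 ρ`, hence the factor `97/100`.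
  have hI : dissip W a b F t₁ ≤ ρ ^ 2 / 1700 * ρ ^ 2 := by
    have h1 : growth K W a b F t₁ ≤ K * ρ ^ 4 / 3600 := by
      rw [div_le_iff₀ hρ] at hg
      refine hg.trans ?_
      have h2 : ℓ ^ 3 ≤ ρ ^ 3 := by gcongr
      have h3 : K * ℓ ^ 3 ≤ K * ρ ^ 3 := by gcongr
      have h4 : K * ℓ ^ 3 * ρ ≤ K * ρ ^ 3 * ρ := by gcongr
      unfold constQ
      linarith
    have h2 := h.two_mul_mean_freq_le hK t₁
    have h3 := le_abs_self (mean W (F t₁) fun p => p.2 * S a b t₁ p.1)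
    unfold growth at h1
    have h4 : W ^ 2 / K ≤ K * (ρ ^ 4 / 10 ^ 12) := by
      rw [div_le_iff₀ hK]
      refine hW2.trans ?_
      have : r ^ 6 ≤ ρ ^ 4 := h6.trans h64
      calc K ^ 2 * (r ^ 6 / 10 ^ 12) ≤ K ^ 2 * (ρ ^ 4 / 10 ^ 12) := by gcongr
        _ = _ := by ring
    have h5 : K * dissip W a b F t₁ ≤ K * (ρ ^ 2 / 1700 * ρ ^ 2) := by
      have : 0 ≤ K * ρ ^ 4 := by positivity
      linarith
    exact le_of_mul_le_mul_left h5 hK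
  have hXκ : ρ ^ 2 / 1700 / (ρ / 50) = ρ / 34 := by field_simp; norm_num
  obtain ⟨ψ, hψ, hx, hM⟩ := h.exists_cluster hK (X := ρ ^ 2 / 1700) (κ := ρ / 50) ht₁ htT
    (by positivity) hρ hI (by rw [hXκ]; linarith)
    (by
      have : r ^ 6 ≤ ρ ^ 3 := h6.trans h63
      calc 2 * W ^ 2 ≤ 2 * (K ^ 2 * (r ^ 6 / 10 ^ 12)) := by gcongr
        _ ≤ 2 * (K ^ 2 * (ρ ^ 3 / 10 ^ 12)) := by gcongr
        _ ≤ K ^ 2 * (ρ / 50) * ρ ^ 2 := by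
          have : 0 ≤ K ^ 2 * ρ ^ 3 := by positivity
          linarith) hxa hxb
  refine ⟨ψ, hψ, hx, fun t ht => le_trans ?_ (hM t ht)⟩
  rw [hXκ]
  linarith

/-- Growth of the `L²` norm while the modulus increases at a definite rate. -/
theorem sqNorm_le_of_growth (h : Flow K W a b F Ft Fθ) (hT : Tame K W w a b)
    (hM : IsModulus R) (hR : ∀ t, 0 ≤ t → R t = modulus a b t) {t₁ c : ℝ} (ht₁ : 0 ≤ t₁)
    (hc : 0 < c) (hg : ∀ t ∈ Ico 0 t₁, K * R t ^ 3 ≤ c * dotR R t) :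
    sqNorm W F t₁ ≤ sqNorm W F 0 * exp (c / R 0) := by
  have hK := hT.K_pos
  choose! D hD hD' using fun (t : ℝ) (ht : 0 ≤ t) => h.hasDerivWithinAt_sqNorm hK ht
  have hpos : ∀ t, 0 ≤ t → 0 < R t := fun t ht => by rw [hR t ht]; exact h.modulus_pos hT ht
  have hcN : Continuous (sqNorm W F) := h.continuous_mean_sq (Φ := fun _ _ => 1) (by fun_prop)
  -- The growth rate `K R` is at most `c R' / R²`, minus the derivative of `c / R`. So `exp (c / R)`
  -- is an integrating factor.
  have hE : ∀ t, 0 ≤ t → HasDerivWithinAt (fun t => exp (c / R t))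
      (exp (c / R t) * (-(c * dotR R t) / R t ^ 2)) (Ici 0) t := fun t ht =>
    (((hasDerivWithinAt_const t (Ici 0) c).div (hM.deriv t ht) (hpos t ht).ne').exp).congr_deriv
      (by simp)
  have h1 := add_le_of_deriv_ge (c := 0) le_rfl ht₁
    (f := fun v => -(exp (c / R v) * sqNorm W F v))
    (f' := fun v => -(exp (c / R v) * (-(c * dotR R v) / R v ^ 2) * sqNorm W F v
      + exp (c / R v) * D v))
    (fun v hv => ((hE v hv.1).mul (hD v hv.1)).neg.continuousWithinAt.mono Icc_subset_Ici_self)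
    (fun v hv => ((hE v hv.1).mul (hD v hv.1)).neg)
    (fun v hv => by
      have h2 := hD' v hv.1
      have h3 := hpos v hv.1
      have h4 := h.sqNorm_nonneg v
      have h5 : K * R v ≤ c * dotR R v / R v ^ 2 := by
        rw [le_div_iff₀ (by positivity)]
        have := hg v hv
        linarith [this]
      have h6 : K * R v * sqNorm W F v ≤ c * dotR R v / R v ^ 2 * sqNorm W F v := by gcongr
      rw [← hR v hv.1] at h2
      have h7 := Real.exp_pos (c / R v)
      have h8 : -(c * dotR R v) / R v ^ 2 * sqNorm W F v + D v ≤ 0 := by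
        rw [neg_div]; linarith
      have h9 := mul_nonpos_of_nonneg_of_nonpos h7.le h8
      linarith)
  have h2 : 1 ≤ exp (c / R t₁) := Real.one_le_exp (by have := hpos t₁ ht₁; positivity)
  have h3 := h.sqNorm_nonneg t₁
  nlinarith

end Flow

/-! ## Return to the solution -/

theorem isClosed_cosNhd (ε : ℝ) (L : Set ℝ) : IsClosed (cosNhd ε L) := by
  have : cosNhd ε L = ⋂ θs ∈ L, {θ | 1 - ε ≤ cos (θ - θs)} := by
    ext θ; simp [cosNhd]
  rw [this]
  exact isClosed_biInter fun θs _ => isClosed_le (by fun_prop) (by fun_prop)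

namespace IsClassicalSolution

variable {K W : ℝ} {f : ℝ → ℝ → ℝ → ℝ}

theorem orderR_eq {t : ℝ} (ht : 0 ≤ t) : orderR f t = modulus (extRe f) (extIm f) t := by
  rw [orderR, Complex.norm_eq_sqrt_sq_add_sq, modulus, Flow.Rsq, extRe, extIm, max_eq_left ht]

theorem sqMass_univ (hf : IsClassicalSolution K f)
    (hW : Function.support (freqDist f) ⊆ Icc (-W) W) {t : ℝ} (ht : 0 ≤ t) :
    sqMass f t univ = sqNorm W (ext f) t := by
  have h1 := setIntegral_period_univ (W := W) (Φ := fun p => ext f t p ^ 2) fun p hp => by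
    rw [hf.ext_support hW t p hp]; simp
  rw [sqMass, inter_univ, sqNorm, mean]
  simp only [one_mul]
  rw [← h1]
  simp [ext, max_eq_left ht]

/-- Continuous weights stand in for indicator functions, so that the smooth transport identities
apply. -/
theorem sqMass_le (hf : IsClassicalSolution K f)
    (hW : Function.support (freqDist f) ⊆ Icc (-W) W) {t : ℝ} (ht : 0 ≤ t) {A : Set ℝ}
    (hA : MeasurableSet A) {Φ : ℝ × ℝ → ℝ} (hΦ : Continuous Φ) (hΦ0 : ∀ p, 0 ≤ Φ p)
    (hΦ1 : ∀ p, p.1 ∈ A → 1 ≤ Φ p) :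
    sqMass f t A ≤ mean W (fun p => ext f t p ^ 2) Φ := by
  have hc : Continuous (ext f t) := (hf.flow hW).cont_at t
  have hint : ∀ Ψ : ℝ × ℝ → ℝ, Continuous Ψ →
      IntegrableOn (fun p => Ψ p * ext f t p ^ 2) (period ×ˢ (univ : Set ℝ)) := by
    intro Ψ hΨ
    have h1 : IntegrableOn (fun p => Ψ p * ext f t p ^ 2) (box W) := integrableOn_box (by fun_prop)
    refine h1.of_forall_sdiff_eq_zero (measurableSet_Ioc.prod MeasurableSet.univ) ?_
    rintro p ⟨hp, hp'⟩
    have : p.2 ∉ Icc (-W) W := fun h2 => hp' ⟨Ioc_subset_Icc_self hp.1, h2⟩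
    rw [hf.ext_support hW t p this]; simp
  have hsub : (period ∩ A) ×ˢ (univ : Set ℝ) ⊆ period ×ˢ (univ : Set ℝ) :=
    prod_mono inter_subset_left le_rfl
  have h1 : sqMass f t A = ∫ p in (period ∩ A) ×ˢ (univ : Set ℝ), 1 * ext f t p ^ 2 := by
    simp [sqMass, ext, max_eq_left ht]
  rw [h1]
  calc ∫ p in (period ∩ A) ×ˢ (univ : Set ℝ), 1 * ext f t p ^ 2
      ≤ ∫ p in (period ∩ A) ×ˢ (univ : Set ℝ), Φ p * ext f t p ^ 2 := by
        refine setIntegral_mono_on ((hint _ continuous_const).mono_set hsub)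
          ((hint _ hΦ).mono_set hsub) ((measurableSet_Ioc.inter hA).prod MeasurableSet.univ)
          fun p hp => ?_
        exact mul_le_mul_of_nonneg_right (hΦ1 p hp.1.2) (sq_nonneg _)
    _ ≤ ∫ p in period ×ˢ (univ : Set ℝ), Φ p * ext f t p ^ 2 := by
        refine setIntegral_mono_set (hint _ hΦ) ?_ hsub.eventuallyLE
        exact Filter.Eventually.of_forall fun p => mul_nonneg (hΦ0 p) (sq_nonneg _)
    _ = _ := setIntegral_period_univ fun p hp => by rw [hf.ext_support hW t p hp]; simp

theorem velocity_eq_vel (hf : IsClassicalSolution K f) {t : ℝ} (ht : 0 ≤ t) (θ ω : ℝ) :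
    velocity K f t θ ω = vel K (extRe f) (extIm f) t (θ, ω) := by
  rw [hf.velocity_eq ht]
  simp [vel, extRe, extIm, max_eq_left ht]

end IsClassicalSolution

/-! ## Counting the intervals of the subdivision -/

open Classical in
/-- A potential bounded by `L` that rises along consecutive elements of `Z`, by `2β + x` after each
element of `G`, while elements outside `G` are followed by elements of `G`. -/
theorem count_of_potential {Z G : Set ℕ} {p x : ℕ → ℝ} {β L : ℝ} (hβ : 0 < β)
    (hZ : Z.OrdConnected) (hGZ : G ⊆ Z) (hp : ∀ l ∈ Z, 0 ≤ p l ∧ p l ≤ L)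
    (hx : ∀ l ∈ G, 0 ≤ x l ∧ x l ≤ L)
    (hgood : ∀ l ∈ G, l + 1 ∈ Z → p l + 2 * β + x l ≤ p (l + 1))
    (hbad : ∀ l ∈ Z, l ∉ G → l + 1 ∈ Z → l + 1 ∈ G ∧ p l ≤ p (l + 1)) :
    Z.Finite ∧ (Z = ∅ ∨ (Z.ncard : ℝ) * β ≤ L + 2 * β) ∧ (Z = ∅ ∨ ∑ᶠ l ∈ G, x l ≤ 2 * L + β) := by
  rcases Z.eq_empty_or_nonempty with hE | hne
  · subst hE; simp
  obtain ⟨a, haZ, hmin⟩ : ∃ a ∈ Z, ∀ l ∈ Z, a ≤ l :=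
    ⟨sInf Z, Nat.sInf_mem hne, fun l => Nat.sInf_le⟩
  -- A bonus `β` on `G` makes every step gain at least `β`: stepping out of `G` loses the bonus but
  -- gains `2 β + x`, and stepping from outside `G` into `G` collects it.
  set q : ℕ → ℝ := fun l => p l + if l ∈ G then β else 0 with hq
  set y : ℕ → ℝ := fun l => if l ∈ G then x l else 0 with hy
  have hy0 : ∀ l, 0 ≤ y l := by
    intro l
    simp only [hy]
    split_ifs with hl
    exacts [(hx l hl).1, le_rfl]
  have hsum : ∀ n, a + n ∈ Z →
      q a + n * β + ∑ j ∈ Finset.range n, y (a + j) ≤ q (a + n) := by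
    intro n
    induction n with
    | zero => intro _; simp
    | succ n ih =>
      intro hn
      have hn' : a + n ∈ Z := hZ.out haZ hn ⟨by omega, by omega⟩
      have h1 := ih hn'
      rw [Finset.sum_range_succ]
      have h2 : q (a + n) + β + y (a + n) ≤ q (a + (n + 1)) := by
        simp only [hq, hy]
        by_cases hG : a + n ∈ G
        · have h3 := hgood _ hG hn
          rw [← add_assoc, if_pos hG, if_pos hG]
          split_ifs <;> linarith
        · obtain ⟨h3, h4⟩ := hbad _ hn' hG hn
          rw [← add_assoc, if_neg hG, if_neg hG, if_pos h3]
          linarith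
      push_cast
      linarith
  have hq0 : 0 ≤ q a := by
    have := (hp a haZ).1
    simp only [hq]; split_ifs <;> linarith
  have hqL : ∀ l ∈ Z, q l ≤ L + β := by
    intro l hl
    have := (hp l hl).2
    simp only [hq]; split_ifs <;> linarith
  have hL : 0 ≤ L := (hp a haZ).1.trans (hp a haZ).2
  have hn : ∀ n, a + n ∈ Z → (n : ℝ) * β ≤ L + β := by
    intro n hn
    have h1 := hsum n hn
    have h2 := hqL _ hn
    have h3 : 0 ≤ ∑ j ∈ Finset.range n, y (a + j) := Finset.sum_nonneg fun j _ => hy0 _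
    linarith
  have hfin : Z.Finite := by
    obtain ⟨N, hN⟩ := exists_nat_ge ((L + β) / β)
    refine (finite_Iic (a + N)).subset fun l hl => ?_
    obtain ⟨n, rfl⟩ := Nat.exists_eq_add_of_le (hmin _ hl)
    have h1 := hn n hl
    rw [← le_div_iff₀ hβ] at h1
    have : n ≤ N := by exact_mod_cast h1.trans hN
    exact Nat.add_le_add_left this a
  obtain ⟨m, hmZ, hmax⟩ := hfin.exists_maximal hne
  obtain ⟨n, rfl⟩ := Nat.exists_eq_add_of_le (hmin _ hmZ)
  have hsub : Z ⊆ ((Finset.range (n + 1)).image (a + ·) : Finset ℕ) := by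
    intro l hl
    obtain ⟨j, rfl⟩ := Nat.exists_eq_add_of_le (hmin _ hl)
    have : ¬ (a + n < a + j) := fun h => absurd (hmax hl h.le) (not_le.2 h)
    simp; omega
  refine ⟨hfin, Or.inr ?_, Or.inr ?_⟩
  · have h1 : Z.ncard ≤ n + 1 := by
      have := ncard_le_ncard hsub (Finset.finite_toSet _)
      rw [ncard_coe_finset] at this
      exact this.trans (Finset.card_image_le.trans (by simp))
    have h2 : (Z.ncard : ℝ) ≤ n + 1 := by exact_mod_cast h1
    have h3 := hn n hmZ
    calc (Z.ncard : ℝ) * β ≤ (n + 1) * β := by gcongr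
      _ ≤ _ := by linarith
  · have hGf := hfin.subset hGZ
    rw [finsum_mem_eq_finite_toFinset_sum _ hGf]
    have h1 : ∑ l ∈ hGf.toFinset, x l = ∑ l ∈ hGf.toFinset, y l :=
      Finset.sum_congr rfl fun l hl => by simp [hy, (Finite.mem_toFinset hGf).1 hl]
    have h2 : ∑ l ∈ hGf.toFinset, y l ≤ ∑ l ∈ (Finset.range (n + 1)).image (a + ·), y l := by
      refine Finset.sum_le_sum_of_subset_of_nonneg (fun l hl => ?_) fun l _ _ => hy0 l
      exact_mod_cast hsub (hGZ ((Finite.mem_toFinset hGf).1 hl))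
    rw [Finset.sum_image (by simp), Finset.sum_range_succ] at h2
    have h3 : y (a + n) ≤ L := by
      simp only [hy]
      split_ifs with hl
      exacts [(hx _ hl).2, hL]
    have h4 := hsum n hmZ
    have h5 := hqL _ hmZ
    have h6 : 0 ≤ (n : ℝ) * β := by positivity
    linarith

/-- A modulus `R` with a monotone majorant `U` that exceeds it only slightly and that rises by a
definite amount after every time at which `R` grows fast. -/
structure Ratchet (K : ℝ) (R U : ℝ → ℝ) : Prop extends IsModulus R where
  K_pos : 0 < K
  mono : Monotone U
  le : ∀ t, 0 ≤ t → R t ≤ U t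
  sub_le : ∀ t, 0 ≤ t → U t - R 0 ^ 2 / 10000 ≤ R t
  level_le : ∀ k (t : ℝ), rTime R k ≤ (t : EReal) → level R k ≤ U t
  sq_le : ∀ k (t : ℝ), 0 ≤ t → (t : EReal) < rTime R (k + 1) → U t ^ 2 ≤ 2 * level R k ^ 2
  gain : ∀ k (t : ℝ), rTime R k ≤ (t : EReal) → (t : EReal) < rTime R (k + 1) →
    K * (18 / 100 * level R k ^ 3) ≤ dotR R t →
    U t + level R k ^ 2 / 1000 ≤ U (t + 1 / (6 * K * level R k))

/-- With `cos² α = 3/4` the hypothesis gives `λ ≥ 1 - 1/240`, and `3/16` times `λ³` still exceeds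
`0.18`. This is the only role of the condition on `λ` besides forcing `R_0 > 0`. -/
theorem mu_ge {R : ℝ → ℝ} {lam : ℝ} {k : ℕ} (hℓ : 0 ≤ level R k) (h1 : R 0 ≤ 1)
    (hlam : 1 - lam ≤ cos alpha ^ 2 / 180 * R 0) : 18 / 100 * level R k ^ 3 ≤ mu R lam k := by
  have hc : cos alpha ^ 2 = 3 / 4 := by
    rw [alpha, Real.cos_pi_div_six, div_pow, Real.sq_sqrt (by norm_num)]; norm_num
  rw [hc] at hlam
  have h2 : 995 / 1000 ≤ lam := by linarith
  have h3 : (995 / 1000 : ℝ) ^ 3 ≤ lam ^ 3 := by gcongr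
  rw [mu, hc]
  have h4 : (18 / 100 : ℝ) ≤ 3 / 4 / 4 * lam ^ 3 := by
    norm_num at h3; linarith
  gcongr

theorem one_le_log_ten : 1 ≤ log 10 := by
  rw [Real.le_log_iff_exp_le (by norm_num)]
  linarith [Real.exp_one_lt_d9]

theorem log_ten_le_three : log 10 ≤ 3 := by
  rw [Real.log_le_iff_le_exp (by norm_num)]
  have h1 := Real.exp_one_gt_d9
  have h2 : exp 3 = exp 1 ^ 3 := by rw [← Real.exp_nat_mul]; norm_num
  rw [h2]
  calc (10 : ℝ) ≤ 2.7 ^ 3 := by norm_num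
    _ ≤ exp 1 ^ 3 := by gcongr; linarith

/-! ### Subdivision times and dwell times -/

namespace Ratchet

variable {K lam : ℝ} {R U : ℝ → ℝ}

theorem exists_right (h : Ratchet K R U) {c s : ℝ} {B : EReal} (hs : 0 ≤ s) (hsB : (s : EReal) < B)
    (hlt : dotR R s < c) :
    ∃ t, s < t ∧ (t : EReal) < B ∧ ∀ u ∈ Ico s t, dotR R u < c := by
  have h1 : ∀ᶠ u in nhdsWithin s (Ici s), dotR R u < c :=
    ((h.cont_dot s hs).mono (Ici_subset_Ici.2 hs)).eventually_lt_const hlt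
  obtain ⟨u, hu, hsub⟩ := mem_nhdsGE_iff_exists_Ico_subset.1 h1
  obtain ⟨B', h2, h3⟩ := EReal.lt_iff_exists_real_btwn.1 hsB
  have h2' : s < B' := EReal.coe_lt_coe_iff.1 h2
  refine ⟨min u B', lt_min hu h2', ?_, fun v hv => hsub ⟨hv.1, hv.2.trans_le (min_le_left _ _)⟩⟩
  exact lt_of_le_of_lt (EReal.coe_le_coe_iff.2 (min_le_right _ _)) h3

theorem le_badEnd {k : ℕ} {s : ℝ} (hs : (s : EReal) < rTime R (k + 1)) :
    (s : EReal) ≤ badEnd R K lam k s :=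
  le_sSup ⟨s, rfl, le_rfl, hs, by simp⟩

/-- A bad interval that ends before the next dyadic time ends at a time of fast growth. -/
theorem le_dotR_badEnd (h : Ratchet K R U) {k : ℕ} {s e : ℝ} (hs0 : 0 ≤ s)
    (hs : (s : EReal) < rTime R (k + 1)) (he : badEnd R K lam k s = e)
    (hlt : (e : EReal) < rTime R (k + 1)) : K * mu R lam k ≤ dotR R e := by
  by_contra hc
  rw [not_le] at hc
  have hse : s ≤ e := EReal.coe_le_coe_iff.1 (he ▸ le_badEnd hs)
  obtain ⟨t, h1, h2, h3⟩ := h.exists_right (hs0.trans hse) hlt hc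
  -- By continuity, slow growth at `e` would persist a little beyond `e`, contradicting that `e` is
  -- the supremum.
  have h4 : (t : EReal) ≤ badEnd R K lam k s := by
    refine le_sSup ⟨t, rfl, hse.trans h1.le, h2, fun u hu => ?_⟩
    rcases lt_or_ge u e with hue | hue
    · have h5 : (u : EReal) < badEnd R K lam k s := he ▸ EReal.coe_lt_coe_iff.2 hue
      obtain ⟨_, ⟨v, rfl, hv1, hv2, hv3⟩, hv⟩ := lt_sSup_iff.1 h5
      exact hv3 u ⟨hu.1, EReal.coe_lt_coe_iff.1 hv⟩
    · exact h3 u ⟨hue, hu.2⟩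
  rw [he] at h4
  exact absurd (EReal.coe_le_coe_iff.1 h4) (not_le.2 h1)

/-- The core of a good interval. -/
theorem exists_goodCoreEnd (h : Ratchet K R U) (hmu : ∀ k, 18 / 100 * level R k ^ 3 ≤ mu R lam k)
    {k : ℕ} {s : ℝ} (hs0 : 0 ≤ s)
    (hs : (s : EReal) < rTime R (k + 1)) (hg : K * mu R lam k ≤ dotR R s) :
    ∃ e : ℝ, goodCoreEnd R K lam k s = e ∧ s ≤ e ∧ (e : EReal) ≤ rTime R (k + 1) ∧
      K * mu R lam k ≤ dotR R e ∧ K * mu R lam k * (e - s) ≤ 2 * level R k ∧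
      R s + K * mu R lam k * (e - s) ≤ R e := by
  have hℓ := h.level_pos k
  have hc : 0 < K * mu R lam k :=
    mul_pos h.K_pos (lt_of_lt_of_le (by positivity) (hmu k))
  set c := K * mu R lam k
  set A : Set ℝ := {t | s ≤ t ∧ (t : EReal) < rTime R (k + 1) ∧ ∀ u ∈ Ico s t, c ≤ dotR R u} with hA
  have hgrow : ∀ e, s ≤ e → (∀ u ∈ Ico s e, c ≤ dotR R u) → R s + c * (e - s) ≤ R e :=
    fun e hse hu => add_le_of_deriv_ge hs0 hse (h.cont.mono fun x hx => hs0.trans hx.1)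
      (fun x hx => h.deriv x (hs0.trans hx.1)) hu
  -- Before `r_{k+1}` the modulus is below `√2 R_k`, which limits how long it can grow at rate `c`.
  have hAle : ∀ t ∈ A, c * (t - s) ≤ 2 * level R k := by
    rintro t ⟨h1, h2, h3⟩
    have h4 := hgrow t h1 h3
    have h5 := h.sq_lt (hs0.trans h1) k h2
    have h6 := h.nonneg s
    have h7 : R t ≤ 2 * level R k := (abs_le_of_sq_le_sq' (by nlinarith) (by positivity)).2
    linarith
  have hsA : s ∈ A := ⟨le_rfl, hs, by simp⟩
  have hbd : ∀ t ∈ A, t ≤ s + 2 * level R k / c := fun t ht => by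
    have := hAle t ht
    rw [← sub_le_iff_le_add', le_div_iff₀ hc]
    linarith
  have hbdd : BddAbove A := ⟨_, hbd⟩
  have heq : goodCoreEnd R K lam k s = (sSup A : ℝ) := by
    refine le_antisymm (sSup_le ?_) ?_
    · rintro _ ⟨t, rfl, ht⟩
      exact EReal.coe_le_coe_iff.2 (le_csSup hbdd ht)
    · refine EReal.ge_of_forall_gt_iff_ge.1 fun z hz => ?_
      obtain ⟨t, ht, htz⟩ := exists_lt_of_lt_csSup ⟨s, hsA⟩ (EReal.coe_lt_coe_iff.1 hz)
      exact (EReal.coe_le_coe_iff.2 htz.le).trans (le_sSup ⟨t, rfl, ht⟩)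
  have hse : s ≤ sSup A := le_csSup hbdd hsA
  have hIco : ∀ u ∈ Ico s (sSup A), c ≤ dotR R u := fun u hu => by
    obtain ⟨t, ht, htz⟩ := exists_lt_of_lt_csSup ⟨s, hsA⟩ hu.2
    exact ht.2.2 u ⟨hu.1, htz⟩
  refine ⟨sSup A, heq, hse, ?_, ?_, ?_, hgrow _ hse hIco⟩
  · rw [← heq]
    exact sSup_le (by rintro _ ⟨t, rfl, -, h', -⟩; exact h'.le)
  · rcases hse.eq_or_lt with h1 | h1
    · rw [← h1]; exact hg
    · have h2 : ContinuousOn (dotR R) (Icc s (sSup A)) :=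
        h.cont_dot.mono fun x hx => hs0.trans hx.1
      have h3 : IsClosed {x ∈ Icc s (sSup A) | c ≤ dotR R x} :=
        h2.preimage_isClosed_of_isClosed isClosed_Icc (isClosed_Ici (a := c))
      have h4 : Ico s (sSup A) ⊆ {x ∈ Icc s (sSup A) | c ≤ dotR R x} :=
        fun x hx => ⟨Ico_subset_Icc_self hx, hIco x hx⟩
      have h5 := closure_minimal h4 h3
      rw [closure_Ico h1.ne] at h5
      exact (h5 (right_mem_Icc.2 hse)).2
  · have := csSup_le ⟨s, hsA⟩ hbd
    rw [← sub_le_iff_le_add', le_div_iff₀ hc] at this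
    linarith

theorem subTime_succ_eq {k l : ℕ} (h : Ratchet K R U) (h1 : rTime R k ≤ subTime R K lam l)
    (h2 : subTime R K lam l < rTime R (k + 1)) :
    ∃ s : ℝ, subTime R K lam l = s ∧ 0 ≤ s ∧ subTime R K lam (l + 1) = nextEnd R K lam k s := by
  have hlt : subTime R K lam l < ⊤ := h2.trans_le le_top
  have h0 := (rTime_nonneg R k).trans h1
  lift subTime R K lam l to ℝ using ⟨hlt.ne, (lt_of_lt_of_le (by simp) h0).ne'⟩ with s hs
  refine ⟨s, rfl, EReal.coe_nonneg.1 h0, ?_⟩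
  rw [subTime, ← hs, if_neg hlt.ne, h.indexAt_eq hlt h1 h2, EReal.toReal_coe]

theorem nextEnd_good (h : Ratchet K R U) (hmu : ∀ k, 18 / 100 * level R k ^ 3 ≤ mu R lam k)
    {k : ℕ} {s : ℝ} (hs0 : 0 ≤ s) (hs : (s : EReal) < rTime R (k + 1))
    (hg : K * mu R lam k ≤ dotR R s) :
    nextEnd R K lam k s = rTime R (k + 1) ∨ ∃ e : ℝ, goodCoreEnd R K lam k s = e ∧ s ≤ e ∧
      nextEnd R K lam k s = (e + dLen R K k : ℝ) := by
  obtain ⟨e, he, hse, -⟩ := h.exists_goodCoreEnd hmu hs0 hs hg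
  rw [nextEnd, if_neg (not_lt.2 hg)]
  split_ifs with hif
  · exact Or.inr ⟨e, he, hse, by rw [he, EReal.coe_add]⟩
  · exact Or.inl rfl

/-- The tail `d_k` of a good interval is long enough for the gain in `Ratchet.gain` to be realised.
-/
theorem dLen_ge (h : Ratchet K R U) (k : ℕ) : 1 / (6 * K * level R k) ≤ dLen R K k := by
  have hℓ := h.level_pos k
  have hK := h.K_pos
  have h1 := one_le_log_ten
  rw [dLen, div_mul_eq_mul_div, one_mul, div_le_div_iff₀ (by positivity) (by positivity)]
  have h2 : 0 < K * level R k := by positivity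
  nlinarith

theorem subTime_mono (h : Ratchet K R U) (hmu : ∀ k, 18 / 100 * level R k ^ 3 ≤ mu R lam k) :
    Monotone (subTime R K lam) := by
  have key : ∀ l, 0 ≤ subTime R K lam l → subTime R K lam l ≤ subTime R K lam (l + 1) := by
    intro l hl
    by_cases htop : subTime R K lam l = ⊤
    · rw [subTime, if_pos htop]; exact le_top
    have hlt := lt_top_iff_ne_top.2 htop
    have h1 := h.rTime_indexAt_le hlt hl
    have h2 := h.lt_rTime_indexAt_succ hlt
    obtain ⟨s, hs, hs0, hnext⟩ := h.subTime_succ_eq h1 h2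
    rw [hnext]
    rw [hs] at h2 ⊢
    set k := indexAt R (s : EReal)
    rcases lt_or_ge (dotR R s) (K * mu R lam k) with hb | hg
    · rw [nextEnd, if_pos hb]; exact le_badEnd h2
    · rcases h.nextEnd_good hmu hs0 h2 hg with he | ⟨e, -, hse, he⟩
      · rw [he]; exact h2.le
      · rw [he, EReal.coe_le_coe_iff]
        have := h.dLen_ge k
        have h3 : 0 ≤ 1 / (6 * K * level R k) := by
          have := h.level_pos k
          have := h.K_pos
          positivity
        linarith
  refine monotone_nat_of_le_succ fun l => key l ?_
  induction l with
  | zero => exact EReal.coe_nonneg.2 (h.initialTime_nonneg h.K_pos)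
  | succ l ih => exact ih.trans (key l ih)

/-- Each dyadic interval contains finitely many subdivision times, and the dwell time is
controlled. -/
theorem dwell_bound (h : Ratchet K R U) (hmu : ∀ k, 18 / 100 * level R k ^ 3 ≤ mu R lam k)
    {k : ℕ} (hk : rTime R k < ⊤) :
    (goodSet R K lam k).Finite ∧ (badSet R K lam k).Finite ∧ 0 ≤ dwell R K lam k ∧
      K * level R k * dwell R K lam k ≤ 9000 / level R k * (1 + log (1 / level R k)) := by
  have hℓ := h.level_pos k
  have hℓ1 := h.level_le_one hk
  have hK := h.K_pos
  have hℓ0 : R 0 ≤ level R k := by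
    have := h.level_mono (Nat.zero_le k); rwa [level_zero] at this
  set τ := subTime R K lam with hτ
  set c := K * mu R lam k with hc
  have hcge : K * (18 / 100 * level R k ^ 3) ≤ c := mul_le_mul_of_nonneg_left (hmu k) hK.le
  have hcpos : 0 < c := lt_of_lt_of_le (by positivity) hcge
  set Z : Set ℕ := {l | rTime R k ≤ τ l ∧ τ l < rTime R (k + 1)} with hZ
  set G := goodSet R K lam k with hG
  set ln : ℕ → ℝ := fun l => (goodCoreEnd R K lam k (τ l).toReal).toReal - (τ l).toReal with hln
  have hmono := h.subTime_mono hmu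
  have hGZ : G ⊆ Z := fun l hl => ⟨hl.1, hl.2.1⟩
  have hBZ : badSet R K lam k ⊆ Z := fun l hl => ⟨hl.1, hl.2.1⟩
  have hU0 : ∀ t : ℝ, 0 ≤ t → (t : EReal) < rTime R (k + 1) → 0 ≤ U t ∧ U t ≤ 2 * level R k :=
    fun t ht htr => ⟨(h.nonneg t).trans (h.le t ht),
      (abs_le_of_sq_le_sq' (by have := h.sq_le k t ht htr; nlinarith) (by positivity)).2⟩
  have hlen : ∀ l ∈ G, ∃ s e : ℝ, τ l = s ∧ 0 ≤ s ∧ s ≤ e ∧ goodCoreEnd R K lam k s = e ∧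
      ln l = e - s ∧ c * ln l ≤ 2 * level R k ∧ c ≤ dotR R e ∧ R s + c * ln l ≤ R e := by
    rintro l ⟨h1, h2, h3⟩
    obtain ⟨s, hs, hs0, -⟩ := h.subTime_succ_eq h1 h2
    rw [hs] at h2
    rw [hs, EReal.toReal_coe] at h3
    obtain ⟨e, he, hse, -, hd, hle, hR⟩ := h.exists_goodCoreEnd hmu hs0 h2 h3
    have hlnl : ln l = e - s := by simp only [hln, hτ, hs, EReal.toReal_coe, he]
    exact ⟨s, e, hs, hs0, hse, he, hlnl, hlnl ▸ hle, hd, hlnl ▸ hR⟩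
  -- On the core `R` rises by `c` times its length; on the tail `U` rises by `R_k²/1000`. Passing
  -- from `U` to `R` at the start costs at most `R_0²/10000`, and `2 β = R_k²/2000` still remains.
  obtain ⟨hfin, hcard, hsum⟩ := count_of_potential (Z := Z) (G := G) (p := fun l => U (τ l).toReal)
    (x := fun l => c * ln l) (β := level R k ^ 2 / 4000) (L := 2 * level R k) (by positivity)
    ⟨fun x hx y hy z hz => ⟨hx.1.trans (hmono hz.1), (hmono hz.2).trans_lt hy.2⟩⟩ hGZ
    (by
      rintro l ⟨h1, h2⟩
      obtain ⟨s, hs, hs0, -⟩ := h.subTime_succ_eq h1 h2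
      have hs' : τ l = s := hs
      rw [hs'] at h2 ⊢
      exact hU0 s hs0 h2)
    (fun l hl => by
      obtain ⟨s, e, -, -, hse, -, hl', hle, -⟩ := hlen l hl
      refine ⟨?_, hle⟩
      rw [hl']
      exact mul_nonneg hcpos.le (by linarith))
    (fun l hl hl1 => by
      obtain ⟨s, e, hs, hs0, hse, he, -, -, hd, hR⟩ := hlen l hl
      obtain ⟨s', hs', -, hnext⟩ := h.subTime_succ_eq hl.1 hl.2.1
      obtain rfl : s = s' := EReal.coe_injective (hs.symm.trans hs')
      have hlt := hl.2.1
      have hg := hl.2.2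
      have hr := hl.1
      rw [hs'] at hlt hg hr
      rw [EReal.toReal_coe] at hg
      have hl2 : nextEnd R K lam k s < rTime R (k + 1) := hnext ▸ hl1.2
      rcases h.nextEnd_good hmu hs0 hlt hg with hn | ⟨e', he', -, hn⟩
      · exact absurd hn hl2.ne
      obtain rfl : e = e' := EReal.coe_injective (he.symm.trans he')
      have hτ1 : τ (l + 1) = (e + dLen R K k : ℝ) := hnext.trans hn
      rw [hs, hτ1, EReal.toReal_coe, EReal.toReal_coe]
      rw [hn] at hl2
      have hd6 := h.dLen_ge k
      have hd0 : 0 < 1 / (6 * K * level R k) := by positivity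
      have hel : (e : EReal) < rTime R (k + 1) :=
        (EReal.coe_le_coe_iff.2 (by linarith)).trans_lt hl2
      have hgain := h.gain k e (hr.trans (EReal.coe_le_coe_iff.2 hse)) hel (hcge.trans hd)
      have h1 := h.mono (by linarith : e + 1 / (6 * K * level R k) ≤ e + dLen R K k)
      have h2 := h.le e (hs0.trans hse)
      have h3 := h.sub_le s hs0
      have h4 : R 0 ^ 2 ≤ level R k ^ 2 := by
        have := h.pos_zero
        gcongr
      have h5 : 0 < level R k ^ 2 := by positivity
      linarith)
    (fun l hl hlG hl1 => by
      obtain ⟨s, hs, hs0, hnext⟩ := h.subTime_succ_eq hl.1 hl.2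
      have hlt := hl.2
      have hs' : τ l = s := hs
      rw [hs'] at hlt
      have hb : dotR R s < c := by
        by_contra hb
        rw [not_lt] at hb
        exact hlG ⟨hl.1, hl.2, by rw [hs, EReal.toReal_coe]; exact hb⟩
      rw [nextEnd, if_pos hb] at hnext
      obtain ⟨e, he, he0, -⟩ := h.subTime_succ_eq hl1.1 hl1.2
      have he' : τ (l + 1) = e := he
      have hel := hl1.2
      rw [he'] at hel
      have hse : s ≤ e := by
        have := hmono (Nat.le_succ l)
        rw [hs, Nat.succ_eq_add_one, he] at this
        exact EReal.coe_le_coe_iff.1 this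
      refine ⟨⟨hl1.1, hl1.2, ?_⟩, ?_⟩
      · rw [he, EReal.toReal_coe]
        exact h.le_dotR_badEnd hs0 hlt (hnext.symm.trans he) hel
      · rw [hs', he', EReal.toReal_coe, EReal.toReal_coe]
        exact h.mono hse)
  have hGf := hfin.subset hGZ
  have hBf := hfin.subset hBZ
  have hlog : 0 ≤ log (1 / level R k) := Real.log_nonneg (by rw [le_div_iff₀ hℓ]; linarith)
  have hlog10 := log_ten_le_three
  have hlog10' := one_le_log_ten
  have hδd : K * level R k * (deltaLen R K k + dLen R K k) = log (1 / level R k) + log 10 / 3 := by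
    rw [deltaLen, dLen]
    field_simp
  have hδd0 : 0 ≤ deltaLen R K k + dLen R K k := by
    have : 0 ≤ K * level R k * (deltaLen R K k + dLen R K k) := by rw [hδd]; linarith
    exact nonneg_of_mul_nonneg_right this (by positivity)
  have hdw : dwell R K lam k = (max (badSet R K lam k).ncard G.ncard : ℕ)
      * (deltaLen R K k + dLen R K k) + ∑ᶠ l ∈ G, ln l := rfl
  have hsum0 : 0 ≤ ∑ᶠ l ∈ G, ln l := by
    rw [finsum_mem_eq_finite_toFinset_sum _ hGf]
    refine Finset.sum_nonneg fun l hl => ?_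
    obtain ⟨s, e, -, -, hse, -, hl', -⟩ := hlen l ((Finite.mem_toFinset hGf).1 hl)
    rw [hl']; linarith
  refine ⟨hGf, hBf, by rw [hdw]; positivity, ?_⟩
  have hrhs : 0 ≤ 9000 / level R k * (1 + log (1 / level R k)) := by positivity
  rcases Z.eq_empty_or_nonempty with hE | hne
  · have hG0 : G = ∅ := subset_empty_iff.1 (hE ▸ hGZ)
    have hB0 : badSet R K lam k = ∅ := subset_empty_iff.1 (hE ▸ hBZ)
    rw [hdw, hG0, hB0]
    simpa using hrhs
  replace hcard := hcard.resolve_left hne.ne_empty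
  replace hsum := hsum.resolve_left hne.ne_empty
  rw [finsum_mem_eq_finite_toFinset_sum _ hGf, ← Finset.mul_sum,
    ← finsum_mem_eq_finite_toFinset_sum _ hGf] at hsum
  set σ := ∑ᶠ l ∈ G, ln l with hσ
  have hmax : ((max (badSet R K lam k).ncard G.ncard : ℕ) : ℝ) ≤ Z.ncard := by
    exact_mod_cast max_le (ncard_le_ncard hBZ hfin) (ncard_le_ncard hGZ hfin)
  set N : ℝ := ((max (badSet R K lam k).ncard G.ncard : ℕ) : ℝ)
  -- Dividing `2 R_k + 2 β` by `β = R_k²/4000` gives `8000/R_k + 2`.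
  have hN : N ≤ 8002 / level R k := by
    rw [le_div_iff₀ hℓ]
    have h1 : N * (level R k ^ 2 / 4000) ≤ 2 * level R k + 2 * (level R k ^ 2 / 4000) :=
      le_trans (by gcongr) hcard
    have h2 : N * level R k * level R k ≤ 8002 * level R k := by nlinarith
    exact le_of_mul_le_mul_right h2 hℓ
  have hσ' : K * level R k * σ ≤ 30 / level R k := by
    rw [le_div_iff₀ hℓ]
    have h1 : K * (18 / 100 * level R k ^ 3) * σ ≤ 5 * level R k := by
      have : K * (18 / 100 * level R k ^ 3) * σ ≤ c * σ := by gcongr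
      nlinarith
    have h2 : K * level R k * σ * level R k * level R k ≤ 30 * level R k := by nlinarith
    exact le_of_mul_le_mul_right h2 hℓ
  have h1 : N * (log (1 / level R k) + log 10 / 3)
      ≤ 8002 / level R k * (1 + log (1 / level R k)) :=
    mul_le_mul hN (by linarith) (by linarith) (by positivity)
  have h2 : 30 / level R k ≤ 30 / level R k * (1 + log (1 / level R k)) :=
    le_mul_of_one_le_right (by positivity) (by linarith)
  calc K * level R k * dwell R K lam k
      = N * (K * level R k * (deltaLen R K k + dLen R K k)) + K * level R k * σ := by
        rw [hdw]; ring
    _ ≤ 8002 / level R k * (1 + log (1 / level R k))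
        + 30 / level R k * (1 + log (1 / level R k)) := by
        rw [hδd]; linarith
    _ = 8032 / level R k * (1 + log (1 / level R k)) := by ring
    _ ≤ _ := by gcongr; norm_num

end Ratchet

theorem IsModulus.zero_le_level {R : ℝ → ℝ} (h : IsModulus R) (k : ℕ) : R 0 ≤ level R k := by
  have := h.level_mono (Nat.zero_le k); rwa [level_zero] at this

/-- The majorant is the running maximum. Fast growth of `R` needs dissipation: `R R' ≤ (3/2) K I +
W²/(2 K)`, so `R' ≥ 0.18 K R_k³` with `R ≥ 0.99 R_k` gives `I ≥ R_k⁴/10`, and `runMax_gain` applies.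
-/
theorem Flow.ratchet {K W w : ℝ} {a b : ℝ → ℝ} {F Ft Fθ : ℝ → ℝ × ℝ → ℝ} {R : ℝ → ℝ}
    (h : Flow K W a b F Ft Fθ) (hT : Tame K W w a b)
    (hR : ∀ t, 0 ≤ t → R t = modulus a b t) (hnn : ∀ t, 0 ≤ R t) : Ratchet K R (runMax a b) := by
  have hM : IsModulus R := h.isModulus hT hR hnn
  have hK := hT.K_pos
  have hr := hT.R_pos
  have hw := hT.w_pos
  have hwle := hT.w_le
  have hU0 : ∀ t, 0 ≤ t → modulus a b 0 ≤ runMax a b t :=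
    fun t ht => h.modulus_le_runMax le_rfl ht
  have hlev : ∀ k (t : ℝ), rTime R k ≤ (t : EReal) → level R k ≤ runMax a b t := by
    intro k t hkt
    obtain ⟨r, hr0, hr, hle⟩ := hM.exists_rTime_eq k (hkt.trans_lt (EReal.coe_lt_top t))
    rw [hr, EReal.coe_le_coe_iff] at hkt
    rw [hR r hr0] at hle
    exact hle.trans (h.modulus_le_runMax hr0 hkt)
  refine { hM with
    K_pos := hK
    mono := h.monotone_runMax
    le := fun t ht => by rw [hR t ht]; exact h.modulus_le_runMax ht le_rfl
    sub_le := fun t ht => ?_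
    level_le := hlev
    sq_le := fun k t ht htr => ?_
    gain := fun k t hkt htr hd => ?_ }
  · have h1 := h.runMax_sub_le hK hw hT.W_nonneg hT.W_le (Flow.Tame.small hT h) hr ht
    have h2 : 3 * w / runMax a b t ≤ 3 * (modulus a b 0 ^ 3 / 1000000) / modulus a b 0 := by
      gcongr
      exact hU0 t ht
    have h3 : 3 * (modulus a b 0 ^ 3 / 1000000) / modulus a b 0
        = 3 / 1000000 * modulus a b 0 ^ 2 := by field_simp
    rw [hR t ht, hR 0 le_rfl]
    nlinarith
  · obtain ⟨s, hs, hs'⟩ := h.exists_runMax_eq ht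
    rw [← hs', ← hR s hs.1]
    exact (hM.sq_lt hs.1 k ((EReal.coe_le_coe_iff.2 hs.2).trans_lt htr)).le
  · have ht : 0 ≤ t := nonneg_of_rTime_le hkt
    have hℓ := hM.level_pos k
    have hℓ0 : modulus a b 0 ≤ level R k := by rw [← hR 0 le_rfl]; exact hM.zero_le_level k
    have hℓ1 := hM.level_le_one (hkt.trans_lt (EReal.coe_lt_top t))
    have hℓU := hlev k t hkt
    have hm := h.modulus_ge_of_le_runMax hT ht hℓ0 hℓU
    refine h.runMax_gain hK hT.W_nonneg hw hT.W_le (Flow.Tame.small hT h) hr ht hℓ hℓ1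
      (hwle.trans (by gcongr)) hℓU ?_ ?_
    · rw [← modulus_sq, ← hR t ht]
      exact (hM.sq_lt ht k htr).le
    · set ℓ := level R k
      rw [h.dotR_eq hT hR ht, le_div_iff₀ (h.modulus_pos hT ht)] at hd
      have h1 := h.two_mul_mean_freq_le hK t
      have h2 := neg_le_abs (mean W (F t) fun p => p.2 * Flow.S a b t p.1)
      have h3 : K * (18 / 100 * ℓ ^ 3) * (99 / 100 * ℓ) ≤ Flow.growth K W a b F t :=
        le_trans (by gcongr) hd
      have h4 : W ^ 2 / K ≤ K * (ℓ ^ 4 / 10 ^ 12) := by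
        rw [div_le_iff₀ hK]
        have h5 : modulus a b 0 ^ 6 ≤ ℓ ^ 6 := by gcongr
        have h6 : ℓ ^ 6 ≤ ℓ ^ 4 := pow_le_pow_of_le_one hℓ.le hℓ1 (by norm_num)
        calc W ^ 2 ≤ K ^ 2 * (modulus a b 0 ^ 6 / 10 ^ 12) := Flow.Tame.W_sq_le hT
          _ ≤ K ^ 2 * (ℓ ^ 4 / 10 ^ 12) := by gcongr; linarith
          _ = _ := by ring
      unfold Flow.growth at h3
      have h7 : K * (ℓ ^ 4 / 10) ≤ K * Flow.dissip W a b F t := by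
        have : 0 ≤ K * ℓ ^ 4 := by positivity
        have h8 := le_abs_self (mean W (F t) fun p => p.2 * Flow.S a b t p.1)
        linarith
      exact le_of_mul_le_mul_left h7 hK

/-! ## Bounds for the barriers -/

section Barrier

variable {K lam E : ℝ} {R : ℝ → ℝ}

/-- A barrier never decays faster than `K R_k sin α / 2 = K R_k / 4`, and this is the only lower
bound on it that the comparison needs. -/
theorem le_profile {k : ℕ} {s A t : ℝ} (hKℓ : 0 ≤ K * level R k) (hA : 0 ≤ A) (hst : s ≤ t)
    (hD : 0 ≤ dwell R K lam k) :
    A * exp (-(K * level R k / 4 * (t - s))) ≤ profile R K lam k s A t := by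
  unfold profile
  have hα : sin alpha = 1 / 2 := Real.sin_pi_div_six
  have h1 := mul_nonneg hKℓ (sub_nonneg.2 hst)
  have h2 := mul_nonneg hKℓ hD
  split_ifs with hif
  · gcongr
    linarith
  · rw [mul_assoc, ← Real.exp_add, hα]
    gcongr
    linarith

theorem profile_le {k : ℕ} {s A t : ℝ} (hKℓ : 0 ≤ K * level R k) (hA : 0 ≤ A) :
    profile R K lam k s A t ≤ A * exp (2 * (K * level R k * dwell R K lam k)) := by
  unfold profile
  have hα : sin alpha = 1 / 2 := Real.sin_pi_div_six
  split_ifs with hif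
  · have h1 : K * level R k * (t - s) ≤ K * level R k * dwell R K lam k := by
      gcongr; linarith
    refine mul_le_mul_of_nonneg_left (Real.exp_le_exp.2 ?_) hA
    linarith
  · have h1 : 0 ≤ K * level R k * (t - s - dwell R K lam k) := mul_nonneg hKℓ (by linarith)
    rw [mul_assoc, ← Real.exp_add, hα]
    gcongr
    linarith

theorem barrier_kZero (t : ℝ) : barrier R K lam E (kZero R K) t
    = profile R K lam (kZero R K) (initialTime R K) (E * exp (4 * constQ / R 0)) t := by
  rcases hk : kZero R K with _ | k
  · rw [barrier]
  · rw [barrier, if_pos hk.ge]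

theorem barrier_succ {k : ℕ} (hk : kZero R K ≤ k) (t : ℝ) : barrier R K lam E (k + 1) t
    = profile R K lam (k + 1) (rTime R (k + 1)).toReal
      (barrier R K lam E k (rTime R (k + 1)).toReal) t := by
  rw [barrier, if_neg (by omega)]

/-- The `1/R_k` are geometric with ratio `1/√2`, and `√2 - 1 ≥ 2/5`. In this form an error `1/R_k`
per level telescopes. -/
theorem inv_level_succ (h : IsModulus R) (k : ℕ) :
    1 / level R (k + 1) ≤ 5 / 2 * (1 / level R k) - 5 / 2 * (1 / level R (k + 1)) := by
  have h1 := h.level_pos k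
  have h2 : (7 / 5 : ℝ) ≤ sqrt 2 := by exact Real.le_sqrt_of_sq_le (by norm_num)
  have h3 : 1 / level R k = sqrt 2 * (1 / level R (k + 1)) := by
    rw [level_succ]; field_simp
  have h4 : 0 < 1 / level R (k + 1) := one_div_pos.2 (h.level_pos _)
  rw [h3]
  nlinarith

theorem exists_toReal (h : IsModulus R) {k : ℕ} (hk : kZero R K ≤ k)
    (hfin : rTime R (k + 1) < ⊤) :
    rTime R (k + 1) = ((rTime R (k + 1)).toReal : EReal)
      ∧ initialTime R K ≤ (rTime R (k + 1)).toReal := by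
  obtain ⟨r, -, hr, -⟩ := h.exists_rTime_eq (k + 1) hfin
  have h1 := (h.lt_rTime_kZero_succ (K := K)).trans_le (rTime_mono R (Nat.succ_le_succ hk))
  rw [Nat.succ_eq_add_one, hr] at h1
  rw [hr, EReal.toReal_coe]
  exact ⟨rfl, (EReal.coe_lt_coe_iff.1 h1).le⟩

/-- Functions that decay like the barriers, up to a bounded factor, stay below them. -/
theorem le_barrier (h : IsModulus R) (hK : 0 < K) (hE : 0 ≤ E)
    (hD : ∀ k, rTime R k < ⊤ → 0 ≤ dwell R K lam k) {Y : ℝ → ℝ} {c T : ℝ} (hc : 0 ≤ c)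
    (hY0 : Y (initialTime R K) ≤ c * (E * exp (4 * constQ / R 0)))
    (hY : ∀ k (s t : ℝ), initialTime R K ≤ s → s ≤ t → t ≤ T → rTime R k ≤ (s : EReal) →
      (t : EReal) ≤ rTime R (k + 1) →
      Y t ≤ Y s * exp (-(K * level R k / 4 * (t - s)) + 100 / level R k))
    {k : ℕ} (hk : kZero R K ≤ k) :
    ∀ t : ℝ, t ≤ T → initialTime R K ≤ t → rTime R k ≤ (t : EReal) → (t : EReal) ≤ rTime R (k + 1) →
      0 ≤ barrier R K lam E k t ∧ Y t ≤ c * exp (400 / R 0 - 250 / level R k)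
        * barrier R K lam E k t := by
  have hpos := h.pos_zero
  induction k, hk using Nat.le_induction with
  | base =>
    intro t htT ht hkt htr
    have hℓ := h.level_pos (kZero R K)
    have hKℓ := mul_pos hK hℓ
    have h1 := hY _ _ t le_rfl ht htT (h.rTime_kZero_le hK) htr
    have h2 := le_profile hKℓ.le (A := E * exp (4 * constQ / R 0)) (by positivity) ht
      (hD _ (hkt.trans_lt (EReal.coe_lt_top t)))
    rw [← barrier_kZero] at h2
    refine ⟨le_trans (by positivity) h2, ?_⟩
    set ℓ := level R (kZero R K)
    have h3 : 100 / ℓ ≤ 400 / R 0 - 250 / ℓ := by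
      have : 350 / ℓ ≤ 400 / R 0 := by
        have := h.zero_le_level (kZero R K)
        gcongr
        norm_num
      have e : 350 / ℓ = 100 / ℓ + 250 / ℓ := by ring
      linarith
    calc Y t ≤ _ := h1
      _ ≤ c * (E * exp (4 * constQ / R 0)) * exp (-(K * ℓ / 4 * (t - initialTime R K)) + 100 / ℓ) :=
        by gcongr
      _ = c * exp (100 / ℓ) * (E * exp (4 * constQ / R 0)
          * exp (-(K * ℓ / 4 * (t - initialTime R K)))) := by rw [Real.exp_add]; ring
      _ ≤ _ := by gcongr
  | succ k hk ih =>
    intro t htT ht hkt htr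
    have hfin := hkt.trans_lt (EReal.coe_lt_top t)
    obtain ⟨hr, htr0⟩ := exists_toReal h hk hfin
    set r := (rTime R (k + 1)).toReal with hrdef
    have hℓ := h.level_pos (k + 1)
    have hKℓ := mul_pos hK hℓ
    rw [hr, EReal.coe_le_coe_iff] at hkt
    obtain ⟨h4, h5⟩ := ih r (hkt.trans htT) htr0 (hr ▸ rTime_le_succ R k) hr.ge
    have h1 := hY _ r t htr0 hkt htT hr.le htr
    have h2 := le_profile hKℓ.le h4 hkt (hD (k + 1) hfin)
    rw [hrdef, ← barrier_succ hk, ← hrdef] at h2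
    refine ⟨le_trans (by positivity) h2, ?_⟩
    have h3 := inv_level_succ h k
    set ℓ := level R (k + 1)
    -- The new error `100/R_{k+1}` is exactly what the increase of `-250/R_k` pays for.
    have h6 : 400 / R 0 - 250 / level R k + 100 / ℓ ≤ 400 / R 0 - 250 / ℓ := by
      have e1 : 250 / level R k = 250 * (1 / level R k) := by ring
      have e2 : 250 / ℓ = 250 * (1 / ℓ) := by ring
      have e3 : 100 / ℓ = 100 * (1 / ℓ) := by ring
      rw [e1, e2, e3]
      linarith
    calc Y t ≤ _ := h1
      _ ≤ c * exp (400 / R 0 - 250 / level R k) * barrier R K lam E k r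
          * exp (-(K * ℓ / 4 * (t - r)) + 100 / ℓ) := by gcongr
      _ = c * exp (400 / R 0 - 250 / level R k + 100 / ℓ) * (barrier R K lam E k r
          * exp (-(K * ℓ / 4 * (t - r)))) := by rw [Real.exp_add, Real.exp_add]; ring
      _ ≤ _ := by gcongr

/-- The barriers are bounded in terms of the dwell times. -/
theorem barrier_le (h : IsModulus R) (hK : 0 < K) (hE : 0 ≤ E) {Λ : ℝ} (hΛ : 0 ≤ Λ)
    (hD0 : ∀ k, rTime R k < ⊤ → 0 ≤ dwell R K lam k)
    (hD : ∀ k, rTime R k < ⊤ → K * level R k * dwell R K lam k ≤ Λ / level R k)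
    {k : ℕ} (hk : kZero R K ≤ k) :
    ∀ t : ℝ, initialTime R K ≤ t → rTime R k ≤ (t : EReal) →
      0 ≤ barrier R K lam E k t ∧ barrier R K lam E k t
        ≤ E * exp (4 * constQ / R 0) * exp (8 * Λ / R 0 - 5 * Λ / level R k) := by
  have hpos := h.pos_zero
  induction k, hk using Nat.le_induction with
  | base =>
    intro t ht hkt
    have hℓ := h.level_pos (kZero R K)
    have hKℓ := mul_pos hK hℓ
    have hfin := hkt.trans_lt (EReal.coe_lt_top t)
    have hA : 0 ≤ E * exp (4 * constQ / R 0) := by positivity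
    have h1 := le_profile hKℓ.le hA ht (hD0 _ hfin)
    have h2 := profile_le (lam := lam) (s := initialTime R K) (t := t) hKℓ.le hA
    rw [← barrier_kZero] at h1 h2
    refine ⟨le_trans (by positivity) h1, h2.trans ?_⟩
    have h3 := hD _ hfin
    set ℓ := level R (kZero R K)
    -- The first barrier gains at most `2 Λ / R_{k_0}` in the exponent, and `2 + 5 ≤ 8` leaves room
    -- for the term that telescopes afterwards.
    have h4 : 8 * Λ / ℓ ≤ 8 * Λ / R 0 := by
      have := h.zero_le_level (kZero R K)
      gcongr
    have h5 : 0 ≤ Λ / ℓ := by positivity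
    have e1 : 8 * Λ / ℓ = 8 * (Λ / ℓ) := by ring
    have e2 : 5 * Λ / ℓ = 5 * (Λ / ℓ) := by ring
    gcongr
    linarith
  | succ k hk ih =>
    intro t ht hkt
    have hfin := hkt.trans_lt (EReal.coe_lt_top t)
    obtain ⟨hr, htr0⟩ := exists_toReal h hk hfin
    set r := (rTime R (k + 1)).toReal with hrdef
    have hℓ := h.level_pos (k + 1)
    have hKℓ := mul_pos hK hℓ
    rw [hr, EReal.coe_le_coe_iff] at hkt
    obtain ⟨h4, h5⟩ := ih r htr0 (hr ▸ rTime_le_succ R k)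
    have h1 := le_profile hKℓ.le h4 hkt (hD0 (k + 1) hfin)
    have h2 := profile_le (lam := lam) (s := r) (t := t) hKℓ.le h4
    rw [hrdef, ← barrier_succ hk, ← hrdef] at h1 h2
    refine ⟨le_trans (by positivity) h1, h2.trans ?_⟩
    have h3 := hD (k + 1) hfin
    have h6 := mul_le_mul_of_nonneg_left (inv_level_succ h k) hΛ
    set ℓ := level R (k + 1)
    calc barrier R K lam E k r * exp (2 * (K * ℓ * dwell R K lam (k + 1)))
        ≤ E * exp (4 * constQ / R 0) * exp (8 * Λ / R 0 - 5 * Λ / level R k)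
          * exp (2 * (Λ / ℓ)) := by gcongr
      _ = E * exp (4 * constQ / R 0) * exp (8 * Λ / R 0 - 5 * Λ / level R k + 2 * (Λ / ℓ)) := by
          rw [Real.exp_add]; ring
      _ ≤ _ := by
          have e1 : Λ / ℓ = Λ * (1 / ℓ) := by ring
          have e2 : 5 * Λ / level R k = 5 * (Λ * (1 / level R k)) := by ring
          have e3 : 5 * Λ / ℓ = 5 * (Λ * (1 / ℓ)) := by ring
          gcongr
          rw [e1, e2, e3]
          linarith

end Barrier

/-! ## The main estimate -/

namespace IsModulus

variable {K : ℝ} {R : ℝ → ℝ}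

/-- Before `t_0` the threshold for `k = 0` already keeps `R'` positive. -/
theorem le_initialTime (h : IsModulus R) (hK : 0 < K) {r : ℝ} (hr : 0 ≤ r)
    (hrt : r ≤ initialTime R K) : R r ≤ R (initialTime R K) := by
  have h1 := add_le_of_deriv_ge (c := 0) hr hrt (h.cont.mono fun x hx => hr.trans hx.1)
    (fun x hx => h.deriv x (hr.trans hx.1)) fun x hx => by
      have h2 := h.lt_dotR_of_lt_initialTime (K := K) hx.2 (k := 0)
        (by simpa [rTime] using hr.trans hx.1)
      have h3 := h.level_pos 0
      refine le_trans ?_ h2.le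
      unfold constQ
      positivity
  linarith

theorem level_kZero_le (h : IsModulus R) (hK : 0 < K) :
    level R (kZero R K) ≤ R (initialTime R K) := by
  have h1 := h.rTime_kZero_le hK
  obtain ⟨r, hr0, hr, hle⟩ := h.exists_rTime_eq _ (h1.trans_lt (EReal.coe_lt_top _))
  rw [hr, EReal.coe_le_coe_iff] at h1
  exact hle.trans (h.le_initialTime hK hr0 h1)

/-- Before `t_0` one has `R' > K R_k³ / 3600` for the current level, while `R³ < 2√2 R_k³`; the
constant is `2.83 · 3600` rounded up. -/
theorem cube_le_dotR (h : IsModulus R) (hK : 0 < K) {t : ℝ} (ht : 0 ≤ t)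
    (htt : t < initialTime R K) : K * R t ^ 3 ≤ 10190 * dotR R t := by
  have hlt := EReal.coe_lt_top t
  have h1 := h.lt_dotR_of_lt_initialTime htt (h.rTime_indexAt_le hlt (EReal.coe_nonneg.2 ht))
  have h2 := h.sq_lt ht _ (h.lt_rTime_indexAt_succ hlt)
  have hℓ := h.level_pos (indexAt R t)
  set ℓ := level R (indexAt R t)
  have h3 : R t ≤ 1415 / 1000 * ℓ := (abs_le_of_sq_le_sq' (by nlinarith) (by positivity)).2
  have h4 := h.nonneg t
  have h5 : R t ^ 3 ≤ 283 / 100 * ℓ ^ 3 := by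
    calc R t ^ 3 = R t * R t ^ 2 := by ring
      _ ≤ (1415 / 1000 * ℓ) * (2 * ℓ ^ 2) := by gcongr
      _ = _ := by ring
  have h6 : K * R t ^ 3 ≤ K * (283 / 100 * ℓ ^ 3) := by gcongr
  unfold constQ at h1
  have h7 : 0 < K * ℓ ^ 3 := by positivity
  linarith

end IsModulus

theorem one_add_log_le {r : ℝ} (hr : 0 < r) (hr1 : r ≤ 1) :
    0 ≤ log (1 / r) ∧ 1 ≤ 2 * log (1 + 1 / r) ∧ 1 + log (1 / r) ≤ 3 * log (1 + 1 / r) := by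
  have h1 : 1 ≤ 1 / r := by rw [le_div_iff₀ hr]; linarith
  have h2 : log 2 ≤ log (1 + 1 / r) := Real.log_le_log (by norm_num) (by linarith)
  have h3 : log (1 / r) ≤ log (1 + 1 / r) := Real.log_le_log (by positivity) (by linarith)
  have h4 := Real.log_two_gt_d9
  exact ⟨Real.log_nonneg h1, by linarith, by linarith⟩

/-! ### Total and weighted norms below the barriers -/

namespace Flow

variable {K W w lam : ℝ} {a b : ℝ → ℝ} {F Ft Fθ : ℝ → ℝ × ℝ → ℝ} {R : ℝ → ℝ}

theorem sqNorm_initialTime_le (h : Flow K W a b F Ft Fθ) (hT : Tame K W w a b)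
    (hR : ∀ t, 0 ≤ t → R t = modulus a b t) (hnn : ∀ t, 0 ≤ R t) :
    sqNorm W F (initialTime R K) ≤ sqNorm W F 0 * exp (10190 / R 0) := by
  have hM := h.isModulus hT hR hnn
  exact h.sqNorm_le_of_growth hT hM hR (hM.initialTime_nonneg hT.K_pos) (by norm_num)
    fun t ht => hM.cube_le_dotR hT.K_pos ht.1 ht.2

/-- The total mass lies below the barriers for a short time. -/
theorem sqNorm_le_barrier (h : Flow K W a b F Ft Fθ) (hT : Tame K W w a b)
    (hR : ∀ t, 0 ≤ t → R t = modulus a b t) (hnn : ∀ t, 0 ≤ R t)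
    (hD : ∀ k, rTime R k < ⊤ → 0 ≤ dwell R K lam k) {k : ℕ} (hk : kZero R K ≤ k) {t : ℝ}
    (ht : initialTime R K ≤ t) (hkt : rTime R k ≤ (t : EReal))
    (htr : (t : EReal) ≤ rTime R (k + 1)) (hts : t ≤ initialTime R K + 1000 / (K * R 0)) :
    sqNorm W F t ≤ barrier R K lam (sqNorm W F 0) k t := by
  have hM := h.isModulus hT hR hnn
  have hK := hT.K_pos
  have hpos := hM.pos_zero
  have hE := h.sqNorm_nonneg 0
  have ht0 := hM.initialTime_nonneg hK
  set E := sqNorm W F 0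
  -- The comparison is applied to a pure exponential of rate `K/4`, which decays at least as fast as
  -- any barrier since `R_k ≤ 1`. This gives a lower bound for the barrier.
  have hb := le_barrier (lam := lam) (E := E) (T := t) (c := 1) hM hK hE hD
    (Y := fun t => E * exp (4 * constQ / R 0) * exp (-(K / 4 * (t - initialTime R K))))
    zero_le_one (by simp) (fun j s u hs hsu hut hjs hju => by
      have hℓ := hM.level_pos j
      have hℓ1 := hM.level_le_one (hjs.trans_lt (EReal.coe_lt_top s))
      rw [mul_assoc (E * _), ← Real.exp_add]
      gcongr
      have h1 : K * level R j / 4 * (u - s) ≤ K * 1 / 4 * (u - s) := by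
        gcongr
      have h2 : 0 ≤ 100 / level R j := by positivity
      linarith) hk t le_rfl ht hkt htr
  obtain ⟨hb0, hb⟩ := hb
  have hℓ := hM.level_pos k
  have h1 : E * exp (4 * constQ / R 0) * exp (-(K / 4 * (t - initialTime R K)))
      ≤ exp (400 / R 0) * barrier R K lam E k t := by
    refine hb.trans ?_
    rw [one_mul]
    gcongr
    have : 0 ≤ 250 / level R k := by positivity
    linarith
  have h2 : sqNorm W F t ≤ E * exp (10190 / R 0) * exp (1000 / R 0) := by
    refine (h.sqNorm_le_exp hK ht0 ht).trans ?_
    gcongr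
    · exact h.sqNorm_initialTime_le hT hR hnn
    · have : t - initialTime R K ≤ 1000 / (K * R 0) := by linarith
      calc K * (t - initialTime R K) ≤ K * (1000 / (K * R 0)) := by gcongr
        _ = 1000 / R 0 := by field_simp
  have h3 : K / 4 * (t - initialTime R K) ≤ 250 / R 0 := by
    have : t - initialTime R K ≤ 1000 / (K * R 0) := by linarith
    calc K / 4 * (t - initialTime R K) ≤ K / 4 * (1000 / (K * R 0)) := by gcongr
      _ = 250 / R 0 := by field_simp; norm_num
  -- The budget in units of `1/R_0`: growth before `t_0`, growth after it, comparison loss and decay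
  -- of the exponential cost `10190 + 1000 + 400 + 250`, less than `4 Q = 14400`.
  have h4 : E * exp (10190 / R 0) * exp (1000 / R 0) * exp (400 / R 0)
      ≤ E * exp (4 * constQ / R 0) * exp (-(K / 4 * (t - initialTime R K))) := by
    rw [mul_assoc, mul_assoc, mul_assoc, ← Real.exp_add, ← Real.exp_add, ← Real.exp_add]
    refine mul_le_mul_of_nonneg_left (Real.exp_le_exp.2 ?_) hE
    have e0 : 0 ≤ 1 / R 0 := by positivity
    have e1 : 10190 / R 0 = 10190 * (1 / R 0) := by ring
    have e2 : 1000 / R 0 = 1000 * (1 / R 0) := by ring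
    have e3 : 400 / R 0 = 400 * (1 / R 0) := by ring
    have e4 : 250 / R 0 = 250 * (1 / R 0) := by ring
    have e5 : 4 * constQ / R 0 = 14400 * (1 / R 0) := by unfold constQ; ring
    rw [e4] at h3
    rw [e1, e2, e3, e5]
    linarith
  have h5 : sqNorm W F t * exp (400 / R 0) ≤ barrier R K lam E k t * exp (400 / R 0) := by
    calc sqNorm W F t * exp (400 / R 0)
        ≤ E * exp (10190 / R 0) * exp (1000 / R 0) * exp (400 / R 0) := by gcongr
      _ ≤ _ := h4
      _ ≤ _ := h1
      _ = _ := mul_comm _ _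
  exact le_of_mul_le_mul_right h5 (Real.exp_pos _)

/-- The weighted functional in the frame of the initial cluster lies far below the barriers. -/
theorem weightedSq_le_barrier (h : Flow K W a b F Ft Fθ) (hT : Tame K W w a b)
    (hR : ∀ t, 0 ≤ t → R t = modulus a b t) (hnn : ∀ t, 0 ≤ R t)
    (hD : ∀ k, rTime R k < ⊤ → 0 ≤ dwell R K lam k) {ψ : ℝ → ℝ} {T : ℝ}
    (hψ : IsFrame K a b T ψ)
    (hM : ∀ u ∈ Ico (initialTime R K) T, (1 + 97 / 100 * R (initialTime R K)) / 2
      ≤ clusterMass W (R (initialTime R K) / 50) F u (ψ u))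
    {k : ℕ} (hk : kZero R K ≤ k) {t : ℝ} (ht : initialTime R K ≤ t) (htT : t < T)
    (hkt : rTime R k ≤ (t : EReal)) (htr : (t : EReal) ≤ rTime R (k + 1)) :
    50 / R 0 * weightedSq W (R 0 ^ 2 / 4000) F ψ t ≤ barrier R K lam (sqNorm W F 0) k t := by
  have hMod := h.isModulus hT hR hnn
  have hRat := h.ratchet hT hR hnn
  have hK := hT.K_pos
  have hpos := hMod.pos_zero
  have hE := h.sqNorm_nonneg 0
  have ht0 := hMod.initialTime_nonneg hK
  have hρ0 : R 0 ≤ R (initialTime R K) := hMod.le_initialTime hK le_rfl ht0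
  have hρ1 := hMod.le_one _ ht0
  have hS := h.sqNorm_initialTime_le hT hR hnn
  set ρ := R (initialTime R K)
  set E := sqNorm W F 0
  have hρ : 0 < ρ := hpos.trans_le hρ0
  have hη : 0 < R 0 ^ 2 / 4000 := by positivity
  -- `4210 = 4 Q - 10190` is the slack left by the growth before `t_0`. It covers the comparison
  -- loss `400` and the prefactor `100/R_0 ≤ exp (100/R_0)`.
  have hb := le_barrier (lam := lam) (E := E) (T := t) (c := 2 * exp (-(4210 / R 0))) hMod hK hE hD
    (Y := weightedSq W (R 0 ^ 2 / 4000) F ψ) (by positivity)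
    (by
      refine (h.weightedSq_le hη _).trans ?_
      have e : 2 * exp (-(4210 / R 0)) * (E * exp (4 * constQ / R 0))
          = 2 * (E * exp (-(4210 / R 0) + 4 * constQ / R 0)) := by rw [Real.exp_add]; ring
      have e2 : -(4210 / R 0) + 4 * constQ / R 0 = 10190 / R 0 := by unfold constQ; ring
      rw [e, e2]
      linarith)
    (fun j s u hs hsu hut hjs hju => by
      have hs0 : 0 ≤ s := ht0.trans hs
      have hℓ0 := hMod.zero_le_level j
      have hℓ1 := hMod.level_le_one (hjs.trans_lt (EReal.coe_lt_top s))
      have hM' : ∀ v ∈ Ico s u, (1 + 97 / 100 * ρ) / 2 ≤ clusterMass W (ρ / 50) F v (ψ v) :=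
        fun v hv => hM v ⟨hs.trans hv.1, hv.2.trans_le (hut.trans htT.le)⟩
      rw [hR 0 le_rfl] at hρ0 hℓ0 ⊢
      have h1 := h.weightedSq_decay hT hψ hρ0 hρ1 hs0 hsu (hut.trans_lt htT) hM'
      have h2 := h.integral_hComp_ge hT (κ := ρ / 50) (s := s) (t := u) hψ.cont (by positivity)
        (by linarith) hs0 hsu hℓ0 hℓ1 (fun v hv => by have := hM' v hv; linarith)
        (fun v hv => by
          have h3 := hM' v hv
          have h4 := h.hComp_ge (κ := ρ / 50) (by positivity) v (ψ v)
          linarith)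
        (fun v hv => (hRat.level_le j s hjs).trans (hRat.mono hv.1))
        (fun v hv => hRat.sq_le j v (hs0.trans hv.1)
          ((EReal.coe_lt_coe_iff.2 hv.2).trans_le hju))
      refine h1.trans ?_
      rw [← hR 0 le_rfl]
      have := h.weightedSq_nonneg (ψ := ψ) hη s
      gcongr
      linarith) hk t le_rfl ht hkt htr
  obtain ⟨hb0, hb⟩ := hb
  have hℓ := hMod.level_pos k
  have h1 : 100 / R 0 ≤ exp (100 / R 0) := by linarith [Real.add_one_le_exp (100 / R 0)]
  calc 50 / R 0 * weightedSq W (R 0 ^ 2 / 4000) F ψ t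
      ≤ 50 / R 0 * (2 * exp (-(4210 / R 0)) * exp (400 / R 0 - 250 / level R k)
        * barrier R K lam E k t) := by gcongr
    _ = 100 / R 0 * (exp (-(4210 / R 0)) * exp (400 / R 0 - 250 / level R k))
        * barrier R K lam E k t := by ring
    _ ≤ exp (100 / R 0) * (exp (-(4210 / R 0)) * exp (400 / R 0 - 250 / level R k))
        * barrier R K lam E k t := by gcongr
    _ ≤ 1 * barrier R K lam E k t := by
        gcongr
        rw [← Real.exp_add, ← Real.exp_add, Real.exp_le_one_iff]
        have e0 : 0 < 1 / R 0 := by positivity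
        have e1 : 100 / R 0 = 100 * (1 / R 0) := by ring
        have e2 : 4210 / R 0 = 4210 * (1 / R 0) := by ring
        have e3 : 400 / R 0 = 400 * (1 / R 0) := by ring
        have : 0 ≤ 250 / level R k := by positivity
        rw [e1, e2, e3]
        linarith
    _ = _ := one_mul _

end Flow

/-- The half-width `π/2 - γ` has cosine `sin γ = √(1 - c) ≥ 1 - c`. With `c = R_{k_0}/30` the arc
therefore starts inside the trapping region of the cluster. -/
theorem cos_ge_of_mem_arcPlus {c φ x : ℝ} (hc0 : 0 ≤ c) (hc1 : c ≤ 1)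
    (hx : x ∈ arcPlus (Real.arccos (sqrt c)) φ) : 1 - cos (x - φ) ≤ c := by
  obtain ⟨n, hn1, hn2⟩ := hx
  set γ := Real.arccos (sqrt c)
  have h1 : cos (x - φ) = cos |x + 2 * Real.pi * n - φ| := by
    rw [Real.cos_abs, ← Real.cos_add_int_mul_two_pi (x - φ) n]
    congr 1; ring
  have h2 : |x + 2 * Real.pi * n - φ| ≤ Real.pi / 2 - γ := abs_le.2 ⟨by linarith, by linarith⟩
  have hγ0 : 0 ≤ γ := Real.arccos_nonneg _
  have h3 : cos (Real.pi / 2 - γ) ≤ cos |x + 2 * Real.pi * n - φ| :=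
    Real.cos_le_cos_of_nonneg_of_le_pi (abs_nonneg _) (by linarith [Real.pi_pos]) h2
  rw [Real.cos_pi_div_two_sub, Real.sin_arccos, Real.sq_sqrt hc0] at h3
  have h4 : 1 - c ≤ sqrt (1 - c) := Real.le_sqrt_of_sq_le (by nlinarith)
  rw [h1]
  linarith

/-! ### The attractor and the final estimates -/

namespace IsClassicalSolution

variable {K W lam : ℝ} {f : ℝ → ℝ → ℝ → ℝ}

theorem W_nonneg (hf : IsClassicalSolution K f)
    (hW : Function.support (freqDist f) ⊆ Icc (-W) W) : 0 ≤ W := by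
  by_contra hneg
  have h1 := (hf.flow hW).mass 0
  rw [box, Icc_eq_empty (by linarith : ¬ -W ≤ W), prod_empty, setIntegral_empty] at h1
  exact zero_ne_one h1

theorem tame (hf : IsClassicalSolution K f) (hK : 0 < K)
    (hW : Function.support (freqDist f) ⊆ Icc (-W) W) (hpos : 0 < orderR f 0)
    (hWK : W / K ≤ 1 / 1000000 * orderR f 0 ^ 3) :
    Tame K W (orderR f 0 ^ 3 / 1000000) (extRe f) (extIm f) where
  K_pos := hK
  W_nonneg := hf.W_nonneg hW
  w_pos := by positivity
  W_le := by
    rw [div_le_iff₀ hK] at hWK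
    linarith
  w_le := by rw [orderR_eq le_rfl]
  R_pos := by rw [← orderR_eq le_rfl]; exact hpos

/-- Outside the attractor the gap to the centre of the cluster is bounded below. -/
theorem gap_ge_of_notMem_attractor (hf : IsClassicalSolution K f) (hK : 0 < K)
    (hW : Function.support (freqDist f) ⊆ Icc (-W) W)
    (hT : Tame K W (orderR f 0 ^ 3 / 1000000) (extRe f) (extIm f)) {ψ : ℝ → ℝ} {T t θ : ℝ}
    (hψ : IsFrame K (extRe f) (extIm f) T ψ)
    (hψ0 : ψ (initialTime (orderR f) K) = orderPhase f (initialTime (orderR f) K))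
    (hM : ∀ u ∈ Ico (initialTime (orderR f) K) T,
      (1 + 97 / 100 * orderR f (initialTime (orderR f) K)) / 2
        ≤ Flow.clusterMass W (orderR f (initialTime (orderR f) K) / 50) (ext f) u (ψ u))
    (ht : initialTime (orderR f) K + 1000 / (K * orderR f 0) ≤ t) (htT : t < T)
    (hθ : θ ∈ (attractor K W f t)ᶜ) : orderR f 0 / 40 ≤ 1 - cos (θ - ψ t) := by
  have h := hf.flow hW
  have hMod := h.isModulus hT (fun t ht => orderR_eq ht) fun t => norm_nonneg _
  have hpos := hMod.pos_zero
  have ht0 := hMod.initialTime_nonneg hK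
  have hρ0 := hMod.le_initialTime hK le_rfl ht0
  have hρ1 := hMod.le_one _ ht0
  have hlev := hMod.level_kZero_le hK
  have hlev0 := hMod.level_pos (kZero (orderR f) K)
  have hr1 := hMod.le_one 0 le_rfl
  set r := orderR f 0 with hr
  set t₀ := initialTime (orderR f) K
  set ρ := orderR f t₀
  set ℓ := level (orderR f) (kZero (orderR f) K)
  have hρ : 0 < ρ := hpos.trans_le hρ0
  have hKr : 0 < 1000 / (K * r) := by positivity
  simp only [attractor, cosNhd, mem_compl_iff, mem_ofPred_eq, not_forall, not_le] at hθ
  -- One transported point `x` at a gap larger than `ε = R_0/15` from `θ` is enough. As `x` is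
  -- almost at the centre, `one_sub_cos_sub_le` leaves nearly `R_0/30`, hence `R_0/40`.
  obtain ⟨_, ⟨ω, hω, x, hx, hxs, rfl⟩, hcos⟩ := hθ
  have hgap : 1 - cos (x t₀ - ψ t₀) ≤ 2 * (ρ / 50) := by
    rw [hψ0]
    refine (cos_ge_of_mem_arcPlus (c := ℓ / 30) (by positivity) (by linarith) hxs).trans ?_
    linarith
  have hWle := hT.W_le
  have hr3 : r ^ 3 ≤ r ^ 2 := pow_le_pow_of_le_one hpos.le hr1 (by norm_num)
  have hrρ2 : r ^ 2 ≤ ρ ^ 2 := by gcongr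
  have hρ2 : 0 < ρ ^ 2 := by positivity
  have h1 := h.char_gap_le hK hψ hρ
    (hWle.trans (by
      have : r ^ 3 / 1000000 ≤ ρ ^ 2 / 1000 := by linarith
      calc K * (r ^ 3 / 1000000) ≤ K * (ρ ^ 2 / 1000) := by gcongr
        _ = _ := by ring)) ht0 (by linarith : t₀ ≤ t) htT
    (fun u hu => hM u ⟨hu.1, hu.2.trans htT⟩)
    (fun s hs => by rw [← hf.velocity_eq_vel hs]; exact hx s hs) (abs_le.2 ⟨hω.1, hω.2⟩) hgap
  have h2 : W / (K * ρ) ≤ r / 1000000 := by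
    rw [div_le_iff₀ (by positivity)]
    have h3 : r ^ 3 ≤ r * ρ := by
      calc r ^ 3 ≤ r ^ 2 := hr3
        _ = r * r := sq r
        _ ≤ r * ρ := by gcongr
    calc W ≤ K * (r ^ 3 / 1000000) := hWle
      _ ≤ K * (r * ρ / 1000000) := by gcongr
      _ = _ := by ring
  have h3 : ρ * exp (-(K * ρ * (t - t₀))) ≤ r / 1000 := by
    have h4 : 1000 * ρ / r ≤ K * ρ * (t - t₀) := by
      calc 1000 * ρ / r = K * ρ * (1000 / (K * r)) := by field_simp
        _ ≤ _ := by gcongr; linarith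
    have h5 : 1000 * ρ / r ≤ exp (K * ρ * (t - t₀)) := by
      linarith [Real.add_one_le_exp (K * ρ * (t - t₀))]
    rw [Real.exp_neg, ← div_eq_mul_inv, div_le_iff₀ (Real.exp_pos _)]
    calc ρ = r / 1000 * (1000 * ρ / r) := by field_simp
      _ ≤ _ := by gcongr
  have h4 := one_sub_cos_sub_le (θ - ψ t) (x t - ψ t)
  rw [sub_sub_sub_cancel_right] at h4
  linarith

theorem sqMass_compl_attractor_le (hf : IsClassicalSolution K f) (hK : 0 < K)
    (hW : Function.support (freqDist f) ⊆ Icc (-W) W)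
    (hT : Tame K W (orderR f 0 ^ 3 / 1000000) (extRe f) (extIm f))
    (hD : ∀ k, rTime (orderR f) k < ⊤ → 0 ≤ dwell (orderR f) K lam k) {k : ℕ}
    (hk : kZero (orderR f) K ≤ k) {t : ℝ} (ht : initialTime (orderR f) K ≤ t)
    (hkt : rTime (orderR f) k ≤ (t : EReal)) (htr : (t : EReal) ≤ rTime (orderR f) (k + 1)) :
    sqMass f t (attractor K W f t)ᶜ ≤ barrier (orderR f) K lam (sqMass f 0 univ) k t := by
  have h := hf.flow hW
  have hR : ∀ t, 0 ≤ t → orderR f t = modulus (extRe f) (extIm f) t := fun t ht => orderR_eq ht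
  have hnn : ∀ t, 0 ≤ orderR f t := fun t => norm_nonneg _
  have hMod := h.isModulus hT hR hnn
  have hpos := hMod.pos_zero
  have hr1 := hMod.le_one 0 le_rfl
  have ht0 := hMod.initialTime_nonneg hK
  have htnn := ht0.trans ht
  have hA : MeasurableSet (attractor K W f t)ᶜ := (isClosed_cosNhd _ _).measurableSet.compl
  rw [hf.sqMass_univ hW le_rfl]
  -- Until the transported arc has contracted to the centre, its neighbourhood may miss part of the
  -- circle near the cluster, and only the total norm is used.
  rcases le_total t (initialTime (orderR f) K + 1000 / (K * orderR f 0)) with hts | hts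
  · exact (hf.sqMass_le hW htnn hA (Φ := fun _ => 1) continuous_const (fun _ => zero_le_one)
      fun _ _ => le_rfl).trans (h.sqNorm_le_barrier hT hR hnn hD hk ht hkt htr hts)
  have hg := hMod.dotR_initialTime_le hK
  rw [h.dotR_eq hT hR ht0] at hg
  obtain ⟨ψ, hψ, hψ0, hM⟩ := h.exists_initial_cluster hT
    (x := orderPhase f (initialTime (orderR f) K)) ht0 (by linarith : _ < t + 1)
    (by rw [← hR _ ht0, ← hR 0 le_rfl]; exact hMod.le_initialTime hK le_rfl ht0)
    (hMod.level_pos _).le (by rw [← hR _ ht0]; exact hMod.level_kZero_le hK) hg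
    (by
      rw [← hR _ ht0, extRe, max_eq_left ht0]
      exact (Complex.norm_mul_cos_arg _).symm)
    (by
      rw [← hR _ ht0, extIm, max_eq_left ht0]
      exact (Complex.norm_mul_sin_arg _).symm)
  rw [← hR _ ht0] at hM
  have hb := h.weightedSq_le_barrier (lam := lam) hT hR hnn hD hψ hM hk ht (by linarith) hkt htr
  have hη : 0 < orderR f 0 ^ 2 / 4000 := by positivity
  refine le_trans ?_ hb
  have hcw := continuous_weight hη
  have h1 := hf.sqMass_le hW htnn hA
    (Φ := fun p => 50 / orderR f 0 * weight (orderR f 0 ^ 2 / 4000) (1 - cos (p.1 - ψ t)))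
    (by fun_prop) (fun p => mul_nonneg (by positivity) (weight_nonneg hη _)) fun p hp => by
      -- Off the attractor the weight is at least `R_0/40 - 2 η` with `2 η = R_0²/2000`, hence at
      -- least `R_0/50`.
      have h2 := hf.gap_ge_of_notMem_attractor hK hW hT hψ hψ0 hM hts (by linarith) hp
      have h3 := le_weight hη (1 - cos (p.1 - ψ t))
      have h4 : orderR f 0 ^ 2 ≤ orderR f 0 := by nlinarith
      rw [div_mul_eq_mul_div, le_div_iff₀ hpos]
      linarith
  refine h1.trans_eq ?_
  rw [weightedSq, ← mean_const_mul]

theorem barrier_le_exp (hf : IsClassicalSolution K f) (hK : 0 < K)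
    (hW : Function.support (freqDist f) ⊆ Icc (-W) W) {R : ℝ → ℝ} (hR : IsModulus R)
    (hD : ∀ k, rTime R k < ⊤ → 0 ≤ dwell R K lam k ∧
      K * level R k * dwell R K lam k ≤ 9000 / level R k * (1 + log (1 / level R k)))
    {k : ℕ} (hk : kZero R K ≤ k) {t : ℝ} (ht : initialTime R K ≤ t)
    (hkt : rTime R k ≤ (t : EReal)) :
    barrier R K lam (sqMass f 0 univ) k t
      ≤ sqMass f 0 univ * exp (250000 / R 0 * log (1 + 1 / R 0)) := by
  have hE : 0 ≤ sqMass f 0 univ := by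
    rw [hf.sqMass_univ hW le_rfl]; exact (hf.flow hW).sqNorm_nonneg 0
  have hpos := hR.pos_zero
  obtain ⟨hl0, hl1, hl2⟩ := one_add_log_le hpos (hR.le_one 0 le_rfl)
  have hΛ : 0 ≤ 9000 * (1 + log (1 / R 0)) := by linarith
  have h1 := (barrier_le hR hK hE hΛ (fun k hk => (hD k hk).1) (fun j hj => by
    have hℓ := hR.level_pos j
    refine (hD j hj).2.trans ?_
    rw [div_mul_eq_mul_div]
    have : log (1 / level R j) ≤ log (1 / R 0) :=
      Real.log_le_log (by positivity) (by have := hR.zero_le_level j; gcongr)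
    gcongr) hk t ht hkt).2
  refine h1.trans ?_
  rw [mul_assoc, ← Real.exp_add]
  refine mul_le_mul_of_nonneg_left (Real.exp_le_exp.2 ?_) hE
  have hℓ := hR.level_pos k
  have h2 : 0 ≤ 5 * (9000 * (1 + log (1 / R 0))) / level R k := by positivity
  have h3 : 4 * constQ / R 0 + 8 * (9000 * (1 + log (1 / R 0))) / R 0
      = (14400 + 72000 * (1 + log (1 / R 0))) / R 0 := by unfold constQ; ring
  have h4 : 250000 / R 0 * log (1 + 1 / R 0) = 250000 * log (1 + 1 / R 0) / R 0 := by ring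
  -- With `1 ≤ 2 L` and `1 + log (1/R_0) ≤ 3 L` for `L = log (1 + 1/R_0)`, the left side is at most
  -- `244800 L / R_0`.
  have h5 : (14400 + 72000 * (1 + log (1 / R 0))) / R 0 ≤ 250000 * log (1 + 1 / R 0) / R 0 := by
    gcongr
    linarith
  linarith

end IsClassicalSolution

end Kuramoto


end

theorem theorem5p7 :
    ∃ C : ℝ, 0 < C ∧ ∃ B : ℝ, 0 < B ∧
      ∀ (K W lam : ℝ) (f : ℝ → ℝ → ℝ → ℝ),
        0 < K →
        Kuramoto.IsClassicalSolution K f →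
        Function.support (Kuramoto.freqDist f) ⊆ Set.Icc (-W) W →
        lam < 1 →
        W / K ≤ C * Kuramoto.orderR f 0 ^ 3 →
        1 - lam ≤ Real.cos Kuramoto.alpha ^ 2 / 180 * Kuramoto.orderR f 0 →
        ∀ k : ℕ,
          Kuramoto.kZero (Kuramoto.orderR f) K ≤ k →
          Kuramoto.rTime (Kuramoto.orderR f) k < ⊤ →
          (Kuramoto.goodSet (Kuramoto.orderR f) K lam k).Finite ∧
          (Kuramoto.badSet (Kuramoto.orderR f) K lam k).Finite ∧
          ∀ t : ℝ,
            Kuramoto.initialTime (Kuramoto.orderR f) K ≤ t →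
            Kuramoto.rTime (Kuramoto.orderR f) k ≤ (t : EReal) →
            (t : EReal) < Kuramoto.rTime (Kuramoto.orderR f) (k + 1) →
            Kuramoto.sqMass f t (Kuramoto.attractor K W f t)ᶜ
                ≤ Kuramoto.barrier (Kuramoto.orderR f) K lam
                    (Kuramoto.sqMass f 0 Set.univ) k t ∧
            Kuramoto.barrier (Kuramoto.orderR f) K lam (Kuramoto.sqMass f 0 Set.univ) k t
                ≤ Kuramoto.sqMass f 0 Set.univ *
                    Real.exp (B / Kuramoto.orderR f 0 *
                      Real.log (1 + 1 / Kuramoto.orderR f 0)) := by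
  refine ⟨1 / 1000000, by norm_num, 250000, by norm_num, ?_⟩
  intro K W lam f hK hf hW hlam hWK hlamR k hk hfin
  have hpos : 0 < Kuramoto.orderR f 0 := by
    -- Positivity of `R_0` is not assumed; it follows from `λ < 1` and the bound on `1 - λ`.
    have h1 : 0 < cos Kuramoto.alpha ^ 2 / 180 * Kuramoto.orderR f 0 := by linarith
    exact pos_of_mul_pos_right h1 (by positivity)
  have hT := hf.tame hK hW hpos hWK
  have hnn : ∀ t, 0 ≤ Kuramoto.orderR f t := fun t => norm_nonneg _
  have hRat := (hf.flow hW).ratchet hT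
    (fun t ht => Kuramoto.IsClassicalSolution.orderR_eq ht) hnn
  have hMod := hRat.toIsModulus
  have hD := fun j hj => hRat.dwell_bound (lam := lam) (k := j)
    (fun i => Kuramoto.mu_ge (hMod.level_pos i).le (hMod.le_one 0 le_rfl) hlamR) hj
  refine ⟨(hD k hfin).1, (hD k hfin).2.1, fun t ht hkt htr => ⟨?_, ?_⟩⟩
  · exact hf.sqMass_compl_attractor_le hK hW hT (fun j hj => (hD j hj).2.2.1) hk ht hkt htr.le
  · exact hf.barrier_le_exp hK hW hMod (fun j hj => (hD j hj).2.2) hk ht hkt
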